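/- Let $(X,d)$ be a complete and separable metric space with its topology $\tau$, let $m$ be a finite non-negative Borel measure on $X$, let $q\in(1,\infty)$, and let $L^0(X,m)$ be the real measurable functions modulo $m$-a.e. equality, with convergence in measure. *Notation.* For a distance $\rho$ on $X$ inducing $\tau$, let $\mathrm{Lip}_b(X,\rho)$ be the set of bounded $\rho$-Lipschitz functions $X\to\mathbb R$. For $f\in \mathrm{Lip}_b(X,\rho)$ let $$\mathrm{lip}_\rho f(x)=\inf_{U}\ \sup_{y,z\in U,\,y\ne z}\frac{|f(y)-f(z)|}{\rho(y,z)},$$ where $U$ ranges over the $\tau$-neighbourhoods of $x$ (and the supremum over the empty set is $0$). For $\mathcal B\subset \mathrm{Lip}_b(X,\rho)$ and $f\in L^0(X,m)$ let $$\mathrm{CE}_{\rho,q,\mathcal B}(f)=\inf\Big\{\liminf_{n\to\infty}\int_X(\mathrm{lip}_\rho f_n)^q\,dm:\ f_n\in\mathcal B,\ f_n\to f\text{ in }L^0(X,m)\Big\},$$ and let $D^{1,q}(X,\tau,\rho,m;\mathcal B)$ be the set of $f\in L^0(X,m)$ with $\mathrm{CE}_{\rho,q,\mathcal B}(f)<\infty$.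 A function $G\in L^q(X,m)$ is a $(\rho,q,\mathcal B)$-relaxed gradient of $f$ if there are $f_n\in\mathcal B$ and $\tilde G\in L^q(X,m)$ with $\mathrm{lip}_\rho f_n\in L^q(X,m)$, $f_n\to f$ in $L^0(X,m)$, $\mathrm{lip}_\rho f_n\rightharpoonup\tilde G$ weakly in $L^q(X,m)$ and $\tilde G\le G$ $m$-a.e. The relaxed gradient of $f$ of minimal $L^q$-norm is denoted by $|\mathrm Df|_{\star,\rho,q,\mathcal B}$. If $\mathcal B=\mathrm{Lip}_b(X,\rho)$, it is dropped from the notation. The length distance of $d$ is $$\hat d(x,y)=\inf\{\ell_d(\gamma):\ \gamma:[0,1]\to (X,d)\text{ Lipschitz},\ \gamma(0)=x,\ \gamma(1)=y\}\in[0,\infty],$$ where $\ell_d(\gamma)$ is the $d$-length of $\gamma$. **Theorem.** Let $\mathcal A\subset\mathrm{Lip}_b(X,d)$ be a subalgebra that contains the constants and separates the points of $X$ (for all $x\neq y$ in $X$ there is $f\in\mathcal A$ with $f(x)\ne f(y)$). Let $\delta$ be a distance on $X$ such that (a) $(X,\delta)$ is separable; (b) the topology induced by $\delta$ is $\tau$;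 (c) $d\wedge 1\le\delta\le\hat d$ on $X\times X$. Let $Y\subset X$ be a countable $d$-dense set such that, for every $y\in Y$, the function $d_y:=d(y,\cdot)$ satisfies $$d_y\in D^{1,q}(X,\tau,\delta,m;\mathcal A)\quad\text{and}\quad |\mathrm D d_y|_{\star,\delta,q,\mathcal A}\le 1\quad m\text{-a.e.}$$ Then $\mathcal A$ is dense in $q$-energy in $D^{1,q}(X,\tau,\delta,m)$: for every $f\in D^{1,q}(X,\tau,\delta,m)$ there is a sequence $(f_n)_n\subset\mathcal A$ such that $$f_n\to f\ \ m\text{-a.e. in }X,\qquad \mathrm{lip}_\delta f_n\to|\mathrm Df|_{\star,\delta,q}\ \ \text{strongly in }L^q(X,m).$$ -/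

import Mathlib

open MeasureTheory Filter Topology Set
open scoped ENNReal NNReal

namespace MetricSobolev

/-- `d` is a (finite) distance on `X`, written with values in `[0,∞]`. -/
structure IsDistance {X : Type*} (d : X → X → ℝ≥0∞) : Prop where
  eq_zero_iff : ∀ x y, d x y = 0 ↔ x = y
  symm : ∀ x y, d x y = d y x
  triangle : ∀ x y z, d x z ≤ d x y + d y z
  ne_top : ∀ x y, d x y ≠ ∞

/-- The topology induced by the distance `d` is the given topology of `X`. -/
def InducesTopology {X : Type*} [TopologicalSpace X] (d : X → X → ℝ≥0∞) : Prop :=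
  ∀ U : Set X, IsOpen U ↔ ∀ x ∈ U, ∃ r : ℝ≥0∞, 0 < r ∧ ∀ y, d x y < r → y ∈ U

/-- `X` has a countable subset that is dense with respect to the distance `d`. -/
def IsSeparableDist {X : Type*} (d : X → X → ℝ≥0∞) : Prop :=
  ∃ S : Set X, S.Countable ∧ ∀ x, ∀ r : ℝ≥0∞, 0 < r → ∃ s ∈ S, d x s < r

/-- The length (extended) distance generated by the distance of a metric space `X`: the infimum
of the lengths of the Lipschitz curves `γ : [0,1] → X` from `x` to `y`. The length of `γ` is its
variation on `[0,1]`; curves are represented by maps on `ℝ`, only `[0,1]` matters. -/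
noncomputable def lengthDist {X : Type*} [MetricSpace X] (x y : X) : ℝ≥0∞ :=
  ⨅ (γ : ℝ → X) (_ : ∃ K : ℝ≥0, LipschitzOnWith K γ (Icc 0 1)) (_ : γ 0 = x) (_ : γ 1 = y),
    eVariationOn γ (Icc 0 1)

/-- The `d`-Lipschitz constant of `f` on the set `s`, in `[0,∞]` (it is `0` when `s` has at most
one point). -/
noncomputable def lipConst {X : Type*} (d : X → X → ℝ≥0∞) (s : Set X) (f : X → ℝ) : ℝ≥0∞ :=
  ⨆ (x ∈ s) (y ∈ s) (_ : x ≠ y), ENNReal.ofReal |f x - f y| / d x y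

/-- The asymptotic Lipschitz constant of `f` at `x`: the infimum over the neighbourhoods of `x`
(in the topology of `X`) of the `d`-Lipschitz constants. -/
noncomputable def asympLip {X : Type*} [TopologicalSpace X] (d : X → X → ℝ≥0∞) (f : X → ℝ)
    (x : X) : ℝ≥0∞ :=
  ⨅ U ∈ 𝓝 x, lipConst d U f

/-- The bounded, continuous and `d`-Lipschitz functions. -/
def lipB {X : Type*} [TopologicalSpace X] (d : X → X → ℝ≥0∞) : Set (X → ℝ) :=
  {f | Continuous f ∧ (∃ C : ℝ, ∀ x, |f x| ≤ C) ∧ lipConst d univ f < ∞}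

/-- Local convergence in measure: convergence in measure on every set of finite measure. -/
def TendstoL0 {X : Type*} [MeasurableSpace X] (m : Measure X) (u : ℕ → X → ℝ)
    (f : X →ₘ[m] ℝ) : Prop :=
  ∀ s : Set X, MeasurableSet s → m s < ∞ → TendstoInMeasure (m.restrict s) u atTop f

section

variable {X : Type*} [TopologicalSpace X] [MeasurableSpace X]

/-- The pre-Cheeger energy `∫ (lip_d f)^q dm`. -/
noncomputable def preCheeger (d : X → X → ℝ≥0∞) (m : Measure X) (q : ℝ≥0∞) (f : X → ℝ) : ℝ≥0∞ :=
  ∫⁻ x, asympLip d f x ^ q.toReal ∂m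

/-- The `(q,𝒜)`-Cheeger energy: the relaxation of the pre-Cheeger energy of functions in `𝒜`
with respect to local convergence in measure. -/
noncomputable def cheeger (d : X → X → ℝ≥0∞) (m : Measure X) (q : ℝ≥0∞) (𝒜 : Set (X → ℝ))
    (f : X →ₘ[m] ℝ) : ℝ≥0∞ :=
  ⨅ (u : ℕ → X → ℝ) (_ : ∀ n, u n ∈ 𝒜) (_ : TendstoL0 m u f),
    liminf (fun n => preCheeger d m q (u n)) atTop

/-- The space `D^{1,q}(X,τ,d,m;𝒜)` of functions with finite `(q,𝒜)`-Cheeger energy. -/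
def D1 (d : X → X → ℝ≥0∞) (m : Measure X) (q : ℝ≥0∞) (𝒜 : Set (X → ℝ)) : Set (X →ₘ[m] ℝ) :=
  {f | cheeger d m q 𝒜 f < ∞}

/-- `G` is a `(q,𝒜)`-relaxed gradient of `f`: some `u n ∈ 𝒜` converge to `f` locally in measure
while `lip_d (u n)` converges weakly in `L^q` to some `G' ≤ G`. -/
def IsRelaxedGradient (d : X → X → ℝ≥0∞) (m : Measure X) (q : ℝ≥0∞) [Fact (1 ≤ q)]
    (𝒜 : Set (X → ℝ)) (f : X →ₘ[m] ℝ) (G : Lp ℝ q m) : Prop :=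
  ∃ (u : ℕ → X → ℝ) (h : ∀ n, MemLp (fun x => (asympLip d (u n) x).toReal) q m) (G' : Lp ℝ q m),
    (∀ n, u n ∈ 𝒜) ∧ TendstoL0 m u f ∧
    (∀ φ : StrongDual ℝ (Lp ℝ q m), Tendsto (fun n => φ ((h n).toLp)) atTop (𝓝 (φ G'))) ∧
    G' ≤ᵐ[m] G

/-- `G` is the minimal `(q,𝒜)`-relaxed gradient of `f`: the one of least `L^q`-norm. -/
def IsMinRelaxedGradient (d : X → X → ℝ≥0∞) (m : Measure X) (q : ℝ≥0∞) [Fact (1 ≤ q)]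
    (𝒜 : Set (X → ℝ)) (f : X →ₘ[m] ℝ) (G : Lp ℝ q m) : Prop :=
  IsRelaxedGradient d m q 𝒜 f G ∧
    ∀ G' : Lp ℝ q m, IsRelaxedGradient d m q 𝒜 f G' → ‖G‖ ≤ ‖G'‖

/-- `𝒜` is dense in `q`-energy in `D^{1,q}(X,τ,d,m) = D^{1,q}(X,τ,d,m; Lip_b(X,τ,d))`: every `f`
in this space has a minimal relaxed gradient `G`, and there are `u n ∈ 𝒜` with `u n → f` almost
everywhere and `lip_d (u n) → G` strongly in `L^q`. -/
def DenseInEnergy (d : X → X → ℝ≥0∞) (m : Measure X) (q : ℝ≥0∞) [Fact (1 ≤ q)]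
    (𝒜 : Set (X → ℝ)) : Prop :=
  ∀ f ∈ D1 d m q (lipB d), ∃ G : Lp ℝ q m, IsMinRelaxedGradient d m q (lipB d) f G ∧
    ∃ (u : ℕ → X → ℝ) (h : ∀ n, MemLp (fun x => (asympLip d (u n) x).toReal) q m),
      (∀ n, u n ∈ 𝒜) ∧ (∀ᵐ x ∂m, Tendsto (fun n => u n x) atTop (𝓝 (f x))) ∧
      Tendsto (fun n => (h n).toLp) atTop (𝓝 G)

end

/-- The (class of the) function `x ↦ d(y,x)` in `L^0(X,m)`. -/
noncomputable def distFrom {X : Type*} [MetricSpace X] [MeasurableSpace X] [BorelSpace X]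
    (m : Measure X) (y : X) : X →ₘ[m] ℝ :=
  AEEqFun.mk (fun x => dist y x) (continuous_const.dist continuous_id).aestronglyMeasurable

end MetricSobolev

/-! ### Calculus of the asymptotic Lipschitz constant -/

namespace MetricSobolev

/-! Everything reduces to one claim, `ApproxGrad.of_mem_lipB`: for every bounded `δ`-Lipschitz `f`,
the function `lip_δ f` is a gradient bound of `f` that is reached by elements of the algebra. The
relation used is `ApproxGrad`, a strong form of relaxed gradient in which only the positive part of
`lip u - G` has to vanish in `L^q`. It is monotone in `G` and closed under joint limits. By uniform
convexity of `L^q`, bounded slopes always produce such a bound (`ApproxGrad.exists_of_bounded`), so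
minimal bounds exist and weak relaxed gradients give nothing more. Once the claim is known, the
algebra and `lipB δ` have the same bounds, hence the same minimal one. Minimality prevents the
slopes of an approximating sequence from losing norm, and this makes their convergence strong
(`denseInEnergy_of_approxGrad`).

The difficulty is that `f` is Lipschitz for `δ`, perhaps not for `d`, while the hypothesis on the
functions `d_y` speaks about `d`. Composition with polynomials gives a chain rule
(`ApproxGrad.combination`), hence stability under minima and locality on coincidence sets. A
`K`-Lipschitz function for `d` is an infimum of cones `F y + K d_y` with `y ∈ Y`, so it has the
bound `K`; locality and minimality improve `K` to any continuous majorant of the local Lipschitz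
constants (`ApproxGrad.of_locally_lipschitz`).

It remains to approximate `f` by `d`-Lipschitz functions with the right local constants. For
continuous `g ≥ lip_δ f`, let `F n x` be the infimum of `f (p 0) + ∑ G n (p i) d(p i, p (i+1))` over
chains ending at `x` with steps at most `1/(n+1)`, where `G n` is `g + ε` plus a penalty far from
large compact sets. Then `F n ≤ f`, and `F n` has local `d`-Lipschitz constant at most `G n`. If `F
n x` stayed well below `f x`, almost optimal chains, parametrized by their cost, would converge to a
curve: the penalty supplies compactness. Along it the `d`-speed is locally at most `1/(g + ε/2)`;
since `δ ≤ \hat d`, `f` then grows by at most the cost, a contradiction (`le_of_chain_cost_le`). The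
penalty is small in `L^q` because the compact sets carry almost all the mass. Letting `ε → 0` and
`g` tend to `lip_δ f` finishes the proof. -/

theorem lipConst_le_ofReal {X : Type*} {δ : X → X → ℝ≥0∞} (hδ : IsDistance δ) {s : Set X}
    {u : X → ℝ} {a : ℝ}
    (h : ∀ y ∈ s, ∀ z ∈ s, |u y - u z| ≤ a * (δ y z).toReal) :
    lipConst δ s u ≤ ENNReal.ofReal a := by
  unfold lipConst
  refine iSup_le fun y => iSup_le fun hy => iSup_le fun z => iSup_le fun hz => iSup_le fun hyz => ?_
  have h0 : δ y z ≠ 0 := fun h0 => hyz ((hδ.eq_zero_iff y z).1 h0)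
  have ht := hδ.ne_top y z
  rw [ENNReal.div_le_iff h0 ht]
  calc ENNReal.ofReal |u y - u z| ≤ ENNReal.ofReal (a * (δ y z).toReal) :=
        ENNReal.ofReal_le_ofReal (h y hy z hz)
    _ = ENNReal.ofReal a * δ y z := by
        rw [ENNReal.ofReal_mul' ENNReal.toReal_nonneg, ENNReal.ofReal_toReal ht]

theorem abs_sub_le_of_lipConst_le {X : Type*} {δ : X → X → ℝ≥0∞} (hδ : IsDistance δ) {s : Set X}
    {u : X → ℝ} {a : ℝ} (ha : 0 ≤ a) (h : lipConst δ s u ≤ ENNReal.ofReal a)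
    {y z : X} (hy : y ∈ s) (hz : z ∈ s) : |u y - u z| ≤ a * (δ y z).toReal := by
  by_cases hyz : y = z
  · subst hyz; simpa using mul_nonneg ha ENNReal.toReal_nonneg
  have h0 : δ y z ≠ 0 := fun h0 => hyz ((hδ.eq_zero_iff y z).1 h0)
  have ht := hδ.ne_top y z
  have h1 : ENNReal.ofReal |u y - u z| / δ y z ≤ ENNReal.ofReal a := by
    refine le_trans ?_ h
    unfold lipConst
    exact le_iSup_of_le y (le_iSup_of_le hy (le_iSup_of_le z (le_iSup_of_le hz
      (le_iSup_of_le hyz le_rfl))))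
  rw [ENNReal.div_le_iff h0 ht, ← ENNReal.ofReal_toReal ht,
    ← ENNReal.ofReal_mul ha] at h1
  exact (ENNReal.ofReal_le_ofReal_iff (mul_nonneg ha ENNReal.toReal_nonneg)).1 h1

theorem mem_lipB_of_bound {X : Type*} [TopologicalSpace X] {δ : X → X → ℝ≥0∞} (hδ : IsDistance δ)
    {u : X → ℝ} (hc : Continuous u) {C a : ℝ} (hC : ∀ x, |u x| ≤ C)
    (h : ∀ y z, |u y - u z| ≤ a * (δ y z).toReal) : u ∈ lipB δ :=
  ⟨hc, ⟨C, hC⟩, (lipConst_le_ofReal hδ fun y _ z _ => h y z).trans_lt ENNReal.ofReal_lt_top⟩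

/-- The asymptotic Lipschitz constant as a real function. -/
noncomputable def lipSlope {X : Type*} [TopologicalSpace X] (δ : X → X → ℝ≥0∞) (u : X → ℝ)
    (x : X) : ℝ := (asympLip δ u x).toReal

section

variable {X : Type*} [TopologicalSpace X] {δ : X → X → ℝ≥0∞}

theorem lipSlope_nonneg (u : X → ℝ) (x : X) : 0 ≤ lipSlope δ u x := ENNReal.toReal_nonneg

theorem asympLip_le_lipConst_univ (u : X → ℝ) (x : X) :
    asympLip δ u x ≤ lipConst δ univ u :=
  iInf₂_le univ univ_mem

theorem asympLip_ne_top {u : X → ℝ} (hu : u ∈ lipB δ) (x : X) : asympLip δ u x ≠ ∞ :=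
  ((asympLip_le_lipConst_univ u x).trans_lt hu.2.2).ne

theorem lipSlope_le_const {u : X → ℝ} (hu : u ∈ lipB δ) (x : X) :
    lipSlope δ u x ≤ (lipConst δ univ u).toReal :=
  ENNReal.toReal_mono hu.2.2.ne (asympLip_le_lipConst_univ u x)

/-- A neighbourhood of `x` is a neighbourhood of all points near `x`, so a Lipschitz constant found
at `x` persists around it. This is upper semicontinuity, which gives measurability and the
continuous majorants used later. -/
theorem isOpen_asympLip_lt (u : X → ℝ) (a : ℝ≥0∞) : IsOpen {x | asympLip δ u x < a} := by
  rw [isOpen_iff_mem_nhds]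
  intro x hx
  simp only [Set.mem_ofPred_eq, asympLip, iInf_lt_iff] at hx
  obtain ⟨U, hU, hlt⟩ := hx
  filter_upwards [eventually_mem_nhds_iff.2 hU] with y hy
  exact (iInf₂_le U hy).trans_lt hlt

theorem measurable_asympLip [MeasurableSpace X] [BorelSpace X] (u : X → ℝ) :
    Measurable (asympLip δ u) :=
  measurable_of_Iio fun a => (isOpen_asympLip_lt u a).measurableSet

theorem measurable_lipSlope [MeasurableSpace X] [BorelSpace X] (u : X → ℝ) :
    Measurable (lipSlope δ u) := (measurable_asympLip u).ennreal_toReal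

theorem eventually_lipSlope_lt {u : X → ℝ} (hu : u ∈ lipB δ) {x : X} {a : ℝ}
    (h : lipSlope δ u x < a) : ∀ᶠ y in 𝓝 x, lipSlope δ u y < a := by
  have ha : 0 < a := (lipSlope_nonneg u x).trans_lt h
  have hx : asympLip δ u x < ENNReal.ofReal a :=
    (ENNReal.lt_ofReal_iff_toReal_lt (asympLip_ne_top hu x)).2 h
  filter_upwards [(isOpen_asympLip_lt u _).mem_nhds hx] with y hy
  exact (ENNReal.lt_ofReal_iff_toReal_lt (asympLip_ne_top hu y)).1 hy

theorem lipSlope_spec (hδ : IsDistance δ) {u : X → ℝ} (hu : u ∈ lipB δ) (x : X) {ε : ℝ}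
    (hε : 0 < ε) :
    ∃ U ∈ 𝓝 x, ∀ y ∈ U, ∀ z ∈ U, |u y - u z| ≤ (lipSlope δ u x + ε) * (δ y z).toReal := by
  have h0 := lipSlope_nonneg (δ := δ) u x
  have hx : asympLip δ u x < ENNReal.ofReal (lipSlope δ u x + ε) :=
    (ENNReal.lt_ofReal_iff_toReal_lt (asympLip_ne_top hu x)).2
      (lt_add_of_pos_right (lipSlope δ u x) hε)
  simp only [asympLip, iInf_lt_iff] at hx
  obtain ⟨U, hU, hlt⟩ := hx
  exact ⟨U, hU, fun y hy z hz => abs_sub_le_of_lipConst_le hδ (by linarith) hlt.le hy hz⟩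

theorem lipSlope_le (hδ : IsDistance δ) {u : X → ℝ} {x : X} {a : ℝ} (ha : 0 ≤ a)
    (h : ∀ ε > 0, ∃ U ∈ 𝓝 x, ∀ y ∈ U, ∀ z ∈ U, |u y - u z| ≤ (a + ε) * (δ y z).toReal) :
    lipSlope δ u x ≤ a := by
  refine le_of_forall_pos_le_add fun ε hε => ?_
  obtain ⟨U, hU, hUl⟩ := h ε hε
  exact ENNReal.toReal_le_of_le_ofReal (by linarith)
    ((iInf₂_le U hU).trans (lipConst_le_ofReal hδ hUl))

theorem lipSlope_affine_le (hδ : IsDistance δ) {u v : X → ℝ} (hu : u ∈ lipB δ) (hv : v ∈ lipB δ)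
    (a b c : ℝ) (x : X) :
    lipSlope δ (fun y => a + b * u y + c * v y) x
      ≤ |b| * lipSlope δ u x + |c| * lipSlope δ v x := by
  have hu0 := lipSlope_nonneg (δ := δ) u x
  have hv0 := lipSlope_nonneg (δ := δ) v x
  refine lipSlope_le hδ (by positivity) fun ε hε => ?_
  have hη : 0 < ε / (|b| + |c| + 1) := by positivity
  obtain ⟨U, hU, h1⟩ := lipSlope_spec hδ hu x hη
  obtain ⟨V, hV, h2⟩ := lipSlope_spec hδ hv x hη
  refine ⟨U ∩ V, inter_mem hU hV, fun y hy z hz => ?_⟩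
  have e1 := h1 y hy.1 z hz.1
  have e2 := h2 y hy.2 z hz.2
  have hd : 0 ≤ (δ y z).toReal := ENNReal.toReal_nonneg
  have key : (|b| + |c|) * (ε / (|b| + |c| + 1)) ≤ ε := by
    rw [mul_div_assoc', div_le_iff₀ (by positivity)]; nlinarith [abs_nonneg b, abs_nonneg c]
  calc |a + b * u y + c * v y - (a + b * u z + c * v z)|
      = |b * (u y - u z) + c * (v y - v z)| := by congr 1; ring
    _ ≤ |b| * |u y - u z| + |c| * |v y - v z| := by
        rw [← abs_mul, ← abs_mul]; exact abs_add_le _ _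
    _ ≤ |b| * ((lipSlope δ u x + ε / (|b| + |c| + 1)) * (δ y z).toReal)
        + |c| * ((lipSlope δ v x + ε / (|b| + |c| + 1)) * (δ y z).toReal) := by gcongr
    _ = (|b| * lipSlope δ u x + |c| * lipSlope δ v x
        + (|b| + |c|) * (ε / (|b| + |c| + 1))) * (δ y z).toReal := by ring
    _ ≤ _ := by gcongr

/-- By the mean value theorem the increment is `ψ ξ` times that of `u₁` plus `1 - ψ ξ` times that of
`u₂`; both weights are non-negative, and `ξ` is close to `u₁ x - u₂ x`. The sign condition on `ψ` is
needed only on the range of `u₁ - u₂`, which leaves room for polynomials. -/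
theorem lipSlope_combination_le (hδ : IsDistance δ) {u₁ u₂ : X → ℝ} (hu₁ : u₁ ∈ lipB δ)
    (hu₂ : u₂ ∈ lipB δ) {φ ψ : ℝ → ℝ} (hφ : ∀ t, HasDerivAt φ (ψ t) t) (hψ : Continuous ψ)
    {C : ℝ} (hC : ∀ x, |u₁ x - u₂ x| ≤ C) (hψ01 : ∀ t, |t| ≤ C → 0 ≤ ψ t ∧ ψ t ≤ 1) (x : X) :
    lipSlope δ (fun y => u₂ y + φ (u₁ y - u₂ y)) x ≤
      ψ (u₁ x - u₂ x) * lipSlope δ u₁ x + (1 - ψ (u₁ x - u₂ x)) * lipSlope δ u₂ x := by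
  set s₁ := lipSlope δ u₁ x with hs₁
  set s₂ := lipSlope δ u₂ x with hs₂
  have h10 : 0 ≤ s₁ := lipSlope_nonneg u₁ x
  have h20 : 0 ≤ s₂ := lipSlope_nonneg u₂ x
  obtain ⟨hx0, hx1⟩ := hψ01 _ (hC x)
  refine lipSlope_le hδ
    (add_nonneg (mul_nonneg hx0 h10) (mul_nonneg (by linarith) h20)) fun ε hε => ?_
  obtain ⟨U, hU, h1⟩ := lipSlope_spec hδ hu₁ x (half_pos hε)
  obtain ⟨V, hV, h2⟩ := lipSlope_spec hδ hu₂ x (half_pos hε)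
  set η := ε / 2 / (s₁ + s₂ + 1) with hη
  have hηp : 0 < η := by positivity
  obtain ⟨r, hr, hrψ⟩ := Metric.continuousAt_iff.1 (hψ.continuousAt (x := u₁ x - u₂ x)) η hηp
  have hw : Continuous fun y => u₁ y - u₂ y := hu₁.1.sub hu₂.1
  have hW : {y | dist (u₁ y - u₂ y) (u₁ x - u₂ x) < r} ∈ 𝓝 x :=
    (hw.tendsto x).eventually (Metric.ball_mem_nhds _ hr)
  refine ⟨U ∩ V ∩ _, inter_mem (inter_mem hU hV) hW, fun y hy z hz => ?_⟩
  have e1 := h1 y hy.1.1 z hz.1.1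
  have e2 := h2 y hy.1.2 z hz.1.2
  set D := (δ y z).toReal
  have hd : 0 ≤ D := ENNReal.toReal_nonneg
  obtain ⟨ξ, hξ, hmv⟩ : ∃ ξ ∈ uIcc (u₁ z - u₂ z) (u₁ y - u₂ y),
      φ (u₁ y - u₂ y) - φ (u₁ z - u₂ z) = ψ ξ * ((u₁ y - u₂ y) - (u₁ z - u₂ z)) := by
    have hcont : Continuous φ := continuous_iff_continuousAt.2 fun t => (hφ t).continuousAt
    rcases lt_trichotomy (u₁ z - u₂ z) (u₁ y - u₂ y) with h | h | h
    · obtain ⟨c, hc, he⟩ := exists_hasDerivAt_eq_slope φ ψ h hcont.continuousOn fun t _ => hφ t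
      refine ⟨c, by rw [uIcc_of_le h.le]; exact Ioo_subset_Icc_self hc, ?_⟩
      rw [he, div_mul_cancel₀ _ (by linarith)]
    · exact ⟨_, left_mem_uIcc, by rw [h]; ring⟩
    · obtain ⟨c, hc, he⟩ := exists_hasDerivAt_eq_slope φ ψ h hcont.continuousOn fun t _ => hφ t
      refine ⟨c, by rw [uIcc_of_ge h.le]; exact Ioo_subset_Icc_self hc, ?_⟩
      have : u₁ z - u₂ z - (u₁ y - u₂ y) ≠ 0 := by linarith
      rw [he]; field_simp; ring
  have hξC : |ξ| ≤ C := by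
    have : uIcc (u₁ z - u₂ z) (u₁ y - u₂ y) ⊆ Icc (-C) C :=
      uIcc_subset_Icc (abs_le.1 (hC z)) (abs_le.1 (hC y))
    exact abs_le.2 (this hξ)
  have hξr : dist ξ (u₁ x - u₂ x) < r := by
    have : uIcc (u₁ z - u₂ z) (u₁ y - u₂ y) ⊆ Metric.ball (u₁ x - u₂ x) r :=
      (convex_ball _ _).ordConnected.uIcc_subset hz.2 hy.2
    exact this hξ
  obtain ⟨k0, k1⟩ := hψ01 ξ hξC
  have hclose : |ψ ξ - ψ (u₁ x - u₂ x)| < η := by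
    simpa [Real.dist_eq] using hrψ hξr
  have hη2 : η * (s₁ + s₂) ≤ ε / 2 := by
    rw [hη, div_mul_eq_mul_div, div_le_iff₀ (by positivity)]; nlinarith
  calc |u₂ y + φ (u₁ y - u₂ y) - (u₂ z + φ (u₁ z - u₂ z))|
      = |ψ ξ * (u₁ y - u₁ z) + (1 - ψ ξ) * (u₂ y - u₂ z)| := by
        congr 1; linear_combination hmv
    _ ≤ ψ ξ * |u₁ y - u₁ z| + (1 - ψ ξ) * |u₂ y - u₂ z| := by
        refine (abs_add_le _ _).trans ?_
        rw [abs_mul, abs_mul, abs_of_nonneg k0, abs_of_nonneg (by linarith : 0 ≤ 1 - ψ ξ)]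
    _ ≤ ψ ξ * ((s₁ + ε / 2) * D) + (1 - ψ ξ) * ((s₂ + ε / 2) * D) := by
        have : 0 ≤ 1 - ψ ξ := by linarith
        gcongr
    _ = (ψ (u₁ x - u₂ x) * s₁ + (1 - ψ (u₁ x - u₂ x)) * s₂
          + ((ψ ξ - ψ (u₁ x - u₂ x)) * (s₁ - s₂) + ε / 2)) * D := by ring
    _ ≤ _ := by
        gcongr
        have a1 := (le_abs_self ((ψ ξ - ψ (u₁ x - u₂ x)) * (s₁ - s₂)))
        rw [abs_mul] at a1
        have a2 : |s₁ - s₂| ≤ s₁ + s₂ := by rw [abs_le]; constructor <;> linarith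
        have a3 : |ψ ξ - ψ (u₁ x - u₂ x)| * |s₁ - s₂| ≤ η * (s₁ + s₂) := by gcongr
        linarith

theorem memLp_lipSlope [MeasurableSpace X] [BorelSpace X] {m : Measure X} [IsFiniteMeasure m]
    {q : ℝ≥0∞} {u : X → ℝ} (hu : u ∈ lipB δ) : MemLp (lipSlope δ u) q m :=
  MemLp.of_bound (measurable_lipSlope u).aestronglyMeasurable (lipConst δ univ u).toReal
    (ae_of_all _ fun x => by
      rw [Real.norm_of_nonneg (lipSlope_nonneg u x)]; exact lipSlope_le_const hu x)

theorem convex_lipB (hδ : IsDistance δ) : Convex ℝ (lipB δ) := by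
  rintro u ⟨hu1, ⟨C, hC⟩, hu3⟩ v ⟨hv1, ⟨D, hD⟩, hv3⟩ a b ha hb -
  have l1 := fun y z => abs_sub_le_of_lipConst_le hδ ENNReal.toReal_nonneg
    (ENNReal.ofReal_toReal hu3.ne).ge (mem_univ y) (mem_univ z)
  have l2 := fun y z => abs_sub_le_of_lipConst_le hδ ENNReal.toReal_nonneg
    (ENNReal.ofReal_toReal hv3.ne).ge (mem_univ y) (mem_univ z)
  refine mem_lipB_of_bound hδ ((hu1.const_smul a).add (hv1.const_smul b)) (C := a * C + b * D)
    (a := a * (lipConst δ univ u).toReal + b * (lipConst δ univ v).toReal) (fun x => ?_)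
    fun y z => ?_
  · simp only [Pi.add_apply, Pi.smul_apply, smul_eq_mul]
    refine (abs_add_le _ _).trans ?_
    rw [abs_mul, abs_mul, abs_of_nonneg ha, abs_of_nonneg hb]
    gcongr
    exacts [hC x, hD x]
  · simp only [Pi.add_apply, Pi.smul_apply, smul_eq_mul]
    calc |a * u y + b * v y - (a * u z + b * v z)|
        = |a * (u y - u z) + b * (v y - v z)| := by congr 1; ring
      _ ≤ a * |u y - u z| + b * |v y - v z| := by
          refine (abs_add_le _ _).trans ?_
          rw [abs_mul, abs_mul, abs_of_nonneg ha, abs_of_nonneg hb]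
      _ ≤ a * ((lipConst δ univ u).toReal * (δ y z).toReal)
          + b * ((lipConst δ univ v).toReal * (δ y z).toReal) := by
          gcongr
          exacts [l1 y z, l2 y z]
      _ = _ := by ring

end

end MetricSobolev

/-! ### Uniform convexity of `L^q` on non-negative functions -/

namespace MetricSobolev

section UniformConvexity

/-- Where `(1 - t) ^ p < ε` the first term suffices. The other `t` form a compact set that avoids
`1`, on which strict convexity gives the midpoint gap a positive lower bound `c`; as the left side
is at most `1`, `C = c⁻¹` works. -/
theorem rpow_midpoint_gap_one {p : ℝ} (hp : 1 < p) {ε : ℝ} (hε : 0 < ε) :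
    ∃ C : ℝ, 0 ≤ C ∧ ∀ t ∈ Icc (0 : ℝ) 1,
      (1 - t) ^ p ≤ ε * (1 + t ^ p) + C * ((1 + t ^ p) / 2 - ((1 + t) / 2) ^ p) := by
  have hp0 : 0 < p := by linarith
  have hconv := strictConvexOn_rpow hp
  set gap : ℝ → ℝ := fun t => (1 + t ^ p) / 2 - ((1 + t) / 2) ^ p with hgap
  have hgap_cont : Continuous gap := by
    have := Real.continuous_rpow_const hp0.le
    exact ((continuous_const.add this).div_const 2).sub
      (this.comp ((continuous_const.add continuous_id).div_const 2))
  have hgap_nonneg : ∀ t, 0 ≤ t → 0 ≤ gap t := by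
    intro t ht
    have := hconv.convexOn.2 (x := 1) (y := t) (by simp) ht
      (by norm_num : (0 : ℝ) ≤ 1 / 2) (by norm_num : (0 : ℝ) ≤ 1 / 2) (by norm_num)
    simp only [smul_eq_mul, Real.one_rpow, mul_one] at this
    have e : (1 : ℝ) / 2 + 1 / 2 * t = (1 + t) / 2 := by ring
    rw [e] at this
    simp only [hgap]; linarith
  have hK : IsCompact (Icc (0 : ℝ) 1 ∩ {t | ε ≤ (1 - t) ^ p}) :=
    isCompact_Icc.inter_right (isClosed_le continuous_const
      ((Real.continuous_rpow_const hp0.le).comp (continuous_const.sub continuous_id)))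
  obtain ⟨c, hc, hcK⟩ := hK.exists_forall_le' hgap_cont.continuousOn (a := 0) (by
    rintro t ⟨⟨ht0, ht1⟩, hte⟩
    have ht1' : t ≠ 1 := by
      rintro rfl
      simp only [sub_self, mem_ofPred_eq, Real.zero_rpow hp0.ne'] at hte
      linarith
    have := hconv.2 (x := 1) (y := t) (by simp) ht0 ht1'.symm
      (by norm_num : (0 : ℝ) < 1 / 2) (by norm_num : (0 : ℝ) < 1 / 2) (by norm_num)
    simp only [smul_eq_mul, Real.one_rpow, mul_one] at this
    have e : (1 : ℝ) / 2 + 1 / 2 * t = (1 + t) / 2 := by ring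
    rw [e] at this
    simp only [hgap]; linarith)
  refine ⟨c⁻¹, by positivity, fun t ht => ?_⟩
  have htp : 0 ≤ t ^ p := Real.rpow_nonneg ht.1 p
  have hg := hgap_nonneg t ht.1
  by_cases h : ε ≤ (1 - t) ^ p
  · have h1 : (1 - t) ^ p ≤ 1 :=
      Real.rpow_le_one (by linarith [ht.2]) (by linarith [ht.1]) hp0.le
    have h2 : 1 ≤ c⁻¹ * gap t := by
      rw [inv_mul_eq_div, le_div_iff₀ hc, one_mul]; exact hcK t ⟨ht, h⟩
    have h3 : 0 ≤ ε * (1 + t ^ p) := by positivity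
    simp only [hgap] at h2
    linarith
  · push Not at h
    have : 0 ≤ c⁻¹ * gap t := by positivity
    simp only [hgap] at this
    nlinarith

/-- Symmetry and homogeneity, with `t = b / a`, reduce to the case where the larger number is `1`.
Since both sides are linear in `p`-th powers, the estimate can be integrated. -/
theorem rpow_midpoint_gap {p : ℝ} (hp : 1 < p) {ε : ℝ} (hε : 0 < ε) :
    ∃ C : ℝ, 0 ≤ C ∧ ∀ a b : ℝ, 0 ≤ a → 0 ≤ b →
      |a - b| ^ p ≤ ε * (a ^ p + b ^ p) + C * ((a ^ p + b ^ p) / 2 - ((a + b) / 2) ^ p) := by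
  obtain ⟨C, hC, h⟩ := rpow_midpoint_gap_one hp hε
  have key : ∀ a b : ℝ, 0 ≤ b → b ≤ a →
      |a - b| ^ p ≤ ε * (a ^ p + b ^ p) + C * ((a ^ p + b ^ p) / 2 - ((a + b) / 2) ^ p) := by
    intro a b hb hab
    have hp0 : p ≠ 0 := by linarith
    rcases (hb.trans hab).eq_or_lt with ha | ha
    · have : b = 0 := by linarith
      subst this; subst ha
      simp [Real.zero_rpow hp0]
    · have ht0 : 0 ≤ b / a := by positivity
      have ht1 : b / a ≤ 1 := (div_le_one ha).2 hab
      have := mul_le_mul_of_nonneg_left (h (b / a) ⟨ht0, ht1⟩) (Real.rpow_nonneg ha.le p)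
      have e1 : a ^ p * (1 - b / a) ^ p = |a - b| ^ p := by
        rw [← Real.mul_rpow ha.le (by linarith), abs_of_nonneg (by linarith)]
        congr 1; field_simp
      have e2 : a ^ p * (b / a) ^ p = b ^ p := by
        rw [← Real.mul_rpow ha.le ht0]; congr 1; field_simp
      have e3 : a ^ p * ((1 + b / a) / 2) ^ p = ((a + b) / 2) ^ p := by
        rw [← Real.mul_rpow ha.le (by positivity)]; congr 1; field_simp
      rw [e1] at this
      refine this.trans (le_of_eq ?_)
      rw [← e2, ← e3]; ring
  refine ⟨C, hC, fun a b ha hb => ?_⟩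
  rcases le_total b a with hab | hab
  · exact key a b hb hab
  · have := key b a ha hab
    rwa [abs_sub_comm, add_comm (b ^ p), add_comm b] at this

variable {X : Type*} [MeasurableSpace X] {m : Measure X} {q : ℝ≥0∞} [Fact (1 ≤ q)]

theorem Lp_norm_rpow_eq_integral (hq_top : q ≠ ∞) (f : Lp ℝ q m) :
    ‖f‖ ^ q.toReal = ∫ x, |f x| ^ q.toReal ∂m := by
  have hq0 : q ≠ 0 := (zero_lt_one.trans_le Fact.out).ne'
  have h := Lp.memLp f
  have hpos : 0 < q.toReal := ENNReal.toReal_pos hq0 hq_top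
  rw [Lp.norm_def, h.eLpNorm_eq_integral_rpow_norm hq0 hq_top, ENNReal.toReal_ofReal (by positivity),
    ← Real.rpow_mul (integral_nonneg fun x => by positivity), inv_mul_cancel₀ hpos.ne',
    Real.rpow_one]
  rfl

theorem Lp_norm_midpoint_gap (hq_one : 1 < q) (hq_top : q ≠ ∞) {ε : ℝ} (hε : 0 < ε) :
    ∃ C : ℝ, 0 ≤ C ∧ ∀ a b : Lp ℝ q m, 0 ≤ᵐ[m] a → 0 ≤ᵐ[m] b →
      ‖a - b‖ ^ q.toReal ≤ ε * (‖a‖ ^ q.toReal + ‖b‖ ^ q.toReal) +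
        C * ((‖a‖ ^ q.toReal + ‖b‖ ^ q.toReal) / 2
          - ‖(1 / 2 : ℝ) • a + (1 / 2 : ℝ) • b‖ ^ q.toReal) := by
  have hq0 : q ≠ 0 := (zero_lt_one.trans hq_one).ne'
  have hp : 1 < q.toReal := by
    rw [← ENNReal.toReal_one]; exact (ENNReal.toReal_lt_toReal (by simp) hq_top).2 hq_one
  obtain ⟨C, hC, h⟩ := rpow_midpoint_gap hp hε
  refine ⟨C, hC, fun a b ha hb => ?_⟩
  have hint : ∀ f : Lp ℝ q m, Integrable (fun x => |f x| ^ q.toReal) m := fun f =>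
    (Lp.memLp f).integrable_norm_rpow hq0 hq_top
  simp only [Lp_norm_rpow_eq_integral hq_top]
  have hsum : Integrable (fun x => |a x| ^ q.toReal + |b x| ^ q.toReal) m := (hint a).add (hint b)
  have hmid := hint ((1 / 2 : ℝ) • a + (1 / 2 : ℝ) • b)
  have hdiff : Integrable (fun x => C * ((|a x| ^ q.toReal + |b x| ^ q.toReal) / 2
      - |((1 / 2 : ℝ) • a + (1 / 2 : ℝ) • b : Lp ℝ q m) x| ^ q.toReal)) m :=
    ((hsum.div_const 2).sub hmid).const_mul C
  rw [← integral_add (hint a) (hint b), ← integral_const_mul, ← integral_div,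
    ← integral_sub (hsum.div_const 2) hmid, ← integral_const_mul,
    ← integral_add (hsum.const_mul ε) hdiff]
  refine integral_mono_ae (hint _) ((hsum.const_mul ε).add hdiff) ?_
  filter_upwards [ha, hb, Lp.coeFn_sub a b, Lp.coeFn_add ((1 / 2 : ℝ) • a) ((1 / 2 : ℝ) • b),
    Lp.coeFn_smul (1 / 2 : ℝ) a, Lp.coeFn_smul (1 / 2 : ℝ) b] with x hax hbx h1 h2 h3 h4
  have hax' : 0 ≤ a x := hax
  have hbx' : 0 ≤ b x := hbx
  have e : (a x + b x) / 2 = 1 / 2 * a x + 1 / 2 * b x := by ring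
  have := h (a x) (b x) hax' hbx'
  simp only [h1, h2, h3, h4, Pi.add_apply, Pi.sub_apply, Pi.smul_apply, smul_eq_mul]
  rw [abs_of_nonneg hax', abs_of_nonneg hbx',
    abs_of_nonneg (by positivity : 0 ≤ 1 / 2 * a x + 1 / 2 * b x), ← e]
  exact this

/-- In a decreasing sequence of convex sets of non-negative functions, elements of almost minimal
`L^q` norm converge. -/
theorem exists_tendsto_of_antitone_convex (hq_one : 1 < q) (hq_top : q ≠ ∞)
    {K : ℕ → Set (Lp ℝ q m)} (hanti : Antitone K) (hne : ∀ n, (K n).Nonempty)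
    (hconv : ∀ n, Convex ℝ (K n)) (hpos : ∀ n, ∀ c ∈ K n, 0 ≤ᵐ[m] c) {lam : ℝ}
    (hlam : ∀ r > lam, ∀ᶠ n in atTop, ∀ c ∈ K n, ‖c‖ ≤ r) :
    ∃ (c : ℕ → Lp ℝ q m) (c' : Lp ℝ q m), (∀ n, c n ∈ K n) ∧ Tendsto c atTop (𝓝 c') ∧
      ‖c'‖ ≤ lam := by
  set p := q.toReal with hp_def
  have hp : 1 < p := by
    rw [hp_def, ← ENNReal.toReal_one]; exact (ENNReal.toReal_lt_toReal (by simp) hq_top).2 hq_one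
  have hp0 : 0 < p := by linarith
  set d : ℕ → ℝ := fun n => sInf (norm '' K n) with hd
  have hbdd : ∀ n, BddBelow (norm '' K n) := fun n =>
    ⟨0, by rintro _ ⟨c, _, rfl⟩; exact norm_nonneg c⟩
  have hd_le : ∀ n, ∀ c ∈ K n, d n ≤ ‖c‖ := fun n c hc => csInf_le (hbdd n) ⟨c, hc, rfl⟩
  have hd0 : ∀ n, 0 ≤ d n := fun n => le_csInf ((hne n).image _)
    (by rintro _ ⟨c, _, rfl⟩; exact norm_nonneg c)
  have hd_mono : Monotone d := fun n k hnk =>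
    csInf_le_csInf (hbdd n) ((hne k).image _) (image_mono (hanti hnk))
  have hd_bdd : ∀ n, d n ≤ lam + 1 := by
    intro n
    obtain ⟨k, hk, hnk⟩ := ((hlam (lam + 1) (by linarith)).and (eventually_ge_atTop n)).exists
    obtain ⟨c, hc⟩ := hne k
    exact (hd_mono hnk).trans ((hd_le k c hc).trans (hk c hc))
  have hbddab : BddAbove (range d) := ⟨lam + 1, by rintro _ ⟨n, rfl⟩; exact hd_bdd n⟩
  have hlim := tendsto_atTop_ciSup hd_mono hbddab
  set D := ⨆ n, d n
  have hdD : ∀ n, d n ≤ D := fun n => le_ciSup hbddab n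
  have hex : ∀ n : ℕ, ∃ c ∈ K n, ‖c‖ < d n + 1 / ((n : ℝ) + 1) := by
    intro n
    obtain ⟨_, ⟨c, hc, rfl⟩, hlt⟩ := exists_lt_of_csInf_lt ((hne n).image norm)
      (lt_add_of_pos_right (d n) (by positivity : 0 < 1 / ((n : ℝ) + 1)))
    exact ⟨c, hc, hlt⟩
  choose c hcK hcn using hex
  set A : ℕ → ℝ := fun n => (D + 1 / ((n : ℝ) + 1)) ^ p with hA
  have hAlim : Tendsto (fun n => A n - d n ^ p) atTop (𝓝 0) := by
    have h1 : Tendsto A atTop (𝓝 ((D + 0) ^ p)) :=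
      ((tendsto_const_nhds.add tendsto_one_div_add_atTop_nhds_zero_nat).rpow_const (Or.inr hp0.le))
    have h2 : Tendsto (fun n => d n ^ p) atTop (𝓝 (D ^ p)) := hlim.rpow_const (Or.inr hp0.le)
    simpa using h1.sub h2
  have hD0 : 0 ≤ D := (hd0 0).trans (hdD 0)
  have hcA : ∀ n k, n ≤ k → ‖c k‖ ^ p ≤ A n := by
    intro n k hnk
    refine Real.rpow_le_rpow (norm_nonneg _) ((hcn k).le.trans ?_) hp0.le
    have : (1 : ℝ) / (k + 1) ≤ 1 / (n + 1) := by gcongr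
    linarith [hdD k]
  -- For `k ≥ n` the midpoint of `c k` and `c n` lies in `K n`, so its norm is at least `d n`. The
  -- midpoint gap is therefore at most `A n - d n ^ p`, which tends to `0`.
  have hcauchy : CauchySeq c := by
    rw [Metric.cauchySeq_iff']
    intro η hη
    set M := A 0
    have hM0 : 0 ≤ M := by positivity
    have hηp : 0 < η ^ p := by positivity
    obtain ⟨C, hC, hgap⟩ := Lp_norm_midpoint_gap (m := m) hq_one hq_top
      (ε := η ^ p / 2 / (2 * M + 1)) (by positivity)
    have : ∀ᶠ n in atTop, C * (A n - d n ^ p) < η ^ p / 2 := by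
      have := hAlim.const_mul C
      rw [mul_zero] at this
      exact this.eventually_lt_const (by positivity)
    obtain ⟨n, hn⟩ := this.exists
    refine ⟨n, fun k hk => ?_⟩
    rw [dist_eq_norm]
    have h1 := hgap (c k) (c n) (hpos _ _ (hcK k)) (hpos _ _ (hcK n))
    have hmid : d n ≤ ‖(1 / 2 : ℝ) • c k + (1 / 2 : ℝ) • c n‖ :=
      hd_le n _ (hconv n (hanti hk (hcK k)) (hcK n) (by norm_num) (by norm_num) (by norm_num))
    have hmid' := Real.rpow_le_rpow (hd0 n) hmid hp0.le
    have h2 := hcA n k hk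
    have h3 := hcA n n le_rfl
    have h4 := hcA 0 k (Nat.zero_le _)
    have h5 := hcA 0 n (Nat.zero_le _)
    have h6 : η ^ p / 2 / (2 * M + 1) * (‖c k‖ ^ p + ‖c n‖ ^ p) ≤ η ^ p / 2 := by
      rw [div_mul_eq_mul_div, div_le_iff₀ (by positivity)]
      have : ‖c k‖ ^ p + ‖c n‖ ^ p ≤ 2 * M + 1 := by linarith
      gcongr
    have h7 : C * ((‖c k‖ ^ p + ‖c n‖ ^ p) / 2 - ‖(1 / 2 : ℝ) • c k + (1 / 2 : ℝ) • c n‖ ^ p)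
        ≤ C * (A n - d n ^ p) := by
      gcongr; linarith
    have h8 : ‖c k - c n‖ ^ p < η ^ p := by linarith
    exact lt_of_not_ge fun hge => absurd (Real.rpow_le_rpow hη.le hge hp0.le) (not_le.2 h8)
  obtain ⟨c', hc'⟩ := cauchySeq_tendsto_of_complete hcauchy
  refine ⟨c, c', hcK, hc', le_of_forall_gt_imp_ge_of_dense fun r hr => ?_⟩
  refine le_of_tendsto hc'.norm ?_
  filter_upwards [hlam r hr] with n hn using hn _ (hcK n)

end UniformConvexity

end MetricSobolev

/-! ### Strong relaxed gradient bounds: closure, extraction and minimality -/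

namespace MetricSobolev

section ApproxGrad

variable {X : Type*} [TopologicalSpace X] [MeasurableSpace X]

/-- `G` bounds the gradient of `f` in the strong relaxed sense: `f` is a limit in measure of functions
`u ∈ 𝒜` such that the positive part of `lip u - G` tends to `0` in `L^q`. -/
def ApproxGrad (δ : X → X → ℝ≥0∞) (m : Measure X) (q : ℝ≥0∞) (𝒜 : Set (X → ℝ))
    (f G : X → ℝ) : Prop :=
  MemLp G q m ∧ ∀ ε : ℝ, 0 < ε → ∃ u ∈ 𝒜, m {x | ε ≤ dist (u x) (f x)} ≤ ENNReal.ofReal ε ∧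
    eLpNorm (fun x => max (lipSlope δ u x - G x) 0) q m ≤ ENNReal.ofReal ε

variable {δ : X → X → ℝ≥0∞} {m : Measure X} {q : ℝ≥0∞} {𝒜 : Set (X → ℝ)} {f G : X → ℝ}

theorem ApproxGrad.mono {G' : X → ℝ} (h : ApproxGrad δ m q 𝒜 f G) (hG' : MemLp G' q m)
    (hle : G ≤ᵐ[m] G') : ApproxGrad δ m q 𝒜 f G' := by
  refine ⟨hG', fun ε hε => ?_⟩
  obtain ⟨u, hu, h1, h2⟩ := h.2 ε hε
  refine ⟨u, hu, h1, le_trans (eLpNorm_mono_ae_real ?_) h2⟩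
  filter_upwards [hle] with x hx
  rw [Real.norm_of_nonneg (le_max_right _ _)]
  exact max_le_max (by linarith) le_rfl

theorem ApproxGrad.congr {f' G' : X → ℝ} (h : ApproxGrad δ m q 𝒜 f G) (hf : f =ᵐ[m] f')
    (hG : G =ᵐ[m] G') : ApproxGrad δ m q 𝒜 f' G' := by
  refine ApproxGrad.mono (G := G) ⟨h.1, fun ε hε => ?_⟩ (h.1.ae_eq hG) hG.le
  obtain ⟨u, hu, h1, h2⟩ := h.2 ε hε
  refine ⟨u, hu, le_of_eq_of_le (measure_congr ?_) h1, h2⟩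
  filter_upwards [hf] with x hx
  exact propext (by change _ ≤ dist (u x) (f' x) ↔ _ ≤ dist (u x) (f x); rw [hx])

theorem ApproxGrad.of_seq (hG : MemLp G q m) {u : ℕ → X → ℝ} (hu : ∀ n, u n ∈ 𝒜)
    (hf : TendstoInMeasure m u atTop f)
    (hs : Tendsto (fun n => eLpNorm (fun x => max (lipSlope δ (u n) x - G x) 0) q m)
      atTop (𝓝 0)) : ApproxGrad δ m q 𝒜 f G := by
  refine ⟨hG, fun ε hε => ?_⟩
  have hε' : (0 : ℝ≥0∞) < ENNReal.ofReal ε := ENNReal.ofReal_pos.2 hε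
  have h1 := (tendstoInMeasure_iff_dist.1 hf ε hε).eventually_le_const hε'
  obtain ⟨n, hn1, hn2⟩ := (h1.and (hs.eventually_le_const hε')).exists
  exact ⟨u n, hu n, hn1, hn2⟩

theorem ApproxGrad.exists_seq (h : ApproxGrad δ m q 𝒜 f G) :
    ∃ u : ℕ → X → ℝ, (∀ n, u n ∈ 𝒜) ∧ (∀ᵐ x ∂m, Tendsto (fun n => u n x) atTop (𝓝 (f x))) ∧
      Tendsto (fun n => eLpNorm (fun x => max (lipSlope δ (u n) x - G x) 0) q m)
        atTop (𝓝 0) := by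
  choose u hu h1 h2 using fun n : ℕ => h.2 (1 / ((n : ℝ) + 1)) (by positivity)
  have hz : Tendsto (fun n : ℕ => ENNReal.ofReal (1 / ((n : ℝ) + 1))) atTop (𝓝 0) := by
    simpa using ENNReal.tendsto_ofReal tendsto_one_div_add_atTop_nhds_zero_nat
  have hmeas : TendstoInMeasure m u atTop f := by
    rw [tendstoInMeasure_iff_dist]
    intro ε hε
    refine tendsto_of_tendsto_of_tendsto_of_le_of_le' tendsto_const_nhds hz
      (Eventually.of_forall fun _ => zero_le) ?_
    filter_upwards [tendsto_one_div_add_atTop_nhds_zero_nat.eventually_le_const hε] with n hn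
    exact (measure_mono fun x hx => hn.trans hx).trans (h1 n)
  obtain ⟨ns, hns, hae⟩ := hmeas.exists_seq_tendsto_ae
  refine ⟨u ∘ ns, fun n => hu _, hae, ?_⟩
  have : Tendsto (fun n => eLpNorm (fun x => max (lipSlope δ (u n) x - G x) 0) q m)
      atTop (𝓝 0) :=
    tendsto_of_tendsto_of_tendsto_of_le_of_le tendsto_const_nhds hz (fun _ => zero_le) h2
  exact this.comp hns.tendsto_atTop

variable [BorelSpace X] [Fact (1 ≤ q)]

/-- The positive part of `lip u - G` is at most that of `lip u - Gs n` plus `|Gs n - G|`, so a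
diagonal choice of `u` works. -/
theorem ApproxGrad.closed {fs Gs : ℕ → X → ℝ} (hS : ∀ n, ApproxGrad δ m q 𝒜 (fs n) (Gs n))
    (hf : TendstoInMeasure m fs atTop f) (hG : MemLp G q m)
    (hGs : Tendsto (fun n => eLpNorm (fun x => Gs n x - G x) q m) atTop (𝓝 0)) :
    ApproxGrad δ m q 𝒜 f G := by
  refine ⟨hG, fun ε hε => ?_⟩
  have hε2 : 0 < ε / 2 := by positivity
  have hε' : (0 : ℝ≥0∞) < ENNReal.ofReal (ε / 2) := ENNReal.ofReal_pos.2 hε2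
  have h1 := (tendstoInMeasure_iff_dist.1 hf (ε / 2) hε2).eventually_le_const hε'
  obtain ⟨n, hn1, hn2⟩ := (h1.and (hGs.eventually_le_const hε')).exists
  obtain ⟨u, hu, hu1, hu2⟩ := (hS n).2 (ε / 2) hε2
  have hadd : ENNReal.ofReal ε = ENNReal.ofReal (ε / 2) + ENNReal.ofReal (ε / 2) := by
    rw [← ENNReal.ofReal_add hε2.le hε2.le, add_halves]
  refine ⟨u, hu, ?_, ?_⟩
  · rw [hadd]
    refine le_trans (measure_mono ?_) ((measure_union_le _ _).trans (add_le_add hu1 hn1))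
    intro x hx
    by_contra hcon
    simp only [mem_union, mem_ofPred_eq, not_or, not_le] at hcon hx
    linarith [dist_triangle (u x) (fs n x) (f x)]
  · rw [hadd]
    have m1 : AEStronglyMeasurable (fun x => max (lipSlope δ u x - Gs n x) 0) m :=
      ((measurable_lipSlope u).aestronglyMeasurable.sub
        (hS n).1.aestronglyMeasurable).sup aestronglyMeasurable_const
    have m2 : AEStronglyMeasurable (fun x => |Gs n x - G x|) m :=
      ((hS n).1.aestronglyMeasurable.sub hG.aestronglyMeasurable).norm
    refine le_trans (eLpNorm_mono_real fun x => ?_)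
      ((eLpNorm_add_le m1 m2 Fact.out).trans (add_le_add hu2 ?_))
    · rw [Real.norm_of_nonneg (le_max_right _ _)]
      simp only [Pi.add_apply]
      refine max_le ?_ (by positivity)
      linarith [le_max_left (lipSlope δ u x - Gs n x) 0, le_abs_self (Gs n x - G x)]
    · exact (eLpNorm_norm (fun x => Gs n x - G x)).trans_le hn2

theorem ApproxGrad.closed_left {fs : ℕ → X → ℝ} (hS : ∀ n, ApproxGrad δ m q 𝒜 (fs n) G)
    (hf : TendstoInMeasure m fs atTop f) : ApproxGrad δ m q 𝒜 f G :=
  ApproxGrad.closed hS hf (hS 0).1 (by simp)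

omit [Fact (1 ≤ q)] in
theorem ApproxGrad.of_mem [IsFiniteMeasure m] {u : X → ℝ} (hu : u ∈ 𝒜) (h𝒜 : 𝒜 ⊆ lipB δ) :
    ApproxGrad δ m q 𝒜 u (lipSlope δ u) :=
  ApproxGrad.of_seq (memLp_lipSlope (h𝒜 hu)) (u := fun _ => u) (fun _ => hu)
    (tendstoInMeasure_iff_dist.2 fun ε hε => by
      simp [not_le.2 hε]) (by simp)

omit [TopologicalSpace X] [BorelSpace X] in
theorem tendsto_eLpNorm_sub_of_dominated {B : X → ℝ} (hq_top : q ≠ ∞) {h : ℕ → X → ℝ}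
    {h' : X → ℝ} (hB : MemLp B q m) (hh : ∀ n, AEStronglyMeasurable (h n) m)
    (hh' : AEStronglyMeasurable h' m) (hle : ∀ n, ∀ᵐ x ∂m, |h n x - h' x| ≤ B x)
    (hlim : ∀ᵐ x ∂m, Tendsto (fun n => h n x) atTop (𝓝 (h' x))) :
    Tendsto (fun n => eLpNorm (fun x => h n x - h' x) q m) atTop (𝓝 0) := by
  have hq0 : q ≠ 0 := (zero_lt_one.trans_le Fact.out).ne'
  have hpos : 0 < q.toReal := ENNReal.toReal_pos hq0 hq_top
  simp only [eLpNorm_eq_lintegral_rpow_enorm_toReal hq0 hq_top]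
  have hlin : Tendsto (fun n => ∫⁻ x, ‖h n x - h' x‖ₑ ^ q.toReal ∂m) atTop
      (𝓝 (∫⁻ _, 0 ∂m)) := by
    refine tendsto_lintegral_of_dominated_convergence' (fun x => ‖B x‖ₑ ^ q.toReal)
      (fun n => ((hh n).sub hh').enorm.pow_const _) (fun n => ?_) ?_ ?_
    · filter_upwards [hle n] with x hx
      gcongr
      refine enorm_le_iff_norm_le.2 ?_
      exact hx.trans (le_abs_self _)
    · exact (lintegral_rpow_enorm_lt_top_of_eLpNorm_lt_top hq0 hq_top hB.2).ne
    · filter_upwards [hlim] with x hx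
      have h1 : Tendsto (fun n => h n x - h' x) atTop (𝓝 0) := by
        simpa using hx.sub_const (h' x)
      have h2 := (ENNReal.continuous_rpow_const (y := q.toReal)).continuousAt.tendsto.comp
        h1.enorm
      simpa [hpos, Function.comp_def] using h2
  have h3 := (ENNReal.continuous_rpow_const (y := 1 / q.toReal)).continuousAt.tendsto.comp hlin
  simpa [hpos, Function.comp_def] using h3

/-- Convex combinations of the tail of a sequence `(u n, a n)` in `𝒜 × L^q` with `lip (u n) ≤ a n`. -/
def tailHull (u : ℕ → X → ℝ) (a : ℕ → Lp ℝ q m) (n : ℕ) : Set ((X → ℝ) × Lp ℝ q m) :=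
  convexHull ℝ ((fun k => (u k, a k)) '' Ici n)

omit [TopologicalSpace X] [BorelSpace X] [Fact (1 ≤ q)] in
theorem tailHull_anti (u : ℕ → X → ℝ) (a : ℕ → Lp ℝ q m) : Antitone (tailHull u a) :=
  fun _ _ hnk => convexHull_mono (image_mono (Ici_subset_Ici.2 hnk))

omit [TopologicalSpace X] [BorelSpace X] [Fact (1 ≤ q)] in
theorem convex_snd_tailHull (u : ℕ → X → ℝ) (a : ℕ → Lp ℝ q m) (n : ℕ) :
    Convex ℝ (Prod.snd '' tailHull u a n) :=
  (convex_convexHull ℝ _).is_linear_image (LinearMap.snd ℝ (X → ℝ) (Lp ℝ q m)).isLinear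

omit [TopologicalSpace X] [BorelSpace X] [Fact (1 ≤ q)] in
theorem mem_snd_tailHull (u : ℕ → X → ℝ) (a : ℕ → Lp ℝ q m) {n k : ℕ} (hk : n ≤ k) :
    a k ∈ Prod.snd '' tailHull u a n :=
  ⟨(u k, a k), subset_convexHull _ _ ⟨k, hk, rfl⟩, rfl⟩

omit [BorelSpace X] [Fact (1 ≤ q)] in
theorem mem_of_mem_tailHull (hδ : IsDistance δ) (h𝒜 : 𝒜 ⊆ lipB δ) (hconv : Convex ℝ 𝒜)
    {u : ℕ → X → ℝ} {a : ℕ → Lp ℝ q m} (hu : ∀ n, u n ∈ 𝒜)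
    (hua : ∀ n, ∀ᵐ x ∂m, lipSlope δ (u n) x ≤ a n x) {n : ℕ} {w : (X → ℝ) × Lp ℝ q m}
    (hw : w ∈ tailHull u a n) : w.1 ∈ 𝒜 ∧ ∀ᵐ x ∂m, lipSlope δ w.1 x ≤ w.2 x := by
  suffices hsub : tailHull u a n ⊆ {w | w.1 ∈ 𝒜 ∧ ∀ᵐ x ∂m, lipSlope δ w.1 x ≤ w.2 x} from hsub hw
  refine convexHull_min ?_ ?_
  · rintro _ ⟨k, -, rfl⟩
    exact ⟨hu _, hua _⟩
  · rintro ⟨v, c⟩ ⟨hv1, hv2⟩ ⟨v', c'⟩ ⟨hv1', hv2'⟩ s t hs ht hst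
    refine ⟨hconv hv1 hv1' hs ht hst, ?_⟩
    filter_upwards [hv2, hv2', Lp.coeFn_add (s • c) (t • c'), Lp.coeFn_smul s c,
      Lp.coeFn_smul t c'] with x h1 h2 h3 h4 h5
    have := lipSlope_affine_le hδ (h𝒜 hv1) (h𝒜 hv1') 0 s t x
    simp only [zero_add, abs_of_nonneg hs, abs_of_nonneg ht] at this
    change lipSlope δ (fun y => s * v y + t * v' y) x ≤ (s • c + t • c' : Lp ℝ q m) x
    rw [h3, Pi.add_apply, h4, h5]
    simp only [Pi.smul_apply, smul_eq_mul] at *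
    refine this.trans ?_
    gcongr

omit [TopologicalSpace X] [BorelSpace X] [Fact (1 ≤ q)] in
theorem abs_sub_le_of_mem_tailHull {u : ℕ → X → ℝ} {a : ℕ → Lp ℝ q m} {n : ℕ}
    {w : (X → ℝ) × Lp ℝ q m} (hw : w ∈ tailHull u a n) {x : X} {t₀ r : ℝ}
    (hr : ∀ k ≥ n, |u k x - t₀| ≤ r) : |w.1 x - t₀| ≤ r := by
  suffices hsub : tailHull u a n ⊆ {w | |w.1 x - t₀| ≤ r} from hsub hw
  refine convexHull_min ?_ ?_
  · rintro _ ⟨k, hk, rfl⟩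
    exact hr k hk
  · rintro ⟨v, c⟩ hv ⟨v', c'⟩ hv' s t hs ht hst
    simp only [mem_ofPred_eq] at hv hv'
    change |s * v x + t * v' x - t₀| ≤ r
    have e : s * v x + t * v' x - t₀ = s * (v x - t₀) + t * (v' x - t₀) := by
      linear_combination t₀ * hst
    rw [e]
    calc |s * (v x - t₀) + t * (v' x - t₀)| ≤ s * |v x - t₀| + t * |v' x - t₀| := by
          refine (abs_add_le _ _).trans ?_
          rw [abs_mul, abs_mul, abs_of_nonneg hs, abs_of_nonneg ht]
      _ ≤ s * r + t * r := by gcongr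
      _ = r := by rw [← add_mul, hst, one_mul]

/-- Applying the same convex weights to functions and bounds preserves `lip u ≤ a`, because the
slope is convex in `u`. Combinations of a tail still converge pointwise to `f`, since balls in `ℝ`
are convex. -/
theorem ApproxGrad.of_tailHull [IsFiniteMeasure m] (hδ : IsDistance δ) (h𝒜 : 𝒜 ⊆ lipB δ)
    (hconv : Convex ℝ 𝒜) {u : ℕ → X → ℝ} {a : ℕ → Lp ℝ q m} (hu : ∀ n, u n ∈ 𝒜)
    (hf : ∀ᵐ x ∂m, Tendsto (fun n => u n x) atTop (𝓝 (f x)))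
    (hua : ∀ n, ∀ᵐ x ∂m, lipSlope δ (u n) x ≤ a n x) {c : ℕ → Lp ℝ q m} {c' : Lp ℝ q m}
    (hc : ∀ n, c n ∈ Prod.snd '' tailHull u a n) (hlim : Tendsto c atTop (𝓝 c')) :
    ApproxGrad δ m q 𝒜 f c' := by
  choose w hw hwc using hc
  have hw1 := fun n => mem_of_mem_tailHull hδ h𝒜 hconv hu hua (hw n)
  refine ApproxGrad.of_seq (Lp.memLp c') (u := fun n => (w n).1) (fun n => (hw1 n).1) ?_ ?_
  · refine tendstoInMeasure_of_tendsto_ae (fun n => ?_) ?_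
    · have hc := (h𝒜 (hw1 n).1).1
      exact hc.measurable.aestronglyMeasurable
    · filter_upwards [hf] with x hx
      rw [Metric.tendsto_atTop] at hx ⊢
      intro ε hε
      obtain ⟨n₀, hn₀⟩ := hx (ε / 2) (by positivity)
      refine ⟨n₀, fun n hn => ?_⟩
      have := abs_sub_le_of_mem_tailHull (hw n) (x := x) (t₀ := f x) (r := ε / 2)
        fun k hk => (hn₀ k (hn.trans hk)).le
      exact lt_of_le_of_lt this (by linarith)
  · have h1 := (Lp.tendsto_Lp_iff_tendsto_eLpNorm' c c').1 hlim
    refine tendsto_of_tendsto_of_tendsto_of_le_of_le tendsto_const_nhds h1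
      (fun _ => zero_le) fun n => eLpNorm_mono_ae ?_
    filter_upwards [(hw1 n).2] with x hx
    rw [hwc n] at hx
    rw [Real.norm_of_nonneg (le_max_right _ _), Real.norm_eq_abs, Pi.sub_apply]
    exact max_le ((sub_le_sub_right hx _).trans (le_abs_self _)) (abs_nonneg _)

/-- From approximations whose slopes are bounded by functions of bounded norm one extracts a strong
relaxed gradient. -/
theorem ApproxGrad.exists_of_bounded [IsFiniteMeasure m] (hδ : IsDistance δ) (hq_one : 1 < q)
    (hq_top : q ≠ ∞) (h𝒜 : 𝒜 ⊆ lipB δ) (hconv : Convex ℝ 𝒜) {u : ℕ → X → ℝ}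
    {a : ℕ → Lp ℝ q m} (hu : ∀ n, u n ∈ 𝒜) (hf : TendstoInMeasure m u atTop f)
    (hua : ∀ n, ∀ᵐ x ∂m, lipSlope δ (u n) x ≤ a n x) {lam : ℝ}
    (hlam : ∀ r > lam, ∀ᶠ n in atTop, ‖a n‖ ≤ r) :
    ∃ c : Lp ℝ q m, ApproxGrad δ m q 𝒜 f c ∧ ‖c‖ ≤ lam := by
  obtain ⟨ns, hns, hae⟩ := hf.exists_seq_tendsto_ae
  have hK3 : ∀ r > lam, ∀ᶠ n in atTop,
      ∀ c ∈ Prod.snd '' tailHull (u ∘ ns) (a ∘ ns) n, ‖c‖ ≤ r := by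
    intro r hr
    obtain ⟨n₀, hn₀⟩ := eventually_atTop.1 (hlam r hr)
    filter_upwards [eventually_ge_atTop n₀] with n hn
    rintro _ ⟨w, hw, rfl⟩
    suffices hsub : tailHull (u ∘ ns) (a ∘ ns) n ⊆ Prod.snd ⁻¹' Metric.closedBall 0 r by
      simpa using hsub hw
    refine convexHull_min ?_ ((convex_closedBall (0 : Lp ℝ q m) r).is_linear_preimage
      (LinearMap.snd ℝ (X → ℝ) (Lp ℝ q m)).isLinear)
    rintro _ ⟨k, hk, rfl⟩
    simpa using hn₀ _ (hn.trans (le_trans hk (hns.id_le k)))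
  obtain ⟨c, c', hcK, hlim, hnorm⟩ := exists_tendsto_of_antitone_convex hq_one hq_top
    (K := fun n => Prod.snd '' tailHull (u ∘ ns) (a ∘ ns) n)
    (fun n k hnk => image_mono (tailHull_anti _ _ hnk))
    (fun n => ⟨_, mem_snd_tailHull _ _ le_rfl⟩) (fun n => convex_snd_tailHull _ _ n)
    (by
      rintro n _ ⟨w, hw, rfl⟩
      filter_upwards [(mem_of_mem_tailHull hδ h𝒜 hconv (fun n => hu (ns n))
        (fun n => hua (ns n)) hw).2] with x hx using (lipSlope_nonneg _ _).trans hx) hK3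
  exact ⟨c', ApproxGrad.of_tailHull hδ h𝒜 hconv (fun n => hu (ns n)) hae
    (fun n => hua (ns n)) hcK hlim, hnorm⟩

/-- Take bounds `c n` of almost least norm and an approximant `u n` for each. The slope of `u n`
lies below `c n` plus the positive part of `lip (u n) - c n`, and these majorants have norms
asymptotically at most the infimum, so a bound attaining it can be extracted. -/
theorem ApproxGrad.exists_min [IsFiniteMeasure m] (hδ : IsDistance δ) (hq_one : 1 < q)
    (hq_top : q ≠ ∞) (h𝒜 : 𝒜 ⊆ lipB δ) (hconv : Convex ℝ 𝒜) (hS : ApproxGrad δ m q 𝒜 f G) :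
    ∃ c : Lp ℝ q m, ApproxGrad δ m q 𝒜 f c ∧
      ∀ c' : Lp ℝ q m, ApproxGrad δ m q 𝒜 f c' → ‖c‖ ≤ ‖c'‖ := by
  set N : Set ℝ := norm '' {c : Lp ℝ q m | ApproxGrad δ m q 𝒜 f c} with hN
  have hbdd : BddBelow N := ⟨0, by rintro _ ⟨c, _, rfl⟩; exact norm_nonneg c⟩
  have hne : N.Nonempty :=
    ⟨_, hS.1.toLp G, hS.congr (ae_eq_refl f) hS.1.coeFn_toLp.symm, rfl⟩
  have hex : ∀ n : ℕ, ∃ c : Lp ℝ q m, ApproxGrad δ m q 𝒜 f c ∧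
      ‖c‖ < sInf N + 1 / ((n : ℝ) + 1) := by
    intro n
    obtain ⟨_, ⟨c, hc, rfl⟩, hlt⟩ := exists_lt_of_csInf_lt hne
      (lt_add_of_pos_right (sInf N) (by positivity : 0 < 1 / ((n : ℝ) + 1)))
    exact ⟨c, hc, hlt⟩
  choose c hc hcn using hex
  choose u hu h1 h2 using fun n : ℕ => (hc n).2 (1 / ((n : ℝ) + 1)) (by positivity)
  have hz : Tendsto (fun n : ℕ => ENNReal.ofReal (1 / ((n : ℝ) + 1))) atTop (𝓝 0) := by
    simpa using ENNReal.tendsto_ofReal tendsto_one_div_add_atTop_nhds_zero_nat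
  have hmeas : TendstoInMeasure m u atTop f := by
    rw [tendstoInMeasure_iff_dist]
    intro ε hε
    refine tendsto_of_tendsto_of_tendsto_of_le_of_le' tendsto_const_nhds hz
      (Eventually.of_forall fun _ => zero_le) ?_
    filter_upwards [tendsto_one_div_add_atTop_nhds_zero_nat.eventually_le_const hε] with n hn
    exact (measure_mono fun x hx => hn.trans hx).trans (h1 n)
  have hpp : ∀ n, MemLp (fun x => max (lipSlope δ (u n) x - c n x) 0) q m := fun n =>
    ⟨((measurable_lipSlope (u n)).aestronglyMeasurable.sub
      (Lp.aestronglyMeasurable _)).sup aestronglyMeasurable_const,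
      (h2 n).trans_lt ENNReal.ofReal_lt_top⟩
  obtain ⟨c', hc', hle⟩ := ApproxGrad.exists_of_bounded (a := fun n => c n + (hpp n).toLp) hδ
    hq_one hq_top h𝒜 hconv hu hmeas (fun n => by
      filter_upwards [Lp.coeFn_add (c n) (hpp n).toLp, (hpp n).coeFn_toLp] with x e1 e2
      rw [e1, Pi.add_apply, e2]
      linarith [le_max_left (lipSlope δ (u n) x - c n x) 0]) (lam := sInf N) (by
      intro r hr
      have hlim : Tendsto (fun n : ℕ => sInf N + 1 / ((n : ℝ) + 1) + 1 / ((n : ℝ) + 1)) atTop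
          (𝓝 (sInf N + 0 + 0)) :=
        (tendsto_const_nhds.add tendsto_one_div_add_atTop_nhds_zero_nat).add
          tendsto_one_div_add_atTop_nhds_zero_nat
      filter_upwards [hlim.eventually_le_const (by simpa using hr)] with n hn
      refine (norm_add_le _ _).trans (le_trans (add_le_add (hcn n).le ?_) hn)
      rw [Lp.norm_toLp]
      exact ENNReal.toReal_le_of_le_ofReal (by positivity) (h2 n))
  exact ⟨c', hc', fun c'' hc'' => hle.trans (csInf_le hbdd ⟨c'', hc'', rfl⟩)⟩

/-- Weak relaxed gradients are strong ones (Mazur's lemma). -/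
theorem IsRelaxedGradient.approxGrad [IsFiniteMeasure m] (hδ : IsDistance δ) (h𝒜 : 𝒜 ⊆ lipB δ) (hconv : Convex ℝ 𝒜) {f : X →ₘ[m] ℝ} {G : Lp ℝ q m}
    (h : IsRelaxedGradient δ m q 𝒜 f G) : ApproxGrad δ m q 𝒜 f G := by
  obtain ⟨u, hmem, G', hu, hf, hweak, hle⟩ := h
  have hf' : TendstoInMeasure m u atTop f := by
    simpa using hf univ MeasurableSet.univ (measure_lt_top m univ)
  obtain ⟨ns, hns, hae⟩ := hf'.exists_seq_tendsto_ae
  set a : ℕ → Lp ℝ q m := fun n => (hmem (ns n)).toLp with ha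
  -- A closed convex set is weakly closed: a functional separating `G'` from a tail hull would
  -- contradict weak convergence.
  have hcl : ∀ n, G' ∈ closure (Prod.snd '' tailHull (u ∘ ns) a n) := by
    intro n
    by_contra hnot
    obtain ⟨φ, s, h1, h2⟩ := geometric_hahn_banach_closed_point
      (convex_snd_tailHull (u ∘ ns) a n).closure isClosed_closure hnot
    refine absurd (le_of_tendsto ((hweak φ).comp hns.tendsto_atTop) ?_) (not_le.2 h2)
    filter_upwards [eventually_ge_atTop n] with k hk
    exact (h1 _ (subset_closure (mem_snd_tailHull (u ∘ ns) a hk))).le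
  choose c hc hdist using fun n : ℕ => Metric.mem_closure_iff.1 (hcl n) (1 / ((n : ℝ) + 1))
    (by positivity)
  have hlim : Tendsto c atTop (𝓝 G') := by
    rw [tendsto_iff_dist_tendsto_zero]
    refine squeeze_zero (fun _ => dist_nonneg) (fun n => ?_)
      tendsto_one_div_add_atTop_nhds_zero_nat
    rw [dist_comm]
    exact (hdist n).le
  refine ApproxGrad.mono (ApproxGrad.of_tailHull hδ h𝒜 hconv (fun n => hu (ns n)) hae
    (fun n => ?_) hc hlim) (Lp.memLp G) hle
  filter_upwards [(hmem (ns n)).coeFn_toLp] with x hx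
  exact hx.ge

end ApproxGrad

end MetricSobolev

/-! ### Chain rule, minima and locality for gradient bounds from an algebra -/

namespace MetricSobolev

theorem exists_derivative_eq (Q : Polynomial ℝ) :
    ∃ P : Polynomial ℝ, P.derivative = Q ∧ P.eval 0 = 0 := by
  induction Q using Polynomial.induction_on' with
  | add p q hp hq =>
    obtain ⟨P, h1, h2⟩ := hp
    obtain ⟨P', h1', h2'⟩ := hq
    exact ⟨P + P', by rw [Polynomial.derivative_add, h1, h1'],
      by rw [Polynomial.eval_add, h2, h2', add_zero]⟩
  | monomial n a =>
    refine ⟨Polynomial.monomial (n + 1) (a / (n + 1)), ?_, by simp [Polynomial.eval_monomial]⟩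
    rw [Polynomial.derivative_monomial]
    have : (n : ℝ) + 1 ≠ 0 := by positivity
    simp only [Nat.add_sub_cancel, Nat.cast_add, Nat.cast_one]
    rw [div_mul_cancel₀ _ this]

/-- Approximation in `C¹([-C,C])` of a function with derivative in `[0,1]` by polynomials with
derivative in `[0,1]`. -/
theorem exists_polynomial_near_deriv {φ ψ : ℝ → ℝ} (hφ : ∀ t, HasDerivAt φ (ψ t) t)
    (hψ : Continuous ψ) (hψ01 : ∀ t, 0 ≤ ψ t ∧ ψ t ≤ 1) (hφ0 : φ 0 = 0) {C η : ℝ} (hC : 0 ≤ C)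
    (hη : 0 < η) :
    ∃ P : Polynomial ℝ, ∀ t, |t| ≤ C → (0 ≤ P.derivative.eval t ∧ P.derivative.eval t ≤ 1) ∧
      |P.derivative.eval t - ψ t| ≤ η ∧ |P.eval t - φ t| ≤ η := by
  -- The function `(1 - 2ρ)ψ + ρ` takes values in `[ρ, 1 - ρ]`, so an approximation within `ρ` stays
  -- in `[0,1]` and is within `2ρ` of `ψ`. Integration from `0` multiplies this error by at most
  -- `C`, which explains `C + 1` in the denominator.
  set ρ : ℝ := min (1 / 2) (η / (2 * (C + 1))) with hρ
  have hρ0 : 0 < ρ := by positivity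
  have hρ1 : ρ ≤ 1 / 2 := min_le_left _ _
  have hρ2 : 2 * ρ * (C + 1) ≤ η := by
    have : ρ ≤ η / (2 * (C + 1)) := min_le_right _ _
    rw [le_div_iff₀ (by positivity)] at this
    linarith
  obtain ⟨Q, hQ⟩ := exists_polynomial_near_of_continuousOn (-C) C
    (fun t => (1 - 2 * ρ) * ψ t + ρ) (by fun_prop) ρ hρ0
  obtain ⟨P, rfl, hP0⟩ := exists_derivative_eq Q
  have hclose : ∀ t, |t| ≤ C → |P.derivative.eval t - ψ t| ≤ 2 * ρ := by
    intro t ht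
    have h1 := hQ t (abs_le.1 ht)
    obtain ⟨h2, h3⟩ := hψ01 t
    rw [abs_lt] at h1
    rw [abs_le]
    constructor <;> nlinarith
  refine ⟨P, fun t ht => ⟨?_, ?_, ?_⟩⟩
  · have h1 := hQ t (abs_le.1 ht)
    obtain ⟨h2, h3⟩ := hψ01 t
    rw [abs_lt] at h1
    constructor <;> nlinarith
  · refine (hclose t ht).trans ?_
    nlinarith
  · have := (convex_Icc (-C) C).norm_image_sub_le_of_norm_hasDerivWithin_le
      (f := fun t => P.eval t - φ t) (f' := fun t => P.derivative.eval t - ψ t) (C := 2 * ρ)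
      (fun t _ => ((P.hasDerivAt t).sub (hφ t)).hasDerivWithinAt)
      (fun t ht => hclose t (abs_le.2 ht)) (x := 0) (y := t) ⟨by linarith, hC⟩ (abs_le.1 ht)
    simp only [hP0, hφ0, sub_zero, Real.norm_eq_abs] at this
    refine this.trans ?_
    nlinarith

section

variable {X : Type*} [TopologicalSpace X] [MeasurableSpace X] [BorelSpace X]
  {δ : X → X → ℝ≥0∞} {m : Measure X} {q : ℝ≥0∞} {f f₁ f₂ G G₁ G₂ : X → ℝ}

theorem ApproxGrad.aestronglyMeasurable {𝒜 : Set (X → ℝ)} (h𝒜 : 𝒜 ⊆ lipB δ)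
    (h : ApproxGrad δ m q 𝒜 f G) : AEStronglyMeasurable f m := by
  obtain ⟨u, hu, hf, -⟩ := h.exists_seq
  exact aestronglyMeasurable_of_tendsto_ae atTop
    (fun n => (h𝒜 (hu n)).1.measurable.aestronglyMeasurable) hf

omit [TopologicalSpace X] [MeasurableSpace X] [BorelSpace X] in
theorem convex_subalgebra (A : Subalgebra ℝ (X → ℝ)) : Convex ℝ (A : Set (X → ℝ)) :=
  A.toSubmodule.convex

omit [TopologicalSpace X] [MeasurableSpace X] [BorelSpace X] in
theorem aeval_comp_mem (A : Subalgebra ℝ (X → ℝ)) {w : X → ℝ} (hw : w ∈ A) (P : Polynomial ℝ) :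
    (fun x => P.eval (w x)) ∈ A := by
  have h : (fun x => P.eval (w x)) = Polynomial.aeval w P := by
    funext x
    simp [Polynomial.aeval_def, Polynomial.eval₂_eq_eval_map]
  rw [h]
  exact (Algebra.adjoin_le (singleton_subset_iff.2 hw) : Algebra.adjoin ℝ {w} ≤ A)
    (Polynomial.aeval_mem_adjoin_singleton ℝ w)

omit [TopologicalSpace X] [BorelSpace X] in
theorem memLp_combination (hf : AEStronglyMeasurable f m) {ψ : ℝ → ℝ} (hψ : Continuous ψ)
    (hψ01 : ∀ t, 0 ≤ ψ t ∧ ψ t ≤ 1) (h₁ : MemLp G₁ q m) (h₂ : MemLp G₂ q m) :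
    MemLp (fun x => ψ (f x) * G₁ x + (1 - ψ (f x)) * G₂ x) q m := by
  have hm : AEStronglyMeasurable (fun x => ψ (f x)) m := hψ.comp_aestronglyMeasurable hf
  refine MemLp.of_le (h₁.norm.add h₂.norm) ((hm.mul h₁.1).add
    ((aestronglyMeasurable_const.sub hm).mul h₂.1)) (ae_of_all _ fun x => ?_)
  obtain ⟨h0, h1⟩ := hψ01 (f x)
  simp only [Pi.add_apply, Real.norm_eq_abs]
  rw [abs_of_nonneg (by positivity : 0 ≤ |G₁ x| + |G₂ x|)]
  refine (abs_add_le _ _).trans ?_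
  rw [abs_mul, abs_mul, abs_of_nonneg h0, abs_of_nonneg (by linarith : 0 ≤ 1 - ψ (f x))]
  nlinarith [abs_nonneg (G₁ x), abs_nonneg (G₂ x)]

variable [IsFiniteMeasure m] [Fact (1 ≤ q)]

/-- The key calculus rule: gradient bounds of `f₂ + φ (f₁ - f₂)` where `φ' = ψ ∈ [0,1]`. -/
theorem ApproxGrad.combination (hδ : IsDistance δ) (hq_top : q ≠ ∞) {A : Subalgebra ℝ (X → ℝ)}
    (hA : (A : Set (X → ℝ)) ⊆ lipB δ) (hS₁ : ApproxGrad δ m q A f₁ G₁)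
    (hS₂ : ApproxGrad δ m q A f₂ G₂) {φ ψ : ℝ → ℝ} (hφ : ∀ t, HasDerivAt φ (ψ t) t)
    (hψ : Continuous ψ) (hψ01 : ∀ t, 0 ≤ ψ t ∧ ψ t ≤ 1) (hφ0 : φ 0 = 0) :
    ApproxGrad δ m q A (fun x => f₂ x + φ (f₁ x - f₂ x))
      (fun x => ψ (f₁ x - f₂ x) * G₁ x + (1 - ψ (f₁ x - f₂ x)) * G₂ x) := by
  have hfm : AEStronglyMeasurable (fun x => f₁ x - f₂ x) m :=
    (hS₁.aestronglyMeasurable hA).sub (hS₂.aestronglyMeasurable hA)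
  obtain ⟨u₁, hu₁, hae₁, hs₁⟩ := hS₁.exists_seq
  obtain ⟨u₂, hu₂, hae₂, hs₂⟩ := hS₂.exists_seq
  have hbd : ∀ n, ∃ C : ℝ, 0 ≤ C ∧ ∀ x, |u₁ n x - u₂ n x| ≤ C := by
    intro n
    obtain ⟨C, hC⟩ := (hA (hu₁ n)).2.1
    obtain ⟨D, hD⟩ := (hA (hu₂ n)).2.1
    refine ⟨|C| + |D|, by positivity, fun x => (abs_sub _ _).trans ?_⟩
    exact add_le_add ((hC x).trans (le_abs_self _)) ((hD x).trans (le_abs_self _))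
  choose C hC0 hC using hbd
  -- The algebra is closed only under polynomials, so `φ` is replaced by `P n`. The sup bounds of
  -- `u₁ n` and `u₂ n` may grow with `n`, hence a separate interval and polynomial for each `n`.
  choose P hP using fun n : ℕ => exists_polynomial_near_deriv hφ hψ hψ01 hφ0 (hC0 n)
    (by positivity : 0 < 1 / ((n : ℝ) + 1))
  have hP01 := fun n t ht => (hP n t ht).1
  have hPψ := fun n t ht => (hP n t ht).2.1
  have hPφ := fun n t ht => (hP n t ht).2.2
  set w : ℕ → X → ℝ := fun n x => u₁ n x - u₂ n x with hw
  set v : ℕ → X → ℝ := fun n x => u₂ n x + (P n).eval (w n x) with hv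
  have hvA : ∀ n, v n ∈ A := fun n =>
    A.add_mem (hu₂ n) (aeval_comp_mem A (A.sub_mem (hu₁ n) (hu₂ n)) (P n))
  have hwae : ∀ᵐ x ∂m, Tendsto (fun n => w n x) atTop (𝓝 (f₁ x - f₂ x)) := by
    filter_upwards [hae₁, hae₂] with x h1 h2 using h1.sub h2
  have hφc : Continuous φ := continuous_iff_continuousAt.2 fun t => (hφ t).continuousAt
  set h' : X → ℝ := fun x => ψ (f₁ x - f₂ x) * G₁ x + (1 - ψ (f₁ x - f₂ x)) * G₂ x with hh'
  have hh'mem : MemLp h' q m := memLp_combination hfm hψ hψ01 hS₁.1 hS₂.1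
  set h : ℕ → X → ℝ := fun n x => (P n).derivative.eval (w n x) * G₁ x
    + (1 - (P n).derivative.eval (w n x)) * G₂ x with hh
  have hwc : ∀ n, Continuous (w n) := fun n => (hA (hu₁ n)).1.sub (hA (hu₂ n)).1
  have hhm : ∀ n, AEStronglyMeasurable (h n) m := by
    intro n
    have hm : AEStronglyMeasurable (fun x => (P n).derivative.eval (w n x)) m :=
      ((P n).derivative.continuous.comp (hwc n)).measurable.aestronglyMeasurable
    exact (hm.mul hS₁.1.1).add ((aestronglyMeasurable_const.sub hm).mul hS₂.1.1)
  have hlimh : Tendsto (fun n => eLpNorm (fun x => h n x - h' x) q m) atTop (𝓝 0) := by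
    refine tendsto_eLpNorm_sub_of_dominated hq_top (hS₁.1.norm.add hS₂.1.norm) hhm hh'mem.1
      (fun n => ae_of_all _ fun x => ?_) ?_
    · obtain ⟨k0, k1⟩ := hP01 n (w n x) (hC n x)
      obtain ⟨k2, k3⟩ := hψ01 (f₁ x - f₂ x)
      have e : h n x - h' x = ((P n).derivative.eval (w n x) - ψ (f₁ x - f₂ x)) * G₁ x
          - ((P n).derivative.eval (w n x) - ψ (f₁ x - f₂ x)) * G₂ x := by
        simp only [hh, hh']; ring
      have k4 : |(P n).derivative.eval (w n x) - ψ (f₁ x - f₂ x)| ≤ 1 := by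
        rw [abs_le]; constructor <;> linarith
      rw [e]
      refine (abs_sub _ _).trans ?_
      rw [abs_mul, abs_mul]
      simp only [Pi.add_apply, Real.norm_eq_abs]
      exact add_le_add (mul_le_of_le_one_left (abs_nonneg _) k4)
        (mul_le_of_le_one_left (abs_nonneg _) k4)
    · filter_upwards [hwae] with x hx
      have hd : Tendsto (fun n => (P n).derivative.eval (w n x)) atTop (𝓝 (ψ (f₁ x - f₂ x))) := by
        have h1 : Tendsto (fun n => (P n).derivative.eval (w n x) - ψ (w n x)) atTop (𝓝 0) :=
          squeeze_zero_norm (fun n => hPψ n _ (hC n x)) tendsto_one_div_add_atTop_nhds_zero_nat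
        simpa using h1.add ((hψ.tendsto _).comp hx)
      exact (hd.mul_const _).add ((tendsto_const_nhds.sub hd).mul_const _)
  refine ApproxGrad.of_seq hh'mem (u := v) hvA ?_ ?_
  · refine tendstoInMeasure_of_tendsto_ae
      (fun n => (hA (hvA n)).1.measurable.aestronglyMeasurable) ?_
    filter_upwards [hwae, hae₂] with x hx hx2
    refine hx2.add ?_
    have h1 : Tendsto (fun n => (P n).eval (w n x) - φ (w n x)) atTop (𝓝 0) :=
      squeeze_zero_norm (fun n => hPφ n _ (hC n x)) tendsto_one_div_add_atTop_nhds_zero_nat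
    simpa using h1.add ((hφc.tendsto _).comp hx)
  · have hlim := (hs₁.add hs₂).add hlimh
    rw [add_zero, add_zero] at hlim
    have hm₁ : ∀ n, AEStronglyMeasurable (fun x => max (lipSlope δ (u₁ n) x - G₁ x) 0) m :=
      fun n => ((measurable_lipSlope _).aestronglyMeasurable.sub hS₁.1.1).sup
        aestronglyMeasurable_const
    have hm₂ : ∀ n, AEStronglyMeasurable (fun x => max (lipSlope δ (u₂ n) x - G₂ x) 0) m :=
      fun n => ((measurable_lipSlope _).aestronglyMeasurable.sub hS₂.1.1).sup
        aestronglyMeasurable_const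
    refine tendsto_of_tendsto_of_tendsto_of_le_of_le tendsto_const_nhds hlim
      (fun _ => zero_le) fun n => ?_
    have hm₃ : AEStronglyMeasurable (fun x => |h n x - h' x|) m := ((hhm n).sub hh'mem.1).norm
    -- As the weights lie in `[0,1]`, the excess of `lip (v n)` over `h n` is at most the sum of the
    -- excesses of the two slopes over `G₁` and `G₂`.
    calc eLpNorm (fun x => max (lipSlope δ (v n) x - h' x) 0) q m
        ≤ eLpNorm (((fun x => max (lipSlope δ (u₁ n) x - G₁ x) 0)
          + (fun x => max (lipSlope δ (u₂ n) x - G₂ x) 0)) + fun x => |h n x - h' x|) q m := by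
          refine eLpNorm_mono_real fun x => ?_
          rw [Real.norm_of_nonneg (le_max_right _ _)]
          simp only [Pi.add_apply]
          have hsl := lipSlope_combination_le hδ (hA (hu₁ n)) (hA (hu₂ n))
            (fun t => (P n).hasDerivAt t) (P n).derivative.continuous (hC n) (hP01 n) x
          obtain ⟨k0, k1⟩ := hP01 n (w n x) (hC n x)
          have a1 := le_max_left (lipSlope δ (u₁ n) x - G₁ x) 0
          have a1' := le_max_right (lipSlope δ (u₁ n) x - G₁ x) 0
          have a2 := le_max_left (lipSlope δ (u₂ n) x - G₂ x) 0
          have a2' := le_max_right (lipSlope δ (u₂ n) x - G₂ x) 0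
          have a3 := le_abs_self (h n x - h' x)
          refine max_le ?_ (by positivity)
          change lipSlope δ (v n) x ≤ (P n).derivative.eval (w n x) * lipSlope δ (u₁ n) x
            + (1 - (P n).derivative.eval (w n x)) * lipSlope δ (u₂ n) x at hsl
          have hx : h n x = (P n).derivative.eval (w n x) * G₁ x
            + (1 - (P n).derivative.eval (w n x)) * G₂ x := rfl
          nlinarith [mul_le_mul_of_nonneg_left a1 k0,
            mul_le_mul_of_nonneg_left a2 (by linarith : 0 ≤ 1 - (P n).derivative.eval (w n x)),
            mul_le_of_le_one_left a1' k1, mul_le_of_le_one_left a2'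
              (by linarith : 1 - (P n).derivative.eval (w n x) ≤ 1)]
      _ ≤ _ := by
          refine (eLpNorm_add_le ((hm₁ n).add (hm₂ n)) hm₃ Fact.out).trans ?_
          refine add_le_add (eLpNorm_add_le (hm₁ n) (hm₂ n) Fact.out) ?_
          exact (eLpNorm_norm (fun x => h n x - h' x)).le

/-- The functions `φ n` are smooth versions of `t ↦ min t 0` that vanish at `0` and have slopes in
`[0,1]`, and `min f₁ f₂ = f₂ + min (f₁ - f₂) 0`. With equal bounds, the convex combination in the
chain rule is exactly `c`. -/
theorem ApproxGrad.min_const (hδ : IsDistance δ) (hq_top : q ≠ ∞) {A : Subalgebra ℝ (X → ℝ)}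
    (hA : (A : Set (X → ℝ)) ⊆ lipB δ) {c : ℝ} (hS₁ : ApproxGrad δ m q A f₁ fun _ => c)
    (hS₂ : ApproxGrad δ m q A f₂ fun _ => c) :
    ApproxGrad δ m q A (fun x => min (f₁ x) (f₂ x)) fun _ => c := by
  set ε : ℕ → ℝ := fun n => 1 / ((n : ℝ) + 1) with hε
  have hε0 : ∀ n, 0 < ε n := fun n => by positivity
  have hlim : Tendsto ε atTop (𝓝 0) := tendsto_one_div_add_atTop_nhds_zero_nat
  set φ : ℕ → ℝ → ℝ := fun n t => (t - √(t ^ 2 + ε n ^ 2) + ε n) / 2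
  set ψ : ℕ → ℝ → ℝ := fun n t => (1 - t / √(t ^ 2 + ε n ^ 2)) / 2
  have hpos : ∀ n t, 0 < t ^ 2 + ε n ^ 2 := fun n t => by have := hε0 n; positivity
  have hφ : ∀ n t, HasDerivAt (φ n) (ψ n t) t := by
    intro n t
    have h1 : HasDerivAt (fun t : ℝ => t ^ 2 + ε n ^ 2) (2 * t) t := by
      simpa using (hasDerivAt_pow 2 t).add_const (ε n ^ 2)
    have h2 := ((((hasDerivAt_id t).sub (h1.sqrt (hpos n t).ne')).add_const (ε n)).div_const 2)
    rw [mul_div_mul_left _ _ two_ne_zero] at h2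
    exact h2
  have hψ : ∀ n, Continuous (ψ n) := by
    intro n
    refine (continuous_const.sub (continuous_id.div ?_ fun t => ?_)).div_const 2
    · fun_prop
    · exact (Real.sqrt_pos.2 (hpos n t)).ne'
  have habs : ∀ n t, |t| ≤ √(t ^ 2 + ε n ^ 2) := fun n t =>
    Real.abs_le_sqrt (by nlinarith [hε0 n])
  have hψ01 : ∀ n t, 0 ≤ ψ n t ∧ ψ n t ≤ 1 := by
    intro n t
    have h1 : |t / √(t ^ 2 + ε n ^ 2)| ≤ 1 := by
      rw [abs_div, abs_of_nonneg (Real.sqrt_nonneg _)]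
      exact div_le_one_of_le₀ (habs n t) (Real.sqrt_nonneg _)
    rw [abs_le] at h1
    simp only [ψ]
    constructor <;> linarith
  have hφ0 : ∀ n, φ n 0 = 0 := by
    intro n
    simp [φ, Real.sqrt_sq (hε0 n).le]
  have hS := fun n => (hS₁.combination hδ hq_top hA hS₂ (hφ n) (hψ n) (hψ01 n) (hφ0 n)).congr
    (G' := fun _ => c) (ae_eq_refl _) (ae_of_all _ fun x => by dsimp only; ring)
  refine ApproxGrad.closed_left hS ?_
  refine tendstoInMeasure_of_tendsto_ae (fun n => (hS n).aestronglyMeasurable hA)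
    (ae_of_all _ fun x => ?_)
  have h1 : Tendsto (fun n => f₂ x + φ n (f₁ x - f₂ x)) atTop
      (𝓝 (f₂ x + (f₁ x - f₂ x - √((f₁ x - f₂ x) ^ 2 + 0 ^ 2) + 0) / 2)) :=
    tendsto_const_nhds.add (((tendsto_const_nhds.sub
      ((tendsto_const_nhds.add (hlim.pow 2)).sqrt)).add hlim).div_const 2)
  convert h1 using 2
  rw [zero_pow two_ne_zero, add_zero, add_zero, Real.sqrt_sq_eq_abs]
  rcases le_total (f₁ x) (f₂ x) with h | h
  · rw [min_eq_left h, abs_of_nonpos (by linarith)]; ring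
  · rw [min_eq_right h, abs_of_nonneg (by linarith)]; ring

/-- Locality: on `{f₁ = f₂}` a gradient bound of `f₂` may be replaced by one of `f₁`. -/
theorem ApproxGrad.piecewise (hδ : IsDistance δ) (hq_top : q ≠ ∞) {A : Subalgebra ℝ (X → ℝ)}
    (hA : (A : Set (X → ℝ)) ⊆ lipB δ) (hS₁ : ApproxGrad δ m q A f₁ G₁)
    (hS₂ : ApproxGrad δ m q A f₂ G₂) :
    ApproxGrad δ m q A f₂ (fun x => if f₁ x = f₂ x then G₁ x else G₂ x) := by
  set ε : ℕ → ℝ := fun n => 1 / ((n : ℝ) + 1) with hε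
  have hε0 : ∀ n, 0 < ε n := fun n => by positivity
  have hlim : Tendsto ε atTop (𝓝 0) := tendsto_one_div_add_atTop_nhds_zero_nat
  -- Uniformly `φ n → 0`, while the derivatives converge to the indicator of `{0}`. The functions
  -- therefore tend to `f₂`, but their bounds remember `G₁` exactly where `f₁ = f₂`.
  set φ : ℕ → ℝ → ℝ := fun n t => ε n * Real.arctan (t / ε n)
  set ψ : ℕ → ℝ → ℝ := fun n t => 1 / (1 + (t / ε n) ^ 2)
  have hφ : ∀ n t, HasDerivAt (φ n) (ψ n t) t := by
    intro n t
    have h2 := (((hasDerivAt_id t).div_const (ε n)).arctan).const_mul (ε n)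
    have := (hε0 n).ne'
    have e : ε n * (1 / (1 + (t / ε n) ^ 2) * (1 / ε n)) = ψ n t := by
      simp only [ψ]
      field_simp
    exact h2.congr_deriv e
  have hψ : ∀ n, Continuous (ψ n) := by
    intro n
    refine continuous_const.div (by fun_prop) fun t => by positivity
  have hψ01 : ∀ n t, 0 ≤ ψ n t ∧ ψ n t ≤ 1 := by
    intro n t
    refine ⟨by positivity, ?_⟩
    exact div_le_one_of_le₀ (by nlinarith [sq_nonneg (t / ε n)]) (by positivity)
  have hφ0 : ∀ n, φ n 0 = 0 := fun n => by simp [φ]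
  have hS := fun n => hS₁.combination hδ hq_top hA hS₂ (hφ n) (hψ n) (hψ01 n) (hφ0 n)
  have hlimG : ∀ x, Tendsto (fun n => ψ n (f₁ x - f₂ x) * G₁ x + (1 - ψ n (f₁ x - f₂ x)) * G₂ x)
      atTop (𝓝 (if f₁ x = f₂ x then G₁ x else G₂ x)) := by
    intro x
    split_ifs with h
    · simp [ψ, h]
    · have hne : f₁ x - f₂ x ≠ 0 := sub_ne_zero.2 h
      have h1 : Tendsto (fun n => ψ n (f₁ x - f₂ x)) atTop (𝓝 0) := by
        have e : ∀ n, ψ n (f₁ x - f₂ x) = ε n ^ 2 / (ε n ^ 2 + (f₁ x - f₂ x) ^ 2) := by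
          intro n
          have := (hε0 n).ne'
          simp only [ψ]
          field_simp
        simp only [e]
        have h2 : Tendsto (fun n => ε n ^ 2 / (ε n ^ 2 + (f₁ x - f₂ x) ^ 2)) atTop
            (𝓝 (0 ^ 2 / (0 ^ 2 + (f₁ x - f₂ x) ^ 2))) :=
          (hlim.pow 2).div ((hlim.pow 2).add_const _) (by positivity)
        simpa using h2
      simpa using (h1.mul_const (G₁ x)).add ((tendsto_const_nhds (x := (1 : ℝ)).sub h1).mul_const (G₂ x))
  have hGm : AEStronglyMeasurable (fun x => if f₁ x = f₂ x then G₁ x else G₂ x) m :=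
    aestronglyMeasurable_of_tendsto_ae atTop (fun n => (hS n).1.1) (ae_of_all _ hlimG)
  have hG : MemLp (fun x => if f₁ x = f₂ x then G₁ x else G₂ x) q m := by
    refine MemLp.of_le (hS₁.1.norm.add hS₂.1.norm) hGm (ae_of_all _ fun x => ?_)
    simp only [Pi.add_apply, Real.norm_eq_abs]
    rw [abs_of_nonneg (by positivity : 0 ≤ |G₁ x| + |G₂ x|)]
    split_ifs
    · linarith [abs_nonneg (G₂ x)]
    · linarith [abs_nonneg (G₁ x)]
  refine ApproxGrad.closed hS ?_ hG ?_
  · refine tendstoInMeasure_of_tendsto_ae (fun n => (hS n).aestronglyMeasurable hA)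
      (ae_of_all _ fun x => ?_)
    have h1 : Tendsto (fun n => φ n (f₁ x - f₂ x)) atTop (𝓝 0) := by
      have h2 : Tendsto (fun n => ε n * (Real.pi / 2)) atTop (𝓝 0) := by
        simpa using hlim.mul_const (Real.pi / 2)
      refine squeeze_zero_norm (fun n => ?_) h2
      simp only [φ]
      rw [Real.norm_eq_abs, abs_mul, abs_of_pos (hε0 n)]
      gcongr
      exact abs_le.2 ⟨(Real.neg_pi_div_two_lt_arctan _).le, (Real.arctan_lt_pi_div_two _).le⟩
    simpa using h1.const_add (f₂ x)
  · refine tendsto_eLpNorm_sub_of_dominated hq_top (hS₁.1.norm.add hS₂.1.norm)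
      (fun n => (hS n).1.1) hGm (fun n => ae_of_all _ fun x => ?_) (ae_of_all _ hlimG)
    obtain ⟨k0, k1⟩ := hψ01 n (f₁ x - f₂ x)
    simp only [Pi.add_apply, Real.norm_eq_abs]
    split_ifs with h
    · have e : ψ n (f₁ x - f₂ x) * G₁ x + (1 - ψ n (f₁ x - f₂ x)) * G₂ x - G₁ x
          = (1 - ψ n (f₁ x - f₂ x)) * (G₂ x - G₁ x) := by ring
      rw [e, abs_mul, abs_of_nonneg (by linarith)]
      nlinarith [abs_sub (G₂ x) (G₁ x), abs_nonneg (G₂ x - G₁ x)]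
    · have e : ψ n (f₁ x - f₂ x) * G₁ x + (1 - ψ n (f₁ x - f₂ x)) * G₂ x - G₂ x
          = ψ n (f₁ x - f₂ x) * (G₁ x - G₂ x) := by ring
      rw [e, abs_mul, abs_of_nonneg k0]
      nlinarith [abs_sub (G₁ x) (G₂ x), abs_nonneg (G₁ x - G₂ x)]

omit [Fact (1 ≤ q)] in
theorem ApproxGrad.affine (hδ : IsDistance δ) {A : Subalgebra ℝ (X → ℝ)}
    (hA : (A : Set (X → ℝ)) ⊆ lipB δ) {c L : ℝ} (a : ℝ) (hL : 0 ≤ L)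
    (hS : ApproxGrad δ m q A f fun _ => c) :
    ApproxGrad δ m q A (fun x => a + L * f x) fun _ => L * c := by
  obtain ⟨u, hu, hae, hs⟩ := hS.exists_seq
  have hv : ∀ n, (fun x => a + L * u n x) ∈ A := fun n =>
    A.add_mem (A.algebraMap_mem a) (A.smul_mem (hu n) L)
  refine ApproxGrad.of_seq (memLp_const _) (u := fun n x => a + L * u n x) hv ?_ ?_
  · refine tendstoInMeasure_of_tendsto_ae
      (fun n => (hA (hv n)).1.measurable.aestronglyMeasurable) ?_
    filter_upwards [hae] with x hx using (hx.const_mul L).const_add a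
  · have h0 := ENNReal.Tendsto.const_mul hs (a := ENNReal.ofReal L) (Or.inr ENNReal.ofReal_ne_top)
    rw [mul_zero] at h0
    refine tendsto_of_tendsto_of_tendsto_of_le_of_le tendsto_const_nhds h0
      (fun _ => zero_le) fun n => ?_
    have e : ENNReal.ofReal L = ‖L‖ₑ := by rw [← ofReal_norm, Real.norm_of_nonneg hL]
    dsimp only
    rw [e, ← eLpNorm_const_smul]
    refine eLpNorm_mono_real fun x => ?_
    rw [Real.norm_of_nonneg (le_max_right _ _)]
    have h1 := lipSlope_affine_le hδ (hA (hu n)) (hA (hu n)) a L 0 x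
    simp only [zero_mul, add_zero, abs_zero, abs_of_nonneg hL] at h1
    simp only [Pi.smul_apply, smul_eq_mul]
    have := le_max_left (lipSlope δ (u n) x - c) 0
    refine max_le ?_ (mul_nonneg hL (le_max_right _ _))
    nlinarith

end

end MetricSobolev

/-! ### Gradient bounds of `d`-Lipschitz functions, global and local -/

namespace MetricSobolev

section

variable {X : Type*} [MetricSpace X] [MeasurableSpace X] [BorelSpace X]
  {δ : X → X → ℝ≥0∞} {m : Measure X} [IsFiniteMeasure m] {q : ℝ≥0∞} [Fact (1 ≤ q)]

/-- Lipschitz functions are infima of cones with vertices in a dense set. -/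
theorem ApproxGrad.of_lipschitzWith (hδ : IsDistance δ) (hq_top : q ≠ ∞)
    {A : Subalgebra ℝ (X → ℝ)} (hA : (A : Set (X → ℝ)) ⊆ lipB δ) {Y : Set X}
    (hY_count : Y.Countable) (hY_dense : Dense Y)
    (hY : ∀ y ∈ Y, ApproxGrad δ m q A (fun x => dist y x) fun _ => 1) {F : X → ℝ} {K : ℝ≥0}
    (hF : LipschitzWith K F) : ApproxGrad δ m q A F fun _ => (K : ℝ) := by
  rcases isEmpty_or_nonempty X with hX | hX
  · have h0 : ApproxGrad δ m q A F (lipSlope δ F) :=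
      ApproxGrad.of_mem (by rw [Subsingleton.elim F 0]; exact A.zero_mem) hA
    exact h0.mono (memLp_const _) (ae_of_all _ fun x => (hX.false x).elim)
  obtain ⟨y, hy⟩ := hY_count.exists_eq_range hY_dense.nonempty
  have hcone : ∀ i, ApproxGrad δ m q A (fun x => F (y i) + K * dist (y i) x) fun _ => (K : ℝ) := by
    intro i
    have := (hY (y i) (hy ▸ mem_range_self i)).affine hδ hA (F (y i)) K.coe_nonneg
    simpa using this
  -- Running minima of the cones: each lies above `F`, and near `x` a cone with vertex close to `x`
  -- forces convergence.
  let g : ℕ → X → ℝ := fun n => Nat.rec (fun x => F (y 0) + K * dist (y 0) x)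
    (fun k h x => min (h x) (F (y (k + 1)) + K * dist (y (k + 1)) x)) n
  have hg : ∀ n, ApproxGrad δ m q A (g n) fun _ => (K : ℝ) := by
    intro n
    induction n with
    | zero => exact hcone 0
    | succ k ih => exact ih.min_const hδ hq_top hA (hcone (k + 1))
  have hge : ∀ n x, F x ≤ g n x := by
    intro n x
    have hc : ∀ i, F x ≤ F (y i) + K * dist (y i) x := fun i => by
      have h1 := hF.dist_le_mul x (y i)
      rw [Real.dist_eq, dist_comm] at h1
      linarith [le_abs_self (F x - F (y i))]
    induction n with
    | zero => exact hc 0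
    | succ k ih => exact le_min ih (hc (k + 1))
  have hle : ∀ n i x, i ≤ n → g n x ≤ F (y i) + K * dist (y i) x := by
    intro n i x hi
    induction n with
    | zero => rw [Nat.le_zero.1 hi]; exact le_rfl
    | succ k ih =>
      rcases Nat.le_succ_iff.1 hi with h | h
      · exact (min_le_left _ _).trans (ih h)
      · rw [h]; exact min_le_right _ _
  refine ApproxGrad.closed_left hg ?_
  refine tendstoInMeasure_of_tendsto_ae (fun n => (hg n).aestronglyMeasurable hA)
    (ae_of_all _ fun x => ?_)
  rw [Metric.tendsto_atTop]
  intro ε hε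
  obtain ⟨_, hyY, hd⟩ := hY_dense.exists_dist_lt x (ε := ε / (2 * (K + 1))) (by positivity)
  rw [hy] at hyY
  obtain ⟨i, rfl⟩ := hyY
  refine ⟨i, fun n hn => ?_⟩
  have h1 := hle n i x hn
  have h2 := hge n x
  have h3 := hF.dist_le_mul (y i) x
  rw [dist_comm] at hd
  rw [Real.dist_eq] at h3
  rw [lt_div_iff₀ (by positivity)] at hd
  have h4 : 2 * (K * dist (y i) x) < ε := by nlinarith [dist_nonneg (x := y i) (y := x)]
  rw [Real.dist_eq, abs_of_nonneg (by linarith)]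
  linarith [le_abs_self (F (y i) - F x)]

/-- The `L`-Lipschitz extension `g` of `F` from `D` may meet `F` outside `D`, where its bound could
exceed `G`. Adding `M` times the distance to `D`, with `M > L + K`, gives `g'` that coincides with
each of `g` and `F` exactly on `D`. Locality then carries the bound `L` from `g` to `g'` and from
`g'` to `F`, changing nothing off `D`. -/
theorem ApproxGrad.piecewise_of_lipschitzOnWith (hδ : IsDistance δ) (hq_top : q ≠ ∞)
    {A : Subalgebra ℝ (X → ℝ)} (hA : (A : Set (X → ℝ)) ⊆ lipB δ)
    (hLip : ∀ (F : X → ℝ) (K : ℝ≥0), LipschitzWith K F → ApproxGrad δ m q A F fun _ => (K : ℝ))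
    {F G : X → ℝ} {K : ℝ≥0} (hF : LipschitzWith K F) (hG : ApproxGrad δ m q A F G) {D : Set X}
    (hD : IsClosed D) (hne : D.Nonempty) {L : ℝ≥0} (hL : LipschitzOnWith L F D) [DecidablePred (· ∈ D)] :
    ApproxGrad δ m q A F (fun x => if x ∈ D then (L : ℝ) else G x) := by
  obtain ⟨g, hg, hgF⟩ := hL.extend_real
  set M : ℝ≥0 := L + K + 1 with hM
  have hdist : LipschitzWith 1 fun x => Metric.infDist x D := Metric.lipschitz_infDist_pt D
  set g' : X → ℝ := fun x => g x + M * Metric.infDist x D with hg'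
  have hg'lip : LipschitzWith (L + M) g' := by
    refine hg.add ?_
    refine LipschitzWith.of_dist_le_mul fun x y => ?_
    have h1 := hdist.dist_le_mul x y
    rw [Real.dist_eq] at h1 ⊢
    rw [← mul_sub, abs_mul, abs_of_nonneg M.coe_nonneg]
    simp only [NNReal.coe_one, one_mul] at h1
    exact mul_le_mul_of_nonneg_left h1 M.coe_nonneg
  have h1 := (hLip g L hg).piecewise hδ hq_top hA (hLip g' _ hg'lip)
  have h2 := h1.piecewise hδ hq_top hA hG
  have hmem : ∀ x, x ∈ D ↔ Metric.infDist x D = 0 := fun x => hD.mem_iff_infDist_zero hne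
  have hM0 : (M : ℝ) ≠ 0 := by positivity
  have hgg' : ∀ x, g x = g' x ↔ x ∈ D := by
    intro x
    rw [hmem]
    simp only [hg', left_eq_add, mul_eq_zero, hM0, false_or]
  have hg'F : ∀ x, g' x = F x ↔ x ∈ D := by
    intro x
    refine ⟨fun h => ?_, fun h => ?_⟩
    · by_contra hx
      have hpos : 0 < Metric.infDist x D :=
        lt_of_le_of_ne Metric.infDist_nonneg (Ne.symm fun h0 => hx ((hmem x).2 h0))
      -- The distance to `D` need not be attained. The factor leaves room for a nearby `z ∈ D` with
      -- `(L + K + 1/2) d(x,z) < M dist(x,D)`, whereas `g' x = F x` would give `M dist(x,D) ≤ (L +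
      -- K) d(x,z)`.
      have hlt : Metric.infDist x D < Metric.infDist x D * ((L + K + 1) / (L + K + 1 / 2)) := by
        refine lt_mul_of_one_lt_right hpos ?_
        rw [one_lt_div (by positivity)]; linarith
      obtain ⟨z, hz, hzd⟩ := (Metric.infDist_lt_iff hne).1 hlt
      rw [mul_div_assoc', lt_div_iff₀ (by positivity)] at hzd
      have e1 := hg.dist_le_mul x z
      have e2 := hF.dist_le_mul x z
      have e3 := hgF hz
      rw [Real.dist_eq] at e1 e2
      have e4 := (abs_le.1 e1).1
      have e5 := (abs_le.1 e2).2
      have e6 : g x + (L + K + 1) * Metric.infDist x D = F x := by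
        simpa [hg', hM] using h
      have : 0 ≤ dist x z := dist_nonneg
      linarith
    · rw [← (hgg' x).2 h]; exact (hgF h).symm
  refine h2.congr (ae_eq_refl _) (ae_of_all _ fun x => ?_)
  by_cases hx : x ∈ D
  · simp only [(hgg' x).2 hx, (hg'F x).2 hx, hx, if_true]
  · have : ¬ g' x = F x := fun h => hx ((hg'F x).1 h)
    simp only [this, hx, if_false]

/-- A function that is Lipschitz and locally `(H x + ε)`-Lipschitz near `x` has gradient bound `H`. -/
theorem ApproxGrad.of_locally_lipschitz [SecondCountableTopology X] (hδ : IsDistance δ)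
    (hq_one : 1 < q) (hq_top : q ≠ ∞)
    {A : Subalgebra ℝ (X → ℝ)} (hA : (A : Set (X → ℝ)) ⊆ lipB δ)
    (hLip : ∀ (F : X → ℝ) (K : ℝ≥0), LipschitzWith K F → ApproxGrad δ m q A F fun _ => (K : ℝ))
    {F H : X → ℝ} {K : ℝ≥0} (hF : LipschitzWith K F) (hH : Continuous H) (hHp : MemLp H q m)
    (hH0 : ∀ x, 0 ≤ H x)
    (hloc : ∀ x, ∀ ε : ℝ≥0, 0 < ε → ∃ U ∈ 𝓝 x, LipschitzOnWith ((H x).toNNReal + ε) F U) :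
    ApproxGrad δ m q A F H := by
  classical
  have hq0 : q ≠ 0 := (zero_lt_one.trans hq_one).ne'
  have hpos : 0 < q.toReal := ENNReal.toReal_pos hq0 hq_top
  -- It suffices that the minimal bound lies below `H`. Otherwise lowering it on a closed set of
  -- positive measure, by locality, would reduce its norm.
  obtain ⟨G, hG, hmin⟩ := (hLip F K hF).exists_min hδ hq_one hq_top hA (convex_subalgebra A)
  refine hG.mono hHp ?_
  have hGm : Measurable G := (Lp.stronglyMeasurable G).measurable
  suffices h : ∀ n : ℕ, m {x | H x + 3 * (1 / ((n : ℝ) + 1)) < G x} = 0 by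
    have h' : ∀ᵐ x ∂m, ∀ n : ℕ, G x ≤ H x + 3 * (1 / ((n : ℝ) + 1)) := by
      rw [ae_all_iff]
      intro n
      simpa [ae_iff] using h n
    filter_upwards [h'] with x hx
    have : Tendsto (fun n : ℕ => H x + 3 * (1 / ((n : ℝ) + 1))) atTop (𝓝 (H x + 3 * 0)) :=
      tendsto_const_nhds.add (tendsto_one_div_add_atTop_nhds_zero_nat.const_mul 3)
    simpa using ge_of_tendsto' this hx
  intro n
  set ε : ℝ≥0 := 1 / ((n : ℝ≥0) + 1) with hε
  have hε0 : 0 < ε := by positivity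
  have hεr : 1 / ((n : ℝ) + 1) = (ε : ℝ) := by simp [hε]
  rw [hεr]
  -- Of the three `ε`, one enters the local Lipschitz constant `L = H x + ε`, one pays for the
  -- oscillation of `H` near `x`, and one is left as the strict gap `G ≥ L + ε` on `D`.
  set E : Set X := {x | H x + 3 * (ε : ℝ) < G x} with hE
  have hEm : MeasurableSet E := measurableSet_lt (hH.measurable.add_const _) hGm
  refine measure_null_of_locally_null E fun x hx => ?_
  obtain ⟨U, hU, hUl⟩ := hloc x ε hε0
  have hV : U ∩ {y | H x - ε < H y} ∈ 𝓝 x :=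
    inter_mem hU ((hH.tendsto x).eventually_const_lt (sub_lt_self _ hε0))
  obtain ⟨V, hVs, hVo, hxV⟩ := mem_nhds_iff.1 hV
  refine ⟨E ∩ V, inter_mem_nhdsWithin _ (hVo.mem_nhds hxV), ?_⟩
  by_contra hne0
  obtain ⟨D, hDs, hDc, hDpos⟩ := (hEm.inter hVo.measurableSet).exists_lt_isClosed_of_ne_top
    (measure_ne_top m _) (pos_iff_ne_zero.2 hne0)
  have hDne : D.Nonempty := nonempty_of_measure_ne_zero hDpos.ne'
  set L : ℝ≥0 := (H x).toNNReal + ε with hL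
  have hLr : (L : ℝ) = H x + ε := by simp [hL, hH0 x]
  have hSG := hG.piecewise_of_lipschitzOnWith hδ hq_top hA hLip hF hDc hDne
    (hUl.mono fun z hz => (hVs (hDs hz).2).1)
  set G' : X → ℝ := fun x => if x ∈ D then (L : ℝ) else G x with hG'
  have hle := hmin _ (hSG.congr (ae_eq_refl _) hSG.1.coeFn_toLp.symm)
  have hDm := hDc.measurableSet
  have hGbig : ∀ z ∈ D, (L : ℝ) + ε ≤ G z := by
    intro z hz
    have h1 : H z + 3 * (ε : ℝ) < G z := (hDs hz).1
    have h2 : H x - ε < H z := (hVs (hDs hz).2).2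
    rw [hLr]; linarith
  have hle' : eLpNorm G q m ≤ eLpNorm G' q m := by
    rw [Lp.norm_def, Lp.norm_def] at hle
    have := (ENNReal.toReal_le_toReal (Lp.eLpNorm_ne_top G) (Lp.eLpNorm_ne_top _)).1 hle
    rwa [eLpNorm_congr_ae hSG.1.coeFn_toLp] at this
  rw [eLpNorm_eq_lintegral_rpow_enorm_toReal hq0 hq_top,
    eLpNorm_eq_lintegral_rpow_enorm_toReal hq0 hq_top,
    ENNReal.rpow_le_rpow_iff (by positivity), ← lintegral_add_compl _ hDm,
    ← lintegral_add_compl (fun x => ‖G' x‖ₑ ^ q.toReal) hDm] at hle'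
  have hc : ∫⁻ z in Dᶜ, ‖G' z‖ₑ ^ q.toReal ∂m = ∫⁻ z in Dᶜ, ‖G z‖ₑ ^ q.toReal ∂m := by
    refine setLIntegral_congr_fun hDm.compl fun z hz => ?_
    have : z ∉ D := hz
    simp only [hG', this, if_false]
  have hfin : ∫⁻ z in Dᶜ, ‖G z‖ₑ ^ q.toReal ∂m ≠ ∞ :=
    ((setLIntegral_le_lintegral _ _).trans_lt
      (lintegral_rpow_enorm_lt_top_of_eLpNorm_lt_top hq0 hq_top (Lp.memLp G).2)).ne
  rw [hc, ENNReal.add_le_add_iff_right hfin] at hle'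
  have h1 : ∫⁻ z in D, ‖G' z‖ₑ ^ q.toReal ∂m = ENNReal.ofReal L ^ q.toReal * m D := by
    rw [← setLIntegral_const]
    refine setLIntegral_congr_fun hDm fun z hz => ?_
    simp only [hG', hz, if_true]
    rw [Real.enorm_eq_ofReal L.coe_nonneg]
  have h2 : ENNReal.ofReal (L + ε) ^ q.toReal * m D ≤ ∫⁻ z in D, ‖G z‖ₑ ^ q.toReal ∂m := by
    rw [← setLIntegral_const]
    refine setLIntegral_mono' hDm fun z hz => ?_
    have h3 := hGbig z hz
    have h4 : (0 : ℝ) ≤ L + ε := by positivity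
    rw [Real.enorm_eq_ofReal (h4.trans h3)]
    gcongr
  have h3 := h2.trans (hle'.trans h1.le)
  rw [ENNReal.mul_le_mul_iff_left hDpos.ne' (measure_ne_top m D),
    ENNReal.rpow_le_rpow_iff hpos, ENNReal.ofReal_le_ofReal_iff L.coe_nonneg] at h3
  have : (0 : ℝ) < ε := hε0
  linarith

end

end MetricSobolev

/-! ### Continuous majorants of upper semicontinuous functions -/

namespace MetricSobolev

section Envelope

/-- Upper semicontinuous bounded functions are limits of continuous functions from above. -/
theorem exists_continuous_approx_above {X : Type*} [PseudoMetricSpace X] {l : X → ℝ} {C : ℝ}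
    (h0 : ∀ x, 0 ≤ l x) (hC : ∀ x, l x ≤ C) (husc : ∀ x a, l x < a → ∀ᶠ y in 𝓝 x, l y < a) :
    ∃ g : ℕ → X → ℝ, (∀ n, Continuous (g n)) ∧ (∀ n x, l x ≤ g n x) ∧ (∀ n x, g n x ≤ C) ∧
      ∀ x, Tendsto (fun n => g n x) atTop (𝓝 (l x)) := by
  -- The sup-convolution is `n`-Lipschitz. Once `n r ≥ C`, points at distance at least `r` cannot
  -- contribute more than `l x`.
  set g : ℕ → X → ℝ := fun n x => ⨆ y, (l y - n * dist x y) with hg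
  have hbdd : ∀ (n : ℕ) x, BddAbove (range fun y => l y - n * dist x y) := by
    rintro n x
    refine ⟨C, ?_⟩
    rintro _ ⟨y, rfl⟩
    have : 0 ≤ (n : ℝ) * dist x y := by positivity
    dsimp only
    linarith [hC y]
  have hle : ∀ n x y, l y - n * dist x y ≤ g n x := fun n x y => le_ciSup (hbdd n x) y
  have hub : ∀ (n : ℕ) x b, (∀ y, l y - n * dist x y ≤ b) → g n x ≤ b := fun n x b h =>
    haveI : Nonempty X := ⟨x⟩
    ciSup_le h
  refine ⟨g, fun n => ?_, fun n x => by simpa using hle n x x, fun n x => hub n x C fun y => ?_,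
    fun x => ?_⟩
  · refine LipschitzWith.continuous (K := n) (LipschitzWith.of_le_add_mul _ fun x y => ?_)
    refine hub n x _ fun z => ?_
    have h1 := hle n y z
    have h2 : (n : ℝ) * dist y z ≤ n * (dist x y + dist x z) := by
      gcongr; rw [dist_comm x y]; exact dist_triangle _ _ _
    simp only [NNReal.coe_natCast]
    linarith
  · have : 0 ≤ (n : ℝ) * dist x y := by positivity
    linarith [hC y]
  · rw [Metric.tendsto_atTop]
    intro ε hε
    obtain ⟨r, hr, hrl⟩ := Metric.eventually_nhds_iff.1 (husc x (l x + ε / 2) (by linarith))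
    obtain ⟨n₀, hn₀⟩ := exists_nat_ge (C / r)
    refine ⟨n₀, fun n hn => ?_⟩
    have h1 : l x ≤ g n x := by simpa using hle n x x
    have h2 : g n x ≤ l x + ε / 2 := by
      refine hub n x _ fun y => ?_
      by_cases hy : dist y x < r
      · have : 0 ≤ (n : ℝ) * dist x y := by positivity
        linarith [hrl hy]
      · push Not at hy
        rw [dist_comm] at hy
        have h3 : C ≤ n * r := by
          rw [div_le_iff₀ hr] at hn₀
          refine hn₀.trans ?_
          gcongr
        have h4 : (n : ℝ) * r ≤ n * dist x y := by gcongr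
        linarith [hC y, h0 x]
    rw [Real.dist_eq, abs_of_nonneg (by linarith)]
    linarith

end Envelope

/-! ### Weighted chains and their cost parametrization -/

section Chain

variable {X : Type*} [MetricSpace X]

/-- The cost of the first `k` steps of the chain `p` with weight `G`. -/
def chainCost (G : X → ℝ) (p : ℕ → X) (k : ℕ) : ℝ :=
  ∑ i ∈ Finset.range k, G (p i) * dist (p i) (p (i + 1))

/-- The infimum of `f (p 0)` plus cost over chains `p` with steps at most `σ` that end at `x`. -/
noncomputable def chainInf (f G : X → ℝ) (σ : ℝ) (x : X) : ℝ :=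
  sInf {c | ∃ (p : ℕ → X) (N : ℕ), p N = x ∧ (∀ i < N, dist (p i) (p (i + 1)) ≤ σ) ∧
    c = f (p 0) + chainCost G p N}

theorem chainCost_nonneg {G : X → ℝ} (hG : ∀ x, 0 ≤ G x) (p : ℕ → X) (k : ℕ) :
    0 ≤ chainCost G p k :=
  Finset.sum_nonneg fun _ _ => mul_nonneg (hG _) dist_nonneg

theorem chainCost_mono {G : X → ℝ} (hG : ∀ x, 0 ≤ G x) (p : ℕ → X) : Monotone (chainCost G p) :=
  fun _ _ h => Finset.sum_le_sum_of_subset_of_nonneg (Finset.range_mono h)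
    fun _ _ _ => mul_nonneg (hG _) dist_nonneg

theorem mul_dist_le_chainCost_sub {G : X → ℝ} {p : ℕ → X} {i k : ℕ} (hik : i ≤ k) {κ : ℝ}
    (hκ0 : 0 ≤ κ) (hκ : ∀ j, i ≤ j → j < k → κ ≤ G (p j)) :
    κ * dist (p i) (p k) ≤ chainCost G p k - chainCost G p i := by
  rw [chainCost, chainCost, ← Finset.sum_Ico_eq_sub _ hik]
  refine (mul_le_mul_of_nonneg_left (dist_le_Ico_sum_dist p hik) hκ0).trans ?_
  rw [Finset.mul_sum]
  refine Finset.sum_le_sum fun j hj => ?_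
  rw [Finset.mem_Ico] at hj
  exact mul_le_mul_of_nonneg_right (hκ j hj.1 hj.2) dist_nonneg

variable {f G : X → ℝ} {σ M : ℝ}

theorem bddBelow_chain (hf : ∀ x, |f x| ≤ M) (hG : ∀ x, 0 ≤ G x) (x : X) :
    BddBelow {c | ∃ (p : ℕ → X) (N : ℕ), p N = x ∧ (∀ i < N, dist (p i) (p (i + 1)) ≤ σ) ∧
      c = f (p 0) + chainCost G p N} := by
  refine ⟨-M, ?_⟩
  rintro _ ⟨p, N, -, -, rfl⟩
  linarith [(abs_le.1 (hf (p 0))).1, chainCost_nonneg hG p N]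

theorem chainInf_le_self (hf : ∀ x, |f x| ≤ M) (hG : ∀ x, 0 ≤ G x) (x : X) :
    chainInf f G σ x ≤ f x :=
  csInf_le (bddBelow_chain hf hG x) ⟨fun _ => x, 0, rfl, by simp, by simp [chainCost]⟩

theorem exists_chain_lt {x : X} {r : ℝ} (h : chainInf f G σ x < r) :
    ∃ (p : ℕ → X) (N : ℕ), p N = x ∧ (∀ i < N, dist (p i) (p (i + 1)) ≤ σ) ∧
      f (p 0) + chainCost G p N < r := by
  have hne : {c | ∃ (p : ℕ → X) (N : ℕ), p N = x ∧ (∀ i < N, dist (p i) (p (i + 1)) ≤ σ) ∧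
      c = f (p 0) + chainCost G p N}.Nonempty := ⟨_, fun _ => x, 0, rfl, by simp, rfl⟩
  obtain ⟨_, ⟨p, N, h1, h2, rfl⟩, hlt⟩ := exists_lt_of_csInf_lt hne h
  exact ⟨p, N, h1, h2, hlt⟩

theorem neg_le_chainInf (hf : ∀ x, |f x| ≤ M) (hG : ∀ x, 0 ≤ G x) (x : X) :
    -M ≤ chainInf f G σ x := by
  by_contra h
  push Not at h
  obtain ⟨p, N, -, -, hlt⟩ := exists_chain_lt h
  linarith [(abs_le.1 (hf (p 0))).1, chainCost_nonneg hG p N]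

/-- A chain ending at `x` is extended by one step to `y`; the weight is evaluated at the left
endpoint, which is why `G x` appears. -/
theorem chainInf_step (hf : ∀ x, |f x| ≤ M) (hG : ∀ x, 0 ≤ G x) {x y : X} (hxy : dist x y ≤ σ) :
    chainInf f G σ y ≤ chainInf f G σ x + G x * dist x y := by
  refine le_of_forall_pos_le_add fun ε hε => ?_
  obtain ⟨p, N, hpN, hp, hlt⟩ := exists_chain_lt (lt_add_of_pos_right (chainInf f G σ x) hε)
  set p' : ℕ → X := fun i => if i ≤ N then p i else y with hp'
  have h1 : ∀ i ≤ N, p' i = p i := fun i hi => by simp [hp', hi]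
  have h2 : p' (N + 1) = y := by simp [hp']
  have hcost : chainCost G p' (N + 1) = chainCost G p N + G x * dist x y := by
    rw [chainCost, Finset.sum_range_succ, h2, h1 N le_rfl, hpN, chainCost]
    congr 1
    refine Finset.sum_congr rfl fun i hi => ?_
    rw [Finset.mem_range] at hi
    rw [h1 i hi.le, h1 (i + 1) hi]
  have : chainInf f G σ y ≤ f (p' 0) + chainCost G p' (N + 1) := by
    refine csInf_le (bddBelow_chain hf hG y) ⟨p', N + 1, h2, fun i hi => ?_, rfl⟩
    rcases Nat.lt_succ_iff_lt_or_eq.1 hi with h | rfl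
    · rw [h1 i h.le, h1 (i + 1) h]; exact hp i h
    · rw [h1 i le_rfl, h2, hpN]; exact hxy
  rw [hcost, h1 0 (Nat.zero_le _)] at this
  linarith

/-- Points at distance at most `σ` are one admissible step apart, at rate `B`. For larger distances
the oscillation bound `2M` is already at most `2M / σ` times the distance. -/
theorem chainInf_lipschitzWith (hf : ∀ x, |f x| ≤ M) (hG : ∀ x, 0 ≤ G x) {B : ℝ≥0}
    (hB : ∀ x, G x ≤ B) (hσ : 0 < σ) (hM : 0 ≤ M) :
    LipschitzWith (B + (2 * M / σ).toNNReal) (chainInf f G σ) := by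
  refine LipschitzWith.of_le_add_mul _ fun x y => ?_
  have h2 : 0 ≤ 2 * M / σ := by positivity
  rw [NNReal.coe_add, Real.coe_toNNReal _ h2, add_mul]
  have h3 : 0 ≤ 2 * M / σ * dist x y := by positivity
  have h4 : 0 ≤ (B : ℝ) * dist x y := by positivity
  rcases le_or_gt (dist x y) σ with h | h
  · rw [dist_comm] at h
    have := chainInf_step hf hG h
    rw [dist_comm] at this
    have h5 : G y * dist x y ≤ B * dist x y := by gcongr; exact hB y
    linarith
  · have h5 := chainInf_le_self (σ := σ) hf hG x
    have h6 := neg_le_chainInf (σ := σ) hf hG y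
    have h7 : 2 * M ≤ 2 * M / σ * dist x y := by
      rw [div_mul_eq_mul_div, le_div_iff₀ hσ]; gcongr
    linarith [(abs_le.1 (hf x)).2]

theorem chainInf_locally_lipschitz (hf : ∀ x, |f x| ≤ M) (hG : ∀ x, 0 ≤ G x)
    (hGc : Continuous G) (hσ : 0 < σ) (x : X) {ε : ℝ≥0} (hε : 0 < ε) :
    ∃ U ∈ 𝓝 x, LipschitzOnWith ((G x).toNNReal + ε) (chainInf f G σ) U := by
  refine ⟨Metric.ball x (σ / 2) ∩ {y | G y < G x + ε}, inter_mem (Metric.ball_mem_nhds x (by positivity))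
    ((hGc.tendsto x).eventually_lt_const (lt_add_of_pos_right _ hε)), ?_⟩
  refine LipschitzOnWith.of_le_add_mul _ fun y hy z hz => ?_
  have hd : dist z y ≤ σ := by
    have h1 : dist y x < σ / 2 := hy.1
    have h2 : dist z x < σ / 2 := hz.1
    linarith [dist_triangle_right z y x]
  have h3 := chainInf_step hf hG hd
  have h4 : G z < G x + ε := hz.2
  rw [NNReal.coe_add, Real.coe_toNNReal _ (hG x), dist_comm y z]
  have : G z * dist z y ≤ (G x + ε) * dist z y := by gcongr
  linarith

/-- The index reached by a chain when the cost `t` has been spent. -/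
noncomputable def chainIndex (G : X → ℝ) (p : ℕ → X) (N : ℕ) (t : ℝ) : ℕ :=
  open Classical in Nat.findGreatest (fun i => chainCost G p i ≤ t) N

theorem chainIndex_le (G : X → ℝ) (p : ℕ → X) (N : ℕ) (t : ℝ) : chainIndex G p N t ≤ N :=
  Nat.findGreatest_le N

theorem chainCost_chainIndex_le (G : X → ℝ) (p : ℕ → X) (N : ℕ) {t : ℝ} (ht : 0 ≤ t) :
    chainCost G p (chainIndex G p N t) ≤ t := by
  unfold chainIndex
  exact Nat.findGreatest_spec (P := fun i => chainCost G p i ≤ t) (Nat.zero_le N)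
    (by simpa [chainCost] using ht)

theorem lt_chainCost_of_chainIndex_lt {p : ℕ → X} {N i : ℕ} {t : ℝ}
    (h : chainIndex G p N t < i) (hi : i ≤ N) : t < chainCost G p i := by
  unfold chainIndex at h
  exact not_le.1 (Nat.findGreatest_is_greatest h hi)

theorem le_chainIndex {p : ℕ → X} {N i : ℕ} {t : ℝ} (hi : i ≤ N) (h : chainCost G p i ≤ t) :
    i ≤ chainIndex G p N t := by
  by_contra hlt
  exact absurd h (not_le.2 (lt_chainCost_of_chainIndex_lt (not_le.1 hlt) hi))

/-- After one further step the cost already exceeds `a`, so the rest of the way costs at most `b -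
a` and has length at most `(b - a) / κ`. The first step, possibly begun before the cost reached `a`,
accounts for the extra `σ`. -/
theorem dist_chainIndex_le {p : ℕ → X} {N i : ℕ} {a b κ : ℝ} (hσ : 0 ≤ σ) (hab : a ≤ b)
    (hp : ∀ i < N, dist (p i) (p (i + 1)) ≤ σ) (hi : chainIndex G p N a ≤ i) (hiN : i ≤ N)
    (hib : chainCost G p i ≤ b) (hκ0 : 0 < κ)
    (hκ : ∀ j, chainIndex G p N a ≤ j → j < i → κ ≤ G (p j)) :
    dist (p (chainIndex G p N a)) (p i) ≤ (b - a) / κ + σ := by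
  set k := chainIndex G p N a with hk
  have hba : 0 ≤ (b - a) / κ := div_nonneg (by linarith) hκ0.le
  rcases hi.eq_or_lt with h | h
  · rw [← h, dist_self]; positivity
  · have h1 := lt_chainCost_of_chainIndex_lt (lt_add_one k) (h.trans_le hiN |> Nat.succ_le_of_lt)
    have h2 := mul_dist_le_chainCost_sub (G := G) (p := p) (Nat.succ_le_of_lt h) hκ0.le
      fun j hj hj' => hκ j ((Nat.le_succ k).trans hj) hj'
    have h3 : dist (p (k + 1)) (p i) ≤ (b - a) / κ := by
      rw [le_div_iff₀ hκ0, mul_comm]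
      rw [Nat.succ_eq_add_one] at h2
      linarith
    linarith [dist_triangle (p k) (p (k + 1)) (p i), hp k (h.trans_le hiN)]

end Chain

/-! ### Compactness by ultrafilters and length of Lipschitz curves -/

section Limit

variable {X : Type*} [MetricSpace X]

/-- Finitely many small balls cover a neighbourhood of the compact set, and an ultrafilter must
contain one of them. It is thus Cauchy, without being concentrated on any single compact set. -/
theorem exists_le_nhds_of_near_compact [CompleteSpace X] (𝒱 : Ultrafilter X)
    (h : ∀ r > 0, ∃ K : Set X, IsCompact K ∧ K.Nonempty ∧ ∀ᶠ z in (𝒱 : Filter X),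
      Metric.infDist z K < r) : ∃ z, (𝒱 : Filter X) ≤ 𝓝 z := by
  refine CompleteSpace.complete (Metric.cauchy_iff.2 ⟨𝒱.neBot, fun ε hε => ?_⟩)
  obtain ⟨K, hK, hne, hev⟩ := h (ε / 4) (by positivity)
  obtain ⟨s, -, hs, hcov⟩ := hK.finite_cover_balls (e := ε / 4) (by positivity)
  have hmem : (⋃ c ∈ s, Metric.ball c (ε / 2)) ∈ 𝒱 := by
    filter_upwards [hev] with z hz
    obtain ⟨y, hy, hzy⟩ := (Metric.infDist_lt_iff hne).1 hz
    obtain ⟨c, hc, hyc⟩ := mem_iUnion₂.1 (hcov hy)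
    refine mem_iUnion₂.2 ⟨c, hc, ?_⟩
    rw [Metric.mem_ball] at hyc ⊢
    linarith [dist_triangle z y c]
  obtain ⟨c, -, hc⟩ := (Ultrafilter.finite_biUnion_mem_iff hs).1 hmem
  refine ⟨_, hc, fun y hy z hz => ?_⟩
  rw [Metric.mem_ball] at hy hz
  linarith [dist_triangle_right y z c]

theorem lengthDist_le {γ : ℝ → X} {s t κ : ℝ} (hst : s ≤ t) (hκ : 0 ≤ κ)
    (hγ : ∀ a b, s ≤ a → a ≤ b → b ≤ t → dist (γ a) (γ b) ≤ κ * (b - a)) :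
    lengthDist (γ s) (γ t) ≤ ENNReal.ofReal (κ * (t - s)) := by
  set K : ℝ≥0 := (κ * (t - s)).toNNReal with hK
  have hKr : (K : ℝ) = κ * (t - s) := Real.coe_toNNReal _ (mul_nonneg hκ (by linarith))
  set c : ℝ → X := fun τ => γ (s + τ * (t - s)) with hc
  have key : ∀ a ∈ Icc (0 : ℝ) 1, ∀ b ∈ Icc (0 : ℝ) 1, a ≤ b → dist (c a) (c b) ≤ K * dist a b := by
    intro a ha b hb hab
    have hts : 0 ≤ t - s := by linarith
    refine (hγ _ _ ?_ ?_ ?_).trans (le_of_eq ?_)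
    · nlinarith [ha.1]
    · nlinarith
    · nlinarith [hb.2]
    · rw [dist_comm, Real.dist_eq, abs_of_nonneg (by linarith)]
      rw [hKr]
      ring
  have hlip : LipschitzOnWith K c (Icc 0 1) := by
    refine LipschitzOnWith.of_dist_le_mul fun a ha b hb => ?_
    rcases le_total a b with h | h
    · exact key a ha b hb h
    · rw [dist_comm, dist_comm a b]; exact key b hb a ha h
  have hvar : eVariationOn c (Icc 0 1) ≤ ENNReal.ofReal (κ * (t - s)) := by
    have h1 := hlip.comp_eVariationOn_le (g := id) (s := Icc (0 : ℝ) 1) (mapsTo_id _)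
    have h2 : eVariationOn (id : ℝ → ℝ) (Icc 0 1) ≤ 1 := by
      have := (monotone_id.monotoneOn (Icc (0 : ℝ) 1)).eVariationOn_eq (a := 0) (b := 1)
        (by simp) (by simp)
      rw [inter_self] at this
      rw [this]; simp
    refine h1.trans ((mul_le_mul_right h2 _).trans (le_of_eq ?_))
    rw [mul_one, ENNReal.ofReal]
  refine le_trans ?_ hvar
  unfold lengthDist
  refine iInf_le_of_le c (iInf_le_of_le ⟨K, hlip⟩ (iInf_le_of_le ?_ (iInf_le_of_le ?_ le_rfl)))
  · simp [hc]
  · simp [hc]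

end Limit

end MetricSobolev

/-! ### Passage from chains to curves -/

namespace MetricSobolev

section ChainLimit

variable {X : Type*} [MetricSpace X]

/-- Points of a chain that ends in a compact set stay close to it if the weight is large off that
set. -/
theorem infDist_chain_le {G : X → ℝ} {p : ℕ → X} {N : ℕ} {K : Set X} {J ρ R : ℝ} (hJ : 0 < J)
    (hρ : 0 < ρ) (hG : ∀ z, 0 ≤ G z) (hend : p N ∈ K) (hR : chainCost G p N ≤ R)
    (hfar : ∀ z, ρ ≤ Metric.infDist z K → J ≤ G z) {i : ℕ} (hi : i ≤ N) :
    Metric.infDist (p i) K ≤ R / J + ρ := by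
  classical
  -- Until the chain next comes within `ρ` of `K`, every weight is at least `J`, so it travels at
  -- most `R / J`. The endpoint in `K` guarantees such a return.
  have hex : ∃ k, i ≤ k ∧ Metric.infDist (p k) K < ρ :=
    ⟨N, hi, by rwa [Metric.infDist_zero_of_mem hend]⟩
  set k := Nat.find hex with hk
  obtain ⟨hik, hkρ⟩ := Nat.find_spec hex
  have hkN : k ≤ N := Nat.find_le ⟨hi, by rwa [Metric.infDist_zero_of_mem hend]⟩
  have h1 := mul_dist_le_chainCost_sub (G := G) (p := p) hik hJ.le fun j hij hjk =>
    hfar _ (not_lt.1 fun h => Nat.find_min hex hjk ⟨hij, h⟩)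
  have h2 := chainCost_mono hG p hkN
  have h3 := chainCost_nonneg hG p i
  have h4 : dist (p i) (p k) ≤ R / J := by
    rw [le_div_iff₀ hJ, mul_comm]; linarith
  have h5 := Metric.infDist_le_infDist_add_dist (s := K) (x := p i) (y := p k)
  linarith

/-- Chains with steps tending to zero and bounded cost converge to curves: if `f` varies along the
limit curves by at most the cost, then it also does so in the limit of the chains. -/
theorem le_of_chain_cost_le [CompleteSpace X] {δ : X → X → ℝ≥0∞}
    (hδ_upper : ∀ x y, δ x y ≤ lengthDist x y) {f g : X → ℝ} (hf : Continuous f)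
    (hg : Continuous g) (hg0 : ∀ x, 0 ≤ g x)
    (hfg : ∀ z, ∀ ε > 0, ∃ U ∈ 𝓝 z, ∀ y ∈ U, ∀ y' ∈ U,
      |f y - f y'| ≤ (g z + ε) * (δ y y').toReal)
    {ε : ℝ} (hε : 0 < ε) {G : ℕ → X → ℝ} (hG : ∀ n z, g z + ε ≤ G n z) {p : ℕ → ℕ → X} {N : ℕ → ℕ}
    {x : X} (hend : ∀ n, p n (N n) = x)
    (hstep : ∀ n, ∀ i < N n, dist (p n i) (p n (i + 1)) ≤ 1 / ((n : ℝ) + 1)) {R : ℝ}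
    (hR : ∀ n, chainCost (G n) (p n) (N n) ≤ R) {K : ℕ → Set X} (hK : ∀ j, IsCompact (K j))
    {j₀ : ℕ} (hx : ∀ j ≥ j₀, x ∈ K j)
    (hGK : ∀ (n j : ℕ) z, j ≤ n → 1 / ((n : ℝ) + 1) ≤ Metric.infDist z (K j) → (j : ℝ) ≤ G n z) {r : ℝ}
    (hr : ∀ n, f (p n 0) + chainCost (G n) (p n) (N n) ≤ r) : f x ≤ r := by
  set σ : ℕ → ℝ := fun n => 1 / ((n : ℝ) + 1) with hσ_def
  have hσ0 : ∀ n, 0 < σ n := fun n => by positivity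
  -- A single ultrafilter gives limits for all times `t` at once, with no diagonal extraction and no
  -- equicontinuity argument.
  set 𝒰 : Ultrafilter ℕ := hyperfilter ℕ with h𝒰
  have h𝒰top : (𝒰 : Filter ℕ) ≤ atTop := Nat.hyperfilter_le_atTop
  have hσ : Tendsto σ 𝒰 (𝓝 0) := tendsto_one_div_add_atTop_nhds_zero_nat.mono_left h𝒰top
  have hGε : ∀ n z, ε ≤ G n z := fun n z => by linarith [hG n z, hg0 z]
  have hG0 : ∀ n z, 0 ≤ G n z := fun n z => hε.le.trans (hGε n z)
  set k : ℕ → ℝ → ℕ := fun n t => chainIndex (G n) (p n) (N n) t with hk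
  set P : ℕ → ℝ → X := fun n t => p n (k n t) with hP
  have hkN : ∀ n t, k n t ≤ N n := fun n t => chainIndex_le _ _ _ _
  have hkc : ∀ n t, 0 ≤ t → chainCost (G n) (p n) (k n t) ≤ t :=
    fun n t ht => chainCost_chainIndex_le _ _ _ ht
  have hkmono : ∀ n a b, 0 ≤ a → a ≤ b → k n a ≤ k n b := fun n a b ha hab =>
    le_chainIndex (hkN n a) ((hkc n a ha).trans hab)
  -- the limit curve
  have hlim : ∀ t, ∃ z, Tendsto (fun n => P n t) 𝒰 (𝓝 z) := by
    intro t
    refine exists_le_nhds_of_near_compact (𝒰.map fun n => P n t) fun ρ hρ => ?_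
    -- The weight level `J'` makes the excursion bound `R / J'` less than `ρ / 2`; the chain step
    -- supplies the other half. The index is also taken at least `j₀`, so that the endpoint `x` lies
    -- in `K J'`.
    obtain ⟨J, hJ⟩ := exists_nat_gt (2 * R / ρ)
    set J' := max (max J j₀) 1
    have hJ'0 : (0 : ℝ) < J' := by
      have : 1 ≤ J' := le_max_right _ _
      exact_mod_cast this
    have hJJ' : (J : ℝ) ≤ J' := by exact_mod_cast (le_max_left J j₀).trans (le_max_left _ _)
    have hxJ : x ∈ K J' := hx _ ((le_max_right J j₀).trans (le_max_left _ _))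
    refine ⟨K J', hK J', ⟨x, hxJ⟩, ?_⟩
    have hev : ∀ᶠ n in (𝒰 : Filter ℕ), J' ≤ n ∧ σ n < ρ / 2 :=
      ((eventually_ge_atTop J').filter_mono h𝒰top).and (hσ.eventually_lt_const (by positivity))
    change ∀ᶠ n in (𝒰 : Filter ℕ), Metric.infDist (P n t) (K J') < ρ
    filter_upwards [hev] with n hn
    have h1 := infDist_chain_le hJ'0 (hσ0 n) (hG0 n) (by rw [hend n]; exact hxJ) (hR n)
      (fun z hz => hGK n J' z hn.1 hz) (hkN n t)
    have h2 : R / J' < ρ / 2 := by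
      rw [div_lt_iff₀ hρ] at hJ
      rw [div_lt_iff₀ hJ'0]
      nlinarith
    exact h1.trans_lt (by linarith [hn.2])
  choose γ hγ using hlim
  have hPdist : ∀ n a i b κ, a ≤ b → k n a ≤ i → i ≤ N n →
      chainCost (G n) (p n) i ≤ b → 0 < κ → (∀ j, k n a ≤ j → j < i → κ ≤ G n (p n j)) →
      dist (P n a) (p n i) ≤ (b - a) / κ + σ n := fun n a i b κ hab hi hiN hib hκ0 hκ =>
    dist_chainIndex_le (hσ0 n).le hab (hstep n) hi hiN hib hκ0 hκ
  have hγdist : ∀ a b κ, 0 ≤ a → a ≤ b → 0 < κ →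
      (∀ᶠ n in (𝒰 : Filter ℕ), ∀ j, k n a ≤ j → j < k n b → κ ≤ G n (p n j)) →
      dist (γ a) (γ b) ≤ (b - a) / κ := by
    intro a b κ ha hab hκ0 hκ
    have h1 : Tendsto (fun n => (b - a) / κ + σ n) 𝒰 (𝓝 ((b - a) / κ + 0)) :=
      tendsto_const_nhds.add hσ
    rw [add_zero] at h1
    refine le_of_tendsto_of_tendsto ((hγ a).dist (hγ b)) h1 ?_
    filter_upwards [hκ] with n hn
    exact hPdist n a (k n b) b κ hab (hkmono n a b ha hab) (hkN n b) (hkc n b (ha.trans hab)) hκ0 hn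
  have hγε : ∀ a b, 0 ≤ a → a ≤ b → dist (γ a) (γ b) ≤ (b - a) / ε := fun a b ha hab =>
    hγdist a b ε ha hab hε (Eventually.of_forall fun n j _ _ => hGε n _)
  have hγcont : ContinuousOn γ (Ici 0) := by
    refine LipschitzOnWith.continuousOn (K := (1 / ε).toNNReal)
      (LipschitzOnWith.of_dist_le_mul fun a ha b hb => ?_)
    rw [Real.coe_toNNReal _ (by positivity)]
    rcases le_total a b with h | h
    · refine (hγε a b ha h).trans (le_of_eq ?_)
      rw [dist_comm, Real.dist_eq, abs_of_nonneg (by linarith)]; ring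
    · rw [dist_comm]
      refine (hγε b a hb h).trans (le_of_eq ?_)
      rw [Real.dist_eq, abs_of_nonneg (by linarith)]; ring
  -- the limit of the costs
  obtain ⟨T, hTmem, hT⟩ : ∃ T ∈ Icc 0 R, Tendsto (fun n => chainCost (G n) (p n) (N n)) 𝒰 (𝓝 T) := by
    obtain ⟨T, hT1, hT2⟩ := (isCompact_Icc (a := (0 : ℝ)) (b := R)).ultrafilter_le_nhds
      (𝒰.map fun n => chainCost (G n) (p n) (N n)) (by
        refine le_principal_iff.2 (mem_map.2 (Filter.univ_mem' fun n => ?_))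
        exact ⟨chainCost_nonneg (hG0 n) _ _, hR n⟩)
    exact ⟨T, hT1, hT2⟩
  -- If the total cost is at most `T`, the index at time `T` is already the last one. Otherwise the
  -- missing piece costs little, and weights at least `ε` make it short.
  have hγT : γ T = x := by
    refine tendsto_nhds_unique (hγ T) ?_
    rw [tendsto_iff_dist_tendsto_zero]
    have h1 : Tendsto (fun n => |chainCost (G n) (p n) (N n) - T| / ε + σ n) 𝒰
        (𝓝 (|T - T| / ε + 0)) := ((hT.sub_const T).abs.div_const ε).add hσ
    rw [sub_self, abs_zero, zero_div, add_zero] at h1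
    refine squeeze_zero (fun _ => dist_nonneg) (fun n => ?_) h1
    rcases le_total (chainCost (G n) (p n) (N n)) T with h | h
    · have : k n T = N n := le_antisymm (hkN n T) (le_chainIndex le_rfl h)
      have h2 := hσ0 n
      simp only [hP, this, hend, dist_self]
      positivity
    · have := hPdist n T (N n) _ ε h (hkN n T) le_rfl le_rfl hε fun j _ _ => hGε n _
      rw [hend] at this
      rwa [abs_of_nonneg (by linarith)]
  -- A part of the chain with zero cost cannot move, since all weights are at least `ε > 0`; hence
  -- `P n 0 = p n 0`.
  have hγ0 : f (γ 0) + T ≤ r := by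
    have h1 : Tendsto (fun n => f (P n 0) + chainCost (G n) (p n) (N n)) 𝒰 (𝓝 (f (γ 0) + T)) :=
      ((hf.tendsto _).comp (hγ 0)).add hT
    refine le_of_tendsto h1 (Eventually.of_forall fun n => ?_)
    have h2 := mul_dist_le_chainCost_sub (G := G n) (p := p n) (Nat.zero_le (k n 0)) hε.le
      fun j _ _ => hGε n _
    have h3 := hkc n 0 le_rfl
    have h4 : chainCost (G n) (p n) 0 = 0 := by simp [chainCost]
    have h5 : dist (p n 0) (P n 0) ≤ 0 := by
      by_contra h
      push Not at h
      have : 0 < ε * dist (p n 0) (p n (k n 0)) := mul_pos hε h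
      linarith
    rw [← dist_le_zero.1 h5]
    exact hr n
  -- speed of the limit curve
  have hspeed : ∀ s, 0 ≤ s → ∃ ρ > 0, ∀ t, s ≤ t → t < s + ρ →
      lengthDist (γ s) (γ t) ≤ ENNReal.ofReal (1 / (g (γ s) + ε / 2) * (t - s)) := by
    intro s hs
    obtain ⟨ρ, hρ, hgρ⟩ := Metric.continuousAt_iff.1 (hg.continuousAt (x := γ s)) (ε / 2)
      (by positivity)
    have hκ0 : 0 < g (γ s) + ε / 2 := by linarith [hg0 (γ s)]
    -- During a time less than `ε ρ / 4` the chain moves less than `ρ / 4 + σ n`. It thus stays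
    -- within `ρ` of `γ s`, where the weight is at least `g + ε ≥ g (γ s) + ε / 2`.
    refine ⟨ε * ρ / 4, by positivity, fun t hst ht => lengthDist_le hst (by positivity)
      fun a b hsa hab hbt => ?_⟩
    have ha0 : 0 ≤ a := hs.trans hsa
    refine (hγdist a b _ ha0 hab hκ0 ?_).trans (le_of_eq (by ring))
    have hd : ∀ᶠ n in (𝒰 : Filter ℕ), dist (P n s) (γ s) < ρ / 4 ∧ σ n < ρ / 4 :=
      ((hγ s).eventually (Metric.ball_mem_nhds _ (by positivity))).and
        (hσ.eventually_lt_const (by positivity))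
    filter_upwards [hd] with n hn j hj hj'
    have h1 := hPdist n s j t ε hst ((hkmono n s a hs hsa).trans hj) (hj'.le.trans (hkN n b))
      ((chainCost_mono (hG0 n) _ hj'.le).trans ((hkc n b (ha0.trans hab)).trans hbt)) hε
      fun j _ _ => hGε n _
    have h2 : (t - s) / ε < ρ / 4 := by
      rw [div_lt_iff₀ hε]; linarith
    have h3 : dist (p n j) (γ s) < ρ := by
      linarith [dist_triangle_left (p n j) (γ s) (P n s), hn.1, hn.2]
    have h4 := hgρ h3
    rw [Real.dist_eq, abs_lt] at h4
    linarith [hG n (p n j), h4.1]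
  -- Here `δ ≤ \hat d` enters: it turns the bound on the `d`-speed into one on `δ`-increments. The
  -- local constant `g (γ s) + ε / 2` of `f` exactly cancels the speed.
  have hslope : ∀ s, 0 ≤ s → ∀ᶠ t in 𝓝[>] s, f (γ t) - f (γ s) ≤ t - s := by
    intro s hs
    obtain ⟨ρ, hρ, hsp⟩ := hspeed s hs
    obtain ⟨U, hU, hfU⟩ := hfg (γ s) (ε / 2) (by positivity)
    have hκ0 : 0 < g (γ s) + ε / 2 := by linarith [hg0 (γ s)]
    have h1 : ∀ᶠ t in 𝓝[>] s, γ t ∈ U := by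
      have h2 : Tendsto γ (𝓝[>] s) (𝓝 (γ s)) :=
        (hγcont s hs).mono_left (nhdsWithin_mono _ fun t ht => hs.trans (le_of_lt ht))
      exact h2.eventually hU
    have h2 : ∀ᶠ t in 𝓝[>] s, t < s + ρ :=
      (eventually_lt_nhds (by linarith)).filter_mono nhdsWithin_le_nhds
    filter_upwards [h1, h2, self_mem_nhdsWithin] with t ht1 ht2 ht3
    have ht3' : s < t := ht3
    have h4 := hfU (γ s) (mem_of_mem_nhds hU) (γ t) ht1
    have h5 : (δ (γ s) (γ t)).toReal ≤ 1 / (g (γ s) + ε / 2) * (t - s) :=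
      ENNReal.toReal_le_of_le_ofReal (mul_nonneg (by positivity) (by linarith))
        ((hδ_upper _ _).trans (hsp t ht3'.le ht2))
    calc f (γ t) - f (γ s) ≤ |f (γ s) - f (γ t)| := by
          rw [abs_sub_comm]; exact le_abs_self _
      _ ≤ (g (γ s) + ε / 2) * (1 / (g (γ s) + ε / 2) * (t - s)) := h4.trans (by gcongr)
      _ = t - s := by rw [← mul_assoc, mul_one_div_cancel hκ0.ne', one_mul]
  have hfin : f (γ T) ≤ f (γ 0) + T := by
    refine image_le_of_liminf_slope_right_le_deriv_boundary (f := fun t => f (γ t)) (a := 0) (b := T)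
      (B := fun t => f (γ 0) + t) (B' := fun _ => 1) ?_ (by simp) (by fun_prop)
      (fun t _ => ((hasDerivAt_id t).const_add _).hasDerivWithinAt) ?_ ⟨hTmem.1, le_rfl⟩
    · exact hf.comp_continuousOn (hγcont.mono fun t ht => ht.1)
    · intro s hs ρ hρ
      refine Eventually.frequently ?_
      filter_upwards [hslope s hs.1, self_mem_nhdsWithin] with t ht ht'
      have ht'' : 0 < t - s := sub_pos.2 ht'
      rw [slope_def_field]
      exact ((div_le_one ht'').2 ht).trans_lt hρ
  rw [hγT] at hfin
  linarith

end ChainLimit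

end MetricSobolev

/-! ### Penalized chain approximation of `δ`-Lipschitz functions -/

namespace MetricSobolev

section

variable {X : Type*} [MetricSpace X] [CompleteSpace X] [SecondCountableTopology X]
  [MeasurableSpace X] [BorelSpace X] {m : Measure X} [IsFiniteMeasure m]

/-- Inner regularity gives each set; the cap `1 / (j + 1)` ensures that the union has full measure
whatever `a` is, and the inserted point `x₀` keeps the sets non-empty. -/
theorem exists_compact_exhaustion [Nonempty X] {q : ℝ} (hq : 0 < q) {a : ℕ → ℝ}
    (ha : ∀ j, 0 < a j) :
    ∃ K : ℕ → Set X, Monotone K ∧ (∀ j, IsCompact (K j)) ∧ (∀ j, (K j).Nonempty) ∧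
      (∀ j, m.real (K j)ᶜ ^ (1 / q) ≤ a j) ∧ ∀ᵐ x ∂m, ∃ j, x ∈ K j := by
  obtain ⟨x₀⟩ := ‹Nonempty X›
  set b : ℕ → ℝ := fun j => min (a j ^ q) (1 / ((j : ℝ) + 1)) with hb
  have hb0 : ∀ j, 0 < b j := fun j =>
    lt_min (Real.rpow_pos_of_pos (ha j) _) (by positivity)
  choose K₀ _ hK₀ hmK₀ using fun j => (MeasurableSet.univ (α := X)).exists_isCompact_sdiff_lt
    (measure_ne_top m univ) (ENNReal.ofReal_pos.2 (hb0 j)).ne'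
  set K : ℕ → Set X := accumulate fun j => insert x₀ (K₀ j) with hK
  have hsub : ∀ j, (K j)ᶜ ⊆ univ \ K₀ j := fun j x hx =>
    ⟨mem_univ x, fun h => hx (subset_accumulate (mem_insert_of_mem _ h))⟩
  have hreal : ∀ j, m.real (K j)ᶜ ≤ b j := fun j =>
    ENNReal.toReal_le_of_le_ofReal (hb0 j).le ((measure_mono (hsub j)).trans (hmK₀ j).le)
  refine ⟨K, monotone_accumulate, isCompact_accumulate fun j => (hK₀ j).insert x₀,
    fun j => ⟨x₀, subset_accumulate (mem_insert _ _)⟩, fun j => ?_, ?_⟩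
  · calc m.real (K j)ᶜ ^ (1 / q) ≤ (a j ^ q) ^ (1 / q) := by
          gcongr
          exact (hreal j).trans (min_le_left _ _)
      _ = a j := by rw [← Real.rpow_mul (ha j).le, mul_one_div_cancel hq.ne', Real.rpow_one]
  · rw [ae_iff]
    have hle : ∀ j : ℕ, m.real {x | ¬∃ j, x ∈ K j} ≤ 1 / ((j : ℝ) + 1) := fun j =>
      (measureReal_mono (s₂ := (K j)ᶜ) fun x (hx : ¬∃ j, x ∈ K j) hxj => hx ⟨j, hxj⟩).trans ((hreal j).trans (min_le_right _ _))
    have h0 := ge_of_tendsto' tendsto_one_div_add_atTop_nhds_zero_nat hle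
    exact (measureReal_eq_zero_iff).1 (le_antisymm h0 measureReal_nonneg)

/-- The weights `∑ i < n, min 1 ((n+1) dist(x, K i))`, which are large away from the sets `K i`. -/
noncomputable def farWeight (K : ℕ → Set X) (n : ℕ) (x : X) : ℝ :=
  ∑ i ∈ Finset.range n, min 1 (((n : ℝ) + 1) * Metric.infDist x (K i))

omit [CompleteSpace X] [SecondCountableTopology X] [MeasurableSpace X] [BorelSpace X] in
theorem continuous_farWeight (K : ℕ → Set X) (n : ℕ) : Continuous (farWeight K n) :=
  continuous_finsetSum _ fun i _ =>
    continuous_const.min (continuous_const.mul (Metric.continuous_infDist_pt (K i)))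

omit [CompleteSpace X] [SecondCountableTopology X] [MeasurableSpace X] [BorelSpace X] in
theorem farWeight_nonneg (K : ℕ → Set X) (n : ℕ) (x : X) : 0 ≤ farWeight K n x :=
  Finset.sum_nonneg fun _ _ => le_min zero_le_one
    (mul_nonneg (by positivity) Metric.infDist_nonneg)

-- The penalty vanishes on compact sets that contain `x`, so its `L^q` norm is controlled, uniformly
-- in `n`, by the masses of the complements.
omit [CompleteSpace X] [SecondCountableTopology X] [MeasurableSpace X] [BorelSpace X] in
theorem farWeight_le (K : ℕ → Set X) (n : ℕ) (x : X) :
    farWeight K n x ≤ ∑ i ∈ Finset.range n, (K i)ᶜ.indicator (fun _ => (1 : ℝ)) x := by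
  refine Finset.sum_le_sum fun i _ => ?_
  by_cases hx : x ∈ K i
  · rw [indicator_of_notMem (notMem_compl_iff.2 hx), Metric.infDist_zero_of_mem hx, mul_zero]
    exact min_le_right _ _
  · rw [indicator_of_mem hx]
    exact min_le_left _ _

omit [CompleteSpace X] [SecondCountableTopology X] [MeasurableSpace X] [BorelSpace X] in
theorem farWeight_le_card (K : ℕ → Set X) (n : ℕ) (x : X) : farWeight K n x ≤ n := by
  refine (Finset.sum_le_card_nsmul _ _ 1 fun i _ => min_le_left _ _).trans (by simp)

-- A point far from `K j` is at least as far from the smaller sets `K i` with `i < j`, so `j` of the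
-- summands are saturated at `1`.
omit [CompleteSpace X] [SecondCountableTopology X] [MeasurableSpace X] [BorelSpace X] in
theorem le_farWeight {K : ℕ → Set X} (hK : Monotone K) (hne : ∀ j, (K j).Nonempty) {n j : ℕ}
    {x : X} (hj : j ≤ n) (hx : 1 / ((n : ℝ) + 1) ≤ Metric.infDist x (K j)) :
    (j : ℝ) ≤ farWeight K n x := by
  have hterm : ∀ i ∈ Finset.range j,
      (1 : ℝ) ≤ min 1 (((n : ℝ) + 1) * Metric.infDist x (K i)) := by
    intro i hi
    have hij : i ≤ j := (Finset.mem_range.1 hi).le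
    have h1 := hx.trans (Metric.infDist_le_infDist_of_subset (x := x) (hK hij) (hne i))
    refine le_min le_rfl ?_
    rw [div_le_iff₀ (by positivity)] at h1
    linarith
  calc (j : ℝ) = ∑ i ∈ Finset.range j, (1 : ℝ) := by simp
    _ ≤ ∑ i ∈ Finset.range j, min 1 (((n : ℝ) + 1) * Metric.infDist x (K i)) :=
        Finset.sum_le_sum hterm
    _ ≤ farWeight K n x :=
        Finset.sum_le_sum_of_subset_of_nonneg (Finset.range_mono hj) fun _ _ _ =>
          le_min zero_le_one (mul_nonneg (by positivity) Metric.infDist_nonneg)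

-- Failure yields, along a subsequence `ψ`, chains whose value is below `f x - η / 2`. Their costs
-- are at most `2M`, and `ψ n ≥ n` keeps the step and penalty estimates valid with `n`, so the limit
-- curve gives `f x ≤ f x - η / 2`.
omit [SecondCountableTopology X] [MeasurableSpace X] [BorelSpace X] in
theorem tendsto_chainInf {δ : X → X → ℝ≥0∞} (hδ_upper : ∀ x y, δ x y ≤ lengthDist x y)
    {f g : X → ℝ} {M : ℝ} (hf : Continuous f) (hM : ∀ x, |f x| ≤ M)
    (hg : Continuous g) (hg0 : ∀ x, 0 ≤ g x)
    (hfg : ∀ z, ∀ ε > 0, ∃ U ∈ 𝓝 z, ∀ y ∈ U, ∀ y' ∈ U,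
      |f y - f y'| ≤ (g z + ε) * (δ y y').toReal) {ε : ℝ} (hε : 0 < ε) {K : ℕ → Set X}
    (hK : Monotone K) (hKc : ∀ j, IsCompact (K j)) (hne : ∀ j, (K j).Nonempty) {x : X} {j₀ : ℕ}
    (hx : x ∈ K j₀) :
    Tendsto (fun n : ℕ => chainInf f (fun z => g z + ε + farWeight K n z) (1 / ((n : ℝ) + 1)) x)
      atTop (𝓝 (f x)) := by
  set G : ℕ → X → ℝ := fun n z => g z + ε + farWeight K n z with hG
  have hGε : ∀ n z, g z + ε ≤ G n z := fun n z => by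
    simp only [hG]; linarith [farWeight_nonneg K n z]
  have hG0 : ∀ n z, 0 ≤ G n z := fun n z => by linarith [hGε n z, hg0 z]
  have hle := fun n : ℕ => chainInf_le_self (σ := 1 / ((n : ℝ) + 1)) hM (hG0 n) x
  rw [Metric.tendsto_atTop']
  intro η hη
  suffices h : ∀ᶠ n : ℕ in atTop, f x - η / 2 ≤ chainInf f (G n) (1 / ((n : ℝ) + 1)) x by
    obtain ⟨n₀, hn₀⟩ := eventually_atTop.1 h
    refine ⟨n₀, fun n hn => ?_⟩
    rw [Real.dist_eq, abs_of_nonpos (by linarith [hle n])]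
    linarith [hn₀ n hn.le]
  by_contra hcon
  rw [not_eventually] at hcon
  obtain ⟨ψ, hψ, hbad⟩ := extraction_of_frequently_atTop hcon
  choose p N hend hstep hcost using fun n => exists_chain_lt (not_le.1 (hbad n))
  have hψn : ∀ n, n ≤ ψ n := hψ.id_le
  have hinv : ∀ n : ℕ, (1 : ℝ) / ((ψ n : ℝ) + 1) ≤ 1 / ((n : ℝ) + 1) := fun n => by
    have : (n : ℝ) ≤ ψ n := by exact_mod_cast hψn n
    gcongr
  have := le_of_chain_cost_le hδ_upper hf hg hg0 hfg hε (G := fun n => G (ψ n))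
    (fun n z => hGε _ z) hend (fun n i hi => (hstep n i hi).trans (hinv n)) (R := 2 * M)
    (fun n => by
      linarith [hcost n, (abs_le.1 (hM (p n 0))).1, (abs_le.1 (hM x)).2]) hKc
    (j₀ := j₀) (fun j hj => hK hj hx) (fun n j z hj hz => by
      have := le_farWeight hK hne (hj.trans (hψn n)) ((hinv n).trans hz)
      simp only [hG]
      linarith [hg0 z]) (fun n => (hcost n).le)
  linarith

variable {δ : X → X → ℝ≥0∞} {q : ℝ≥0∞} [Fact (1 ≤ q)]

/-- The chain infima are `d`-Lipschitz with local constants at most `g + ε` plus the penalty. The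
penalties are dominated by partial sums of a series in `L^q` of total norm at most `ε`, whose sum is
`h`; closedness gives the bound for the limit `f`. -/
theorem ApproxGrad.exists_near_of_chainInf [Nonempty X] (hδ : IsDistance δ)
    (hδ_upper : ∀ x y, δ x y ≤ lengthDist x y) (hq_one : 1 < q) (hq_top : q ≠ ∞)
    {A : Subalgebra ℝ (X → ℝ)} (hA : (A : Set (X → ℝ)) ⊆ lipB δ)
    (hLip : ∀ (F : X → ℝ) (K : ℝ≥0), LipschitzWith K F → ApproxGrad δ m q A F fun _ => (K : ℝ))
    {f g : X → ℝ} {M C : ℝ} (hf : Continuous f) (hM : ∀ x, |f x| ≤ M)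
    (hg : Continuous g) (hg0 : ∀ x, 0 ≤ g x) (hgC : ∀ x, g x ≤ C)
    (hfg : ∀ z, ∀ ε > 0, ∃ U ∈ 𝓝 z, ∀ y ∈ U, ∀ y' ∈ U,
      |f y - f y'| ≤ (g z + ε) * (δ y y').toReal) {ε : ℝ} (hε : 0 < ε) :
    ∃ h : Lp ℝ q m, ‖h‖ ≤ ε ∧ ApproxGrad δ m q A f fun x => g x + ε + h x := by
  have hq0 : q ≠ 0 := (zero_lt_one.trans hq_one).ne'
  have hpos : 0 < q.toReal := ENNReal.toReal_pos hq0 hq_top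
  have hM0 : 0 ≤ M := (abs_nonneg _).trans (hM (Classical.arbitrary X))
  have hC0 : 0 ≤ C := (hg0 _).trans (hgC (Classical.arbitrary X))
  obtain ⟨K, hKmono, hKc, hKne, hKm, hKae⟩ := exists_compact_exhaustion (m := m) hpos
    (a := fun j => ε / 2 / 2 ^ j) (fun j => by positivity)
  have hKmeas : ∀ j, MeasurableSet (K j)ᶜ := fun j => (hKc j).isClosed.measurableSet.compl
  set e : ℕ → Lp ℝ q m := fun j => indicatorConstLp q (hKmeas j) (measure_ne_top m _) (1 : ℝ)
    with he
  have hnorm : ∀ j, ‖e j‖ ≤ ε / 2 / 2 ^ j := fun j => by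
    refine norm_indicatorConstLp_le.trans ?_
    rw [norm_one, one_mul]
    exact hKm j
  have hgeom := hasSum_geometric_two' ε
  have hsum : Summable e := Summable.of_norm_bounded hgeom.summable hnorm
  refine ⟨∑' j, e j, tsum_of_norm_bounded hgeom hnorm, ?_⟩
  set H : ℕ → Lp ℝ q m := fun n => ∑ j ∈ Finset.range n, e j with hH
  have hHlim : Tendsto H atTop (𝓝 (∑' j, e j)) := hsum.hasSum.tendsto_sum_nat
  set F : ℕ → X → ℝ := fun n =>
    chainInf f (fun z => g z + ε + farWeight K n z) (1 / ((n : ℝ) + 1)) with hF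
  have hgmem : MemLp (fun x => g x + ε) q m :=
    MemLp.of_bound (hg.add continuous_const).measurable.aestronglyMeasurable (C + ε)
      (ae_of_all _ fun x => by
        rw [Real.norm_of_nonneg (by linarith [hg0 x])]; linarith [hgC x])
  have hSF : ∀ n, ApproxGrad δ m q A (F n) fun x => g x + ε + H n x := by
    intro n
    have hGc : Continuous fun z => g z + ε + farWeight K n z :=
      (hg.add continuous_const).add (continuous_farWeight K n)
    have hG0 : ∀ z, 0 ≤ g z + ε + farWeight K n z := fun z => by
      linarith [hg0 z, farWeight_nonneg K n z]
    have hGB : ∀ z, g z + ε + farWeight K n z ≤ C + ε + n := fun z => by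
      linarith [hgC z, farWeight_le_card K n z]
    have hB : ((C + ε + n).toNNReal : ℝ) = C + ε + n := Real.coe_toNNReal _ (by positivity)
    have hσ : (0 : ℝ) < 1 / ((n : ℝ) + 1) := by positivity
    have h1 : ApproxGrad δ m q A (F n) fun z => g z + ε + farWeight K n z := by
      refine ApproxGrad.of_locally_lipschitz hδ hq_one hq_top hA hLip
        (chainInf_lipschitzWith hM hG0 (B := (C + ε + n).toNNReal)
          (fun z => (hGB z).trans hB.ge) hσ hM0) hGc
        (MemLp.of_bound hGc.measurable.aestronglyMeasurable (C + ε + n)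
          (ae_of_all _ fun x => ?_)) hG0
        (fun x ε' hε' => chainInf_locally_lipschitz hM hG0 hGc hσ x hε')
      rw [Real.norm_of_nonneg (hG0 x)]
      exact hGB x
    refine h1.mono (hgmem.add (Lp.memLp (H n))) ?_
    have hind : ∀ᵐ x ∂m, ∀ j, e j x = (K j)ᶜ.indicator (fun _ => (1 : ℝ)) x :=
      ae_all_iff.2 fun j => indicatorConstLp_coeFn
    filter_upwards [Lp.coeFn_finsetSum (Finset.range n) e, hind] with x h2 h3
    have h4 : H n x = ∑ j ∈ Finset.range n, (K j)ᶜ.indicator (fun _ => (1 : ℝ)) x := by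
      rw [hH]
      dsimp only
      rw [h2, Finset.sum_apply]
      exact Finset.sum_congr rfl fun j _ => h3 j
    rw [h4]
    linarith [farWeight_le K n x]
  refine ApproxGrad.closed hSF ?_ (hgmem.add (Lp.memLp _)) ?_
  · refine tendstoInMeasure_of_tendsto_ae (fun n => (hSF n).aestronglyMeasurable hA) ?_
    filter_upwards [hKae] with x ⟨j, hj⟩
    exact tendsto_chainInf hδ_upper hf hM hg hg0 hfg hε hKmono hKc hKne hj
  · have h1 := (Lp.tendsto_Lp_iff_tendsto_eLpNorm' H _).1 hHlim
    refine h1.congr fun n => ?_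
    refine congrArg (fun φ => eLpNorm φ q m) (funext fun x => ?_)
    simp only [Pi.sub_apply]
    ring

/-- The asymptotic Lipschitz constant of a bounded `δ`-Lipschitz function is a gradient bound with
respect to the algebra. -/
theorem ApproxGrad.of_mem_lipB (hδ : IsDistance δ)
    (hδ_upper : ∀ x y, δ x y ≤ lengthDist x y) (hq_one : 1 < q) (hq_top : q ≠ ∞)
    {A : Subalgebra ℝ (X → ℝ)} (hA : (A : Set (X → ℝ)) ⊆ lipB δ)
    (hLip : ∀ (F : X → ℝ) (K : ℝ≥0), LipschitzWith K F → ApproxGrad δ m q A F fun _ => (K : ℝ))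
    {f : X → ℝ} (hf : f ∈ lipB δ) : ApproxGrad δ m q A f (lipSlope δ f) := by
  rcases isEmpty_or_nonempty X with hX | hX
  · exact ApproxGrad.of_mem (by rw [Subsingleton.elim f 0]; exact A.zero_mem) hA
  obtain ⟨M, hM⟩ := hf.2.1
  set C := (lipConst δ univ f).toReal with hC
  -- Chains need a continuous weight, while the slope is only upper semicontinuous; the majorants `g
  -- n` bridge this by dominated convergence.
  obtain ⟨g, hgc, hgl, hgC, hglim⟩ := exists_continuous_approx_above (l := lipSlope δ f) (C := C)
    (lipSlope_nonneg f) (lipSlope_le_const hf) fun x a hxa => eventually_lipSlope_lt hf hxa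
  have hg0 : ∀ n x, 0 ≤ g n x := fun n x => (lipSlope_nonneg f x).trans (hgl n x)
  have hgmem : ∀ n, MemLp (g n) q m := fun n =>
    MemLp.of_bound (hgc n).measurable.aestronglyMeasurable C (ae_of_all _ fun x => by
      rw [Real.norm_of_nonneg (hg0 n x)]; exact hgC n x)
  have hSg : ∀ n, ApproxGrad δ m q A f (g n) := by
    intro n
    have hfg : ∀ z, ∀ ε > 0, ∃ U ∈ 𝓝 z, ∀ y ∈ U, ∀ y' ∈ U,
        |f y - f y'| ≤ (g n z + ε) * (δ y y').toReal := by
      intro z ε hε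
      obtain ⟨U, hU, hUl⟩ := lipSlope_spec hδ hf z hε
      refine ⟨U, hU, fun y hy y' hy' => (hUl y hy y' hy').trans ?_⟩
      have := hgl n z
      gcongr
    choose h hh hS using fun k : ℕ => ApproxGrad.exists_near_of_chainInf (m := m) hδ hδ_upper
      hq_one hq_top hA hLip hf.1 hM (hgc n) (hg0 n) (hgC n) hfg
      (by positivity : 0 < 1 / ((k : ℝ) + 1))
    refine ApproxGrad.closed hS (tendstoInMeasure_iff_dist.2 fun ε hε => by simp [not_le.2 hε])
      (hgmem n) ?_
    have hz : Tendsto (fun k : ℕ => ENNReal.ofReal (1 / ((k : ℝ) + 1)) * eLpNorm (fun _ : X => (1 : ℝ)) q m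
        + ENNReal.ofReal (1 / ((k : ℝ) + 1))) atTop
        (𝓝 (0 * eLpNorm (fun _ : X => (1 : ℝ)) q m + 0)) := by
      have h1 : Tendsto (fun k : ℕ => ENNReal.ofReal (1 / ((k : ℝ) + 1))) atTop (𝓝 0) := by
        simpa using ENNReal.tendsto_ofReal tendsto_one_div_add_atTop_nhds_zero_nat
      exact (ENNReal.Tendsto.mul_const h1 (Or.inr (memLp_const (1 : ℝ)).2.ne)).add h1
    rw [zero_mul, add_zero] at hz
    refine tendsto_of_tendsto_of_tendsto_of_le_of_le tendsto_const_nhds hz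
      (fun _ => zero_le) fun k => ?_
    have e1 : (fun x => g n x + 1 / ((k : ℝ) + 1) + h k x - g n x)
        = (1 / ((k : ℝ) + 1)) • (fun _ : X => (1 : ℝ)) + h k := by
      funext x
      simp only [Pi.add_apply, Pi.smul_apply, smul_eq_mul]
      ring
    dsimp only
    rw [e1]
    refine (eLpNorm_add_le (aestronglyMeasurable_const.const_smul _) (Lp.aestronglyMeasurable _)
      Fact.out).trans (add_le_add (le_of_eq ?_) ?_)
    · rw [eLpNorm_const_smul, Real.enorm_eq_ofReal (by positivity)]
    · have h2 := hh k
      rw [Lp.norm_def] at h2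
      exact (ENNReal.le_ofReal_iff_toReal_le (Lp.eLpNorm_ne_top _) (by positivity)).2 h2
  refine ApproxGrad.closed hSg (tendstoInMeasure_iff_dist.2 fun ε hε => by simp [not_le.2 hε])
    (memLp_lipSlope hf) ?_
  refine tendsto_eLpNorm_sub_of_dominated hq_top (memLp_const C) (fun n => (hgmem n).1)
    (measurable_lipSlope f).aestronglyMeasurable (fun n => ae_of_all _ fun x => ?_) (ae_of_all _ hglim)
  rw [abs_of_nonneg (by linarith [hgl n x])]
  linarith [hgC n x, lipSlope_nonneg (δ := δ) f x]

end

end MetricSobolev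

/-! ### From gradient bounds to density in energy -/

namespace MetricSobolev

theorem isDistance_edist {X : Type*} [MetricSpace X] : IsDistance fun x y : X => edist x y :=
  ⟨fun _ _ => edist_eq_zero, edist_comm, edist_triangle, edist_ne_top⟩

/-- Where `d ≤ 1`, `δ` dominates `d` and the constant `K` serves; elsewhere `δ ≥ 1` and the
oscillation `2C` serves. -/
theorem lipB_edist_subset {X : Type*} [MetricSpace X] {δ : X → X → ℝ≥0∞} (hδ : IsDistance δ)
    (hδ_lower : ∀ x y, min (edist x y) 1 ≤ δ x y) : lipB (fun x y : X => edist x y) ⊆ lipB δ := by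
  rintro u ⟨hu, ⟨C, hC⟩, hK⟩
  set K := (lipConst (fun x y : X => edist x y) univ u).toReal
  have hK0 : 0 ≤ K := ENNReal.toReal_nonneg
  refine mem_lipB_of_bound hδ hu hC (a := K + 2 * C) fun y z => ?_
  have hC0 : 0 ≤ C := (abs_nonneg _).trans (hC y)
  have h1 : |u y - u z| ≤ K * dist y z := by
    have := abs_sub_le_of_lipConst_le isDistance_edist hK0 (ENNReal.ofReal_toReal hK.ne).ge
      (mem_univ y) (mem_univ z)
    rwa [edist_dist, ENNReal.toReal_ofReal dist_nonneg] at this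
  have h2 : |u y - u z| ≤ 2 * C := by
    linarith [abs_sub (u y) (u z), hC y, hC z]
  have h3 : min (dist y z) 1 ≤ (δ y z).toReal := by
    have := ENNReal.toReal_mono (hδ.ne_top y z) (hδ_lower y z)
    rwa [ENNReal.toReal_min (edist_ne_top _ _) ENNReal.one_ne_top, edist_dist,
      ENNReal.toReal_ofReal dist_nonneg, ENNReal.toReal_one] at this
  refine le_trans ?_ (mul_le_mul_of_nonneg_left h3 (by positivity))
  rcases le_total (dist y z) 1 with h | h
  · rw [min_eq_left h]
    nlinarith [dist_nonneg (x := y) (y := z)]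
  · rw [min_eq_right h]
    linarith

section

variable {X : Type*} [MeasurableSpace X] {m : Measure X} {q : ℝ≥0∞} [Fact (1 ≤ q)]

/-- Non-negative functions below a convergent sequence converge to the same limit if their norms
do. -/
theorem tendsto_of_le_of_tendsto_norm (hq_top : q ≠ ∞) {a g : ℕ → Lp ℝ q m} {c : Lp ℝ q m}
    (ha : ∀ n, 0 ≤ᵐ[m] a n) (hag : ∀ n, a n ≤ᵐ[m] g n) (hg : Tendsto g atTop (𝓝 c))
    (hnorm : Tendsto (fun n => ‖a n‖) atTop (𝓝 ‖c‖)) : Tendsto a atTop (𝓝 c) := by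
  have hq0 : q ≠ 0 := (zero_lt_one.trans_le Fact.out).ne'
  have hp : 1 ≤ q.toReal := by
    rw [← ENNReal.toReal_one]; exact ENNReal.toReal_mono hq_top Fact.out
  have hp0 : 0 < q.toReal := by linarith
  have hint : ∀ f : Lp ℝ q m, Integrable (fun x => |f x| ^ q.toReal) m := fun f =>
    (Lp.memLp f).integrable_norm_rpow hq0 hq_top
  -- Superadditivity of `t ↦ t ^ q` on `[0,∞)` gives `(g - a) ^ q ≤ g ^ q - a ^ q` when `0 ≤ a ≤ g`.
  have hle : ∀ n, ‖g n - a n‖ ^ q.toReal ≤ ‖g n‖ ^ q.toReal - ‖a n‖ ^ q.toReal := by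
    intro n
    simp only [Lp_norm_rpow_eq_integral hq_top]
    rw [← integral_sub (hint _) (hint _)]
    refine integral_mono_ae (hint _) ((hint _).sub (hint _)) ?_
    filter_upwards [ha n, hag n, Lp.coeFn_sub (g n) (a n)] with x h1 h2 h3
    have h1' : 0 ≤ a n x := h1
    have h4 := Real.add_rpow_le_rpow_add (sub_nonneg.2 h2) h1' hp
    rw [sub_add_cancel] at h4
    simp only [h3, Pi.sub_apply]
    rw [abs_of_nonneg (sub_nonneg.2 h2), abs_of_nonneg h1', abs_of_nonneg (h1'.trans h2)]
    linarith
  have h0 : Tendsto (fun n => ‖g n - a n‖ ^ q.toReal) atTop (𝓝 0) := by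
    have h1 := (hg.norm.rpow_const (p := q.toReal) (Or.inr hp0.le)).sub
      (hnorm.rpow_const (p := q.toReal) (Or.inr hp0.le))
    rw [sub_self] at h1
    exact squeeze_zero (fun n => by positivity) hle h1
  have h2 : Tendsto (fun n => ‖g n - a n‖) atTop (𝓝 0) := by
    have h3 := h0.rpow_const (p := q.toReal⁻¹) (Or.inr (by positivity))
    rw [Real.zero_rpow (by positivity)] at h3
    refine h3.congr fun n => ?_
    rw [← Real.rpow_mul (norm_nonneg _), mul_inv_cancel₀ hp0.ne', Real.rpow_one]
  have h3 := hg.sub (tendsto_zero_iff_norm_tendsto_zero.2 h2)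
  simpa using h3

end

section

variable {X : Type*} [TopologicalSpace X] [MeasurableSpace X] [BorelSpace X]
  {δ : X → X → ℝ≥0∞} {m : Measure X} [IsFiniteMeasure m] {q : ℝ≥0∞} [Fact (1 ≤ q)]

theorem tendstoL0_of_tendsto_ae {u : ℕ → X → ℝ} {f : X →ₘ[m] ℝ} (hu : ∀ n, Continuous (u n))
    (h : ∀ᵐ x ∂m, Tendsto (fun n => u n x) atTop (𝓝 (f x))) : TendstoL0 m u f :=
  fun _ _ _ => tendstoInMeasure_of_tendsto_ae
    (fun n => (hu n).measurable.aestronglyMeasurable) (ae_restrict_of_ae h)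

/-- A finite liminf leaves a subsequence with slopes bounded in `L^q`, from which a strong bound is
extracted. -/
theorem exists_approxGrad_of_mem_D1 (hδ : IsDistance δ) (hq_one : 1 < q) (hq_top : q ≠ ∞)
    {f : X →ₘ[m] ℝ} (hf : f ∈ D1 δ m q (lipB δ)) :
    ∃ G : Lp ℝ q m, ApproxGrad δ m q (lipB δ) f G := by
  have hq0 : q ≠ 0 := (zero_lt_one.trans hq_one).ne'
  have hpos : 0 < q.toReal := ENNReal.toReal_pos hq0 hq_top
  simp only [D1, mem_ofPred_eq, cheeger, iInf_lt_iff] at hf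
  obtain ⟨u, hu, hlim, hfin⟩ := hf
  obtain ⟨C, hC1, hC2⟩ := exists_between hfin
  obtain ⟨ψ, hψ, hψC⟩ := extraction_of_frequently_atTop
    (frequently_lt_of_liminf_lt (by isBoundedDefault) hC1)
  have hf' : TendstoInMeasure m (u ∘ ψ) atTop f := by
    have h : TendstoInMeasure m u atTop f := by
      simpa using hlim univ MeasurableSet.univ (measure_lt_top m univ)
    exact h.comp hψ.tendsto_atTop
  obtain ⟨c, hc, -⟩ := ApproxGrad.exists_of_bounded (m := m) (q := q) hδ hq_one hq_top subset_rfl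
    (convex_lipB hδ) (fun n => hu (ψ n)) hf'
    (a := fun n => (memLp_lipSlope (hu (ψ n))).toLp _)
    (fun n => (memLp_lipSlope (hu (ψ n))).coeFn_toLp.ge) (lam := (C ^ (1 / q.toReal)).toReal)
    (fun r hr => Eventually.of_forall fun n => by
      refine le_trans ?_ hr.le
      rw [Lp.norm_toLp]
      refine ENNReal.toReal_mono (ENNReal.rpow_ne_top_of_nonneg (by positivity) hC2.ne) ?_
      rw [eLpNorm_eq_lintegral_rpow_enorm_toReal hq0 hq_top]
      gcongr
      refine le_trans (le_of_eq ?_) (hψC n).le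
      refine lintegral_congr fun x => ?_
      rw [Real.enorm_eq_ofReal (lipSlope_nonneg _ _), lipSlope,
        ENNReal.ofReal_toReal (asympLip_ne_top (hu _) _)])
  exact ⟨c, hc⟩

/-- Each approximant `u n` has the bound `max (lip (u n)) G` relative to `𝒜`, and these converge to
`G` in `L^q`; closedness concludes. -/
theorem ApproxGrad.of_lipB {𝒜 : Set (X → ℝ)} {f G : X → ℝ}
    (h𝒜 : ∀ u ∈ lipB δ, ApproxGrad δ m q 𝒜 u (lipSlope δ u)) (h : ApproxGrad δ m q (lipB δ) f G) :
    ApproxGrad δ m q 𝒜 f G := by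
  obtain ⟨u, hu, hae, hs⟩ := h.exists_seq
  have hpp : ∀ n, MemLp (fun x => max (lipSlope δ (u n) x) (G x)) q m := fun n =>
    (memLp_lipSlope (hu n)).sup h.1
  refine ApproxGrad.closed (fun n => (h𝒜 _ (hu n)).mono (hpp n)
    (ae_of_all _ fun x => le_max_left _ _)) ?_ h.1 ?_
  · exact tendstoInMeasure_of_tendsto_ae (fun n => (hu n).1.measurable.aestronglyMeasurable) hae
  · refine hs.congr fun n => congrArg (fun φ => eLpNorm φ q m) (funext fun x => ?_)
    rw [max_sub_sub_right _ _ (G x) |>.symm, sub_self]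

/-- Once every bounded `δ`-Lipschitz function admits its slope as a gradient bound with respect to
`𝒜`, the set `𝒜` is dense in energy. -/
theorem denseInEnergy_of_approxGrad (hδ : IsDistance δ) (hq_one : 1 < q) (hq_top : q ≠ ∞)
    {𝒜 : Set (X → ℝ)} (hsub : 𝒜 ⊆ lipB δ) (hconv : Convex ℝ 𝒜)
    (h𝒜 : ∀ u ∈ lipB δ, ApproxGrad δ m q 𝒜 u (lipSlope δ u)) : DenseInEnergy δ m q 𝒜 := by
  intro f hf
  obtain ⟨G₀, hG₀⟩ := exists_approxGrad_of_mem_D1 hδ hq_one hq_top hf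
  obtain ⟨c, hc, hmin⟩ := (hG₀.of_lipB h𝒜).exists_min hδ hq_one hq_top hsub hconv
  obtain ⟨u, hu, hae, hs⟩ := hc.exists_seq
  have hmem : ∀ n, MemLp (lipSlope δ (u n)) q m := fun n => memLp_lipSlope (hsub (hu n))
  have hpp : ∀ n, MemLp (fun x => max (lipSlope δ (u n) x) (c x)) q m := fun n =>
    (hmem n).sup (Lp.memLp c)
  set a : ℕ → Lp ℝ q m := fun n => (hmem n).toLp with ha
  set g : ℕ → Lp ℝ q m := fun n => (hpp n).toLp with hg
  have hg_lim : Tendsto g atTop (𝓝 c) := by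
    rw [Lp.tendsto_Lp_iff_tendsto_eLpNorm']
    refine hs.congr fun n => eLpNorm_congr_ae ?_
    filter_upwards [(hpp n).coeFn_toLp] with x hx
    rw [Pi.sub_apply, hx, max_sub_sub_right _ _ (c x) |>.symm, sub_self]
  have ha0 : ∀ n, 0 ≤ᵐ[m] a n := fun n => by
    filter_upwards [(hmem n).coeFn_toLp] with x hx
    rw [hx]
    exact lipSlope_nonneg _ _
  have hag : ∀ n, a n ≤ᵐ[m] g n := fun n => by
    filter_upwards [(hmem n).coeFn_toLp, (hpp n).coeFn_toLp] with x hx hx'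
    rw [hx, hx']
    exact le_max_left _ _
  have hmeas : TendstoInMeasure m u atTop f :=
    tendstoInMeasure_of_tendsto_ae (fun n => (hsub (hu n)).1.measurable.aestronglyMeasurable) hae
  -- The lower bound is minimality: slopes with norms at most `r < ‖c‖` along a subsequence would
  -- produce a smaller gradient bound. The upper bound comes from `a n ≤ g n → c`.
  have hnorm : Tendsto (fun n => ‖a n‖) atTop (𝓝 ‖c‖) := by
    refine tendsto_order.2 ⟨fun r hr => ?_, fun r hr => ?_⟩
    · by_contra hcon
      obtain ⟨ψ, hψ, hbad⟩ := extraction_of_frequently_atTop (not_eventually.1 hcon)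
      obtain ⟨c', hc', hle⟩ := ApproxGrad.exists_of_bounded (a := fun n => a (ψ n)) hδ hq_one
        hq_top hsub hconv (fun n => hu (ψ n)) (hmeas.comp hψ.tendsto_atTop)
        (fun n => (hmem (ψ n)).coeFn_toLp.ge) (lam := r)
        (fun r' hr' => Eventually.of_forall fun n => (not_lt.1 (hbad n)).trans hr'.le)
      linarith [hmin c' hc']
    · filter_upwards [hg_lim.norm.eventually_lt_const hr] with n hn
      refine lt_of_le_of_lt (Lp.norm_le_norm_of_ae_le ?_) hn
      filter_upwards [ha0 n, hag n] with x h1 h2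
      have h1' : 0 ≤ a n x := h1
      rw [Real.norm_of_nonneg h1', Real.norm_of_nonneg (h1'.trans h2)]
      exact h2
  have ha_lim := tendsto_of_le_of_tendsto_norm hq_top ha0 hag hg_lim hnorm
  refine ⟨c, ⟨⟨u, hmem, c, fun n => hsub (hu n),
    tendstoL0_of_tendsto_ae (fun n => (hsub (hu n)).1) hae,
    fun φ => (φ.continuous.tendsto c).comp ha_lim, EventuallyLE.refl _ _⟩, fun G' hG' => ?_⟩,
    u, hmem, hu, hae, ha_lim⟩
  -- The competitor is relaxed with respect to all of `lipB δ`, while `c` is minimal for `𝒜`;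
  -- transferring its bound to `𝒜` makes the two comparable.
  exact hmin G' ((hG'.approxGrad hδ subset_rfl (convex_lipB hδ)).of_lipB h𝒜)

end

end MetricSobolev

theorem mainTheorem8 {X : Type*} [MetricSpace X] [CompleteSpace X]
    [TopologicalSpace.SeparableSpace X] [MeasurableSpace X] [BorelSpace X]
    (m : Measure X) [IsFiniteMeasure m]
    (q : ℝ≥0∞) [Fact (1 ≤ q)] (hq_one : 1 < q) (hq_top : q ≠ ∞)
    (A : Subalgebra ℝ (X → ℝ))
    (hA_lip : (A : Set (X → ℝ)) ⊆ MetricSobolev.lipB (fun x y : X => edist x y))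
    (hA_sep : (A : Set (X → ℝ)).SeparatesPoints)
    (δ : X → X → ℝ≥0∞) (hδ : MetricSobolev.IsDistance δ)
    (hδ_sep : MetricSobolev.IsSeparableDist δ)
    (hδ_top : MetricSobolev.InducesTopology δ)
    (hδ_lower : ∀ x y, min (edist x y) 1 ≤ δ x y)
    (hδ_upper : ∀ x y, δ x y ≤ MetricSobolev.lengthDist x y)
    (Y : Set X) (hY_count : Y.Countable) (hY_dense : Dense Y)
    (hY : ∀ y ∈ Y, MetricSobolev.distFrom m y ∈ MetricSobolev.D1 δ m q A ∧
      ∃ G : Lp ℝ q m,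
        MetricSobolev.IsMinRelaxedGradient δ m q A (MetricSobolev.distFrom m y) G ∧
        ∀ᵐ x ∂m, G x ≤ 1) :
    MetricSobolev.DenseInEnergy δ m q A := by
  have : SecondCountableTopology X := UniformSpace.secondCountable_of_separable X
  have hA := hA_lip.trans (MetricSobolev.lipB_edist_subset hδ hδ_lower)
  have hconv := MetricSobolev.convex_subalgebra A
  have hY' : ∀ y ∈ Y, MetricSobolev.ApproxGrad δ m q A (fun x => dist y x) fun _ => 1 := by
    intro y hy
    obtain ⟨_, G, hG, hG1⟩ := hY y hy
    exact ((hG.1.approxGrad hδ hA hconv).congr (AEEqFun.coeFn_mk _ _)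
      (ae_eq_refl _)).mono (memLp_const 1) hG1
  exact MetricSobolev.denseInEnergy_of_approxGrad hδ hq_one hq_top hA hconv fun u hu =>
    MetricSobolev.ApproxGrad.of_mem_lipB hδ hδ_upper hq_one hq_top hA
      (fun _ _ hF => MetricSobolev.ApproxGrad.of_lipschitzWith hδ hq_top hA hY_count hY_dense
        hY' hF) hu
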